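/- **Conventions.** A function $\varepsilon:\mathbb{N}\to\mathbb{R}$ is negligible if $\lambda^c\varepsilon(\lambda)\to 0$ as $\lambda\to\infty$ for every $c\in\mathbb{N}$. A generalized quantum circuit acts on a register of qubits by gates from $\{H, T, \mathrm{CNOT}\}$; some of its input qubits may be initialized to $|0\rangle$ and some of its output qubits may be traced out at the end. Its size is the number of gates plus the numbers of input and output qubits. A quantum polynomial-time (QPT) algorithm is a family $(A_\lambda)_{\lambda\in\mathbb{N}}$ of such circuits whose size is bounded by a polynomial in $\lambda$; a non-uniform QPT distinguisher is such a family with one-bit output, where $A_\lambda$ receives in addition an arbitrary density matrix $\rho_\lambda$ as advice. An oracle distinguisher $A^{|f\rangle}$, for $f:\{0,1\}^n\to\{0,1\}$, may in addition use gates $|x\rangle|a\rangle\mapsto|x\rangle|a\oplus f(x)\rangle$, each counted as one gate. Let $n:\mathbb{N}\to\mathbb{N}$ be bounded by a polynomial. A family $F=(F_\lambda)$, $F_\lambda:\{0,1\}^\lambda\times\{0,1\}^{n(\lambda)}\to\{0,1\}$, is a *quantum-query secure PRF* if it is computed by a deterministic polynomial-time Turing machine and for every non-uniform QPT oracle distinguisher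 $(A_\lambda,\rho_\lambda)_\lambda$ there is a negligible $\varepsilon$ such that for all $\lambda$ $$\Big|\Pr_{k\leftarrow\{0,1\}^\lambda}\big[A_\lambda^{|F_\lambda(k,\cdot)\rangle}(\rho_\lambda)=1\big]-\Pr_{f}\big[A_\lambda^{|f\rangle}(\rho_\lambda)=1\big]\Big|\le\varepsilon(\lambda),$$ where $f$ is a uniformly random function $\{0,1\}^{n(\lambda)}\to\{0,1\}$. A QPT algorithm $G$, where $G_\lambda$ maps $\lambda$ qubits to $n(\lambda)$ qubits, is an *$n$-qubit PRS generator* if (i) for all $\lambda$ and all $k\in\{0,1\}^\lambda$ the output $G_\lambda(k)$ is a pure state, and (ii) for every polynomially bounded $t:\mathbb{N}\to\mathbb{N}$ and every non-uniform QPT distinguisher $(A_\lambda,\rho_\lambda)_\lambda$ there is a negligible $\varepsilon$ such that for all $\lambda$ $$\Big|\Pr_{k\leftarrow\{0,1\}^\lambda}\big[A_\lambda(G_\lambda(k)^{\otimes t(\lambda)},\rho_\lambda)=1\big]-\Pr_{|\vartheta\rangle}\big[A_\lambda(|\vartheta\rangle\langle\vartheta|^{\otimes t(\lambda)},\rho_\lambda)=1\big]\Big|\le\varepsilon(\lambda),$$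 where $|\vartheta\rangle$ is a Haar-random $n(\lambda)$-qubit pure state. **Theorem.** Let $n:\mathbb{N}\to\mathbb{N}$ be polynomially bounded with $n(\lambda)=\omega(\log\lambda)$, and let $F_\lambda:\{0,1\}^\lambda\times\{0,1\}^{n(\lambda)}\to\{0,1\}$ be a quantum-query secure PRF. Put $$|\psi_k\rangle=2^{-n(\lambda)/2}\sum_{x\in\{0,1\}^{n(\lambda)}}(-1)^{F_\lambda(k,x)}|x\rangle\qquad(k\in\{0,1\}^\lambda).$$ Then $k\mapsto|\psi_k\rangle$ is an $n$-qubit PRS generator: there is a QPT algorithm $G$ with $G_\lambda(k)=|\psi_k\rangle\langle\psi_k|$ for all $\lambda$ and $k$, and $G$ is an $n$-qubit PRS generator. -/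

import Mathlib

open scoped Matrix ComplexOrder

noncomputable section

namespace QCrypto

/-! ### Asymptotics and averages -/

/-- `s` is bounded by a polynomial in the security parameter. -/
def PolyBounded (s : ℕ → ℕ) : Prop :=
  ∃ p : Polynomial ℕ, ∀ l, s l ≤ p.eval l

/-- `ε` decays faster than every inverse polynomial. -/
def Negligible (ε : ℕ → ℝ) : Prop :=
  Asymptotics.SuperpolynomialDecay Filter.atTop (fun l : ℕ => (l : ℝ)) ε

/-- Expectation over a uniformly random element of a finite type. -/
def uniformAvg {α : Type} [Fintype α] (p : α → ℝ) : ℝ :=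
  (∑ a, p a) / Fintype.card α

/-! ### Quantum states

Qubit registers are indexed by a type `ι`; the computational basis is `ι → Bool`. -/

/-- Operators on the register with qubits labelled by `ι`. -/
abbrev Op (ι : Type) : Type := Matrix (ι → Bool) (ι → Bool) ℂ

/-- Density matrices: positive semidefinite of trace one. -/
def IsDensity {ι : Type} [Fintype ι] [DecidableEq ι] (ρ : Op ι) : Prop :=
  ρ.PosSemidef ∧ ρ.trace = 1

/-- The Hilbert space of `n` qubits. -/
abbrev Ket (n : ℕ) : Type := EuclideanSpace ℂ (Fin n → Bool)

/-- `|ψ⟩⟨ψ|`. -/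
def pureState {n : ℕ} (ψ : Ket n) : Op (Fin n) :=
  Matrix.of fun z w => ψ z * star (ψ w)

/-- `|k⟩⟨k|`. -/
def basisState {n : ℕ} (k : Fin n → Bool) : Op (Fin n) :=
  Matrix.single k k 1

/-- `σ^{⊗ t} ⊗ ρ`, for `σ` on `n` qubits and `ρ` on `a` qubits. -/
def copiesWithAdvice {n a : ℕ} (t : ℕ) (σ : Op (Fin n)) (ρ : Op (Fin a)) :
    Op ((Fin t × Fin n) ⊕ Fin a) :=
  Matrix.of fun z w =>
    (∏ j : Fin t, σ (fun i => z (Sum.inl (j, i))) (fun i => w (Sum.inl (j, i)))) *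
      ρ (fun i => z (Sum.inr i)) (fun i => w (Sum.inr i))

/-- The uniform (Haar) probability measure on the unit vectors of the `n`-qubit space. -/
def haarState (n : ℕ) : MeasureTheory.Measure (Metric.sphere (0 : Ket n) 1) :=
  ((MeasureTheory.volume : MeasureTheory.Measure (Ket n)).toSphere Set.univ)⁻¹ •
    (MeasureTheory.volume : MeasureTheory.Measure (Ket n)).toSphere

instance haarState_isProbabilityMeasure (n : ℕ) :
    MeasureTheory.IsProbabilityMeasure (haarState n) := by
  constructor
  have h0 : (MeasureTheory.volume : MeasureTheory.Measure (Ket n)).toSphere Set.univ ≠ 0 := by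
    rw [Ne, MeasureTheory.Measure.measure_univ_eq_zero]
    exact MeasureTheory.Measure.toSphere_ne_zero _
  simp only [haarState, MeasureTheory.Measure.smul_apply, smul_eq_mul]
  exact ENNReal.inv_mul_cancel h0 (MeasureTheory.measure_ne_top _ _)

/-! ### Circuits over the gate set `{H, T, CNOT}`, possibly with oracle gates -/

/-- Gates acting on a register of `N` qubits. -/
inductive Gate (N : ℕ) : Type
  | H (i : Fin N)
  | T (i : Fin N)
  | CNOT (c t : Fin N) (h : c ≠ t)

/-- The unitary operator of a gate. -/
def Gate.op {N : ℕ} : Gate N → Op (Fin N)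
  | .H i => Matrix.of fun z w =>
      if ∀ j, j ≠ i → z j = w j then
        ((Real.sqrt 2 : ℂ))⁻¹ * (if z i = true ∧ w i = true then -1 else 1)
      else 0
  | .T i => Matrix.diagonal fun z =>
      if z i = true then Complex.exp (Complex.I * (Real.pi / 4)) else 1
  | .CNOT c t _ => Matrix.of fun z w =>
      if z = Function.update w t (xor (w t) (w c)) then 1 else 0

/-- Gates of an algorithm that may query a Boolean function of `n` bits in superposition; a query
acts on `n` query qubits `x` and on a further answer qubit `y`. -/
inductive OracleGate (n N : ℕ) : Type
  | gate (g : Gate N)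
  | query (x : Fin n ↪ Fin N) (y : Fin N) (h : ∀ i, x i ≠ y)

/-- The operator of a gate relative to the oracle `|x⟩|a⟩ ↦ |x⟩|a ⊕ f x⟩`. -/
def OracleGate.op {n N : ℕ} (f : (Fin n → Bool) → Bool) : OracleGate n N → Op (Fin N)
  | .gate g => g.op
  | .query x y _ => Matrix.of fun z w =>
      if z = Function.update w y (xor (w y) (f fun i => w (x i))) then 1 else 0

/-- A generalized circuit with gates from `g`, input register `ι` and output register `κ`. The
qubits outside the range of `inp` start in state zero, and those outside the range of `out`
are traced out at the end. The head of the list `gates` is applied first. -/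
structure Circuit (g : ℕ → Type) (ι κ : Type) where
  width : ℕ
  gates : List (g width)
  inp : ι ↪ Fin width
  out : κ ↪ Fin width

/-- The number of gates plus the number of input and output qubits (where the qubits that start
in zero and the qubits that are traced out are counted too). -/
def Circuit.size {g : ℕ → Type} {ι κ : Type} (C : Circuit g ι κ) : ℕ :=
  C.gates.length + C.width + C.width

/-- `ρ` on the qubits in the range of `e`, and zero on all other qubits. -/
def padZero {ι : Type} {N : ℕ} (e : ι ↪ Fin N) (ρ : Op ι) : Op (Fin N) :=
  open Classical in
  Matrix.of fun z w =>
    if ∀ j, j ∉ Set.range e → z j = false ∧ w j = false then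
      ρ (fun i => z (e i)) (fun i => w (e i))
    else 0

/-- The partial trace over the qubits outside the range of `e`. -/
def traceOut {κ : Type} {N : ℕ} (e : κ ↪ Fin N) (M : Op (Fin N)) : Op κ :=
  open Classical in
  Matrix.of fun u v =>
    ∑ z : Fin N → Bool, ∑ w : Fin N → Bool,
      if (∀ i, z (e i) = u i) ∧ (∀ i, w (e i) = v i) ∧ ∀ j, j ∉ Set.range e → z j = w j then
        M z w
      else 0

/-- The unitary part of a circuit, where `op` interprets the gates. -/
def Circuit.unitary {g : ℕ → Type} {ι κ : Type} (op : ∀ {N}, g N → Op (Fin N))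
    (C : Circuit g ι κ) : Op (Fin C.width) :=
  C.gates.foldl (fun U γ => op γ * U) 1

/-- The channel computed by a circuit, where `op` interprets the gates. -/
def Circuit.channel {g : ℕ → Type} {ι κ : Type} (op : ∀ {N}, g N → Op (Fin N))
    (C : Circuit g ι κ) (ρ : Op ι) : Op κ :=
  traceOut C.out (C.unitary op * padZero C.inp ρ * (C.unitary op)ᴴ)

/-- The output of an oracle-free circuit. -/
def Circuit.run {ι κ : Type} (C : Circuit Gate ι κ) (ρ : Op ι) : Op κ :=
  C.channel Gate.op ρ

/-- The output of an oracle circuit with superposition access to `f`. -/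
def Circuit.runWith {n : ℕ} {ι κ : Type} (C : Circuit (OracleGate n) ι κ)
    (f : (Fin n → Bool) → Bool) (ρ : Op ι) : Op κ :=
  C.channel (OracleGate.op f) ρ

/-- The probability that measuring a one-qubit state yields `1`. -/
def prOne (ρ : Op Unit) : ℝ :=
  (ρ (fun _ => true) (fun _ => true)).re

/-! ### Pseudorandom functions -/

/-- A pair of a key and an input as a word; key bits and input bits are tagged apart. -/
def encodeKeyInput {n : ℕ → ℕ} (a : Σ l : ℕ, (Fin l → Bool) × (Fin (n l) → Bool)) :
    List (Bool ⊕ Bool) :=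
  (List.ofFn a.2.1).map Sum.inl ++ (List.ofFn a.2.2).map Sum.inr

/-- `F` is computed by one deterministic Turing machine in polynomial time. -/
def IsPolyTime (n : ℕ → ℕ) (F : ∀ l, (Fin l → Bool) → (Fin (n l) → Bool) → Bool) : Prop :=
  Nonempty (Turing.TM2ComputableInPolyTime (encodeKeyInput (n := n)) Computability.encodeBool
    (fun a => F a.1 a.2.1 a.2.2))

/-- Indistinguishability of `F l k`, for uniform `k`, from a uniformly random function, against
all polynomial-size oracle circuits with quantum advice that query in superposition. -/
def IsQuantumQuerySecure (n : ℕ → ℕ) (F : ∀ l, (Fin l → Bool) → (Fin (n l) → Bool) → Bool) :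
    Prop :=
  ∀ (a : ℕ → ℕ) (ρ : ∀ l, Op (Fin (a l)))
    (A : ∀ l, Circuit (OracleGate (n l)) (Fin (a l)) Unit),
    (∀ l, IsDensity (ρ l)) → PolyBounded (fun l => (A l).size) →
    ∃ ε : ℕ → ℝ, Negligible ε ∧ ∀ l,
      |uniformAvg (fun k : Fin l → Bool => prOne ((A l).runWith (F l k) (ρ l))) -
        uniformAvg (fun f : (Fin (n l) → Bool) → Bool => prOne ((A l).runWith f (ρ l)))| ≤ ε l

/-- Quantum-query secure pseudorandom functions with key length `l`, input length `n l` and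
one-bit output. -/
structure IsQuantumQueryPRF (n : ℕ → ℕ)
    (F : ∀ l, (Fin l → Bool) → (Fin (n l) → Bool) → Bool) : Prop where
  polyTime : IsPolyTime n F
  secure : IsQuantumQuerySecure n F

/-! ### Pseudorandom states -/

/-- Pseudorandom state generators with key length `l` and output length `n l`. -/
structure IsPRSGenerator (n : ℕ → ℕ) (G : ∀ l, Circuit Gate (Fin l) (Fin (n l))) : Prop where
  polySize : PolyBounded (fun l => (G l).size)
  stateGeneration : ∀ l (k : Fin l → Bool), ∃ ψ : Ket (n l),
    ‖ψ‖ = 1 ∧ (G l).run (basisState k) = pureState ψ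
  pseudorandom : ∀ (t a : ℕ → ℕ) (ρ : ∀ l, Op (Fin (a l)))
    (A : ∀ l, Circuit Gate ((Fin (t l) × Fin (n l)) ⊕ Fin (a l)) Unit),
    PolyBounded t → (∀ l, IsDensity (ρ l)) → PolyBounded (fun l => (A l).size) →
    ∃ ε : ℕ → ℝ, Negligible ε ∧ ∀ l,
      |uniformAvg (fun k : Fin l → Bool =>
          prOne ((A l).run (copiesWithAdvice (t l) ((G l).run (basisState k)) (ρ l)))) -
        ∫ θ, prOne ((A l).run (copiesWithAdvice (t l) (pureState (θ : Ket (n l))) (ρ l)))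
          ∂haarState (n l)| ≤ ε l

/-- The binary phase state `2^{-n/2} ∑ₓ (-1)^{f x} |x⟩`. -/
def binaryPhase {n : ℕ} (f : (Fin n → Bool) → Bool) : Ket n :=
  WithLp.toLp 2 fun x => ((Real.sqrt (2 ^ n) : ℝ) : ℂ)⁻¹ * (-1) ^ (f x).toNat

end QCrypto

end

open scoped Matrix ComplexOrder

noncomputable section

namespace QCrypto

/-! ### Tuples with a repeated entry -/

/-! Two comparisons pass through one hybrid, the phase state of a truly random function.

PRF against random function. A phase state is prepared from oracle access to `f` by Hadamards and
phase kickback, so any distinguisher on `t` copies becomes, with exactly the same acceptance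
probability, an oracle distinguisher with `2 * t` queries (`exists_oracle_circuit`). PRF security
bounds its advantage.

Random function against Haar, for any effect `M` on `t` copies. Let `N = 2 ^ n`, and consider the
matrix of mean products of coordinates of `θ^{⊗ t}`, indexed by `t`-tuples of basis vectors. For
both distributions its entries involving a tuple without repetition have the same shape: a constant
when the two tuples are permutations of each other, and zero otherwise. Vanishing follows from
invariance under changing the sign of one coordinate, and constancy from permutation symmetry in the
Haar case and from equal moduli in the phase case (`SymmetricMoments`). The two injective blocks are
therefore proportional. Everything else has trace equal to the collision weight, the chance that `t`
samples from the distribution `‖θ b‖ ^ 2` repeat, which is at most `t ^ 2` times the mean of `∑ ‖θ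
b‖ ^ 4`. As all traces are one, the collision weights also control the gap between the two
constants, so they bound the whole distance (`SymmetricMoments.abs_integral_sub_integral_le`). The
mean fourth powers sum to `1 / N` for phase states and to at most `2 / N` for Haar states. The
latter bound comes from unitary invariance alone: a Hadamard rotation in the plane of two
coordinates, averaged over four phases, shows that the fourth moment of a coordinate is twice the
mixed second moment, and the mixed moments add up to one. The distance is thus at most `6 * t ^ 2 /
N`, negligible because `n` outgrows `log`.

Generation. A polynomial-time stack machine is unrolled into NAND programs of polynomial length
(`IsPolyTime.computes`): a step depends on and changes only boundedly many cells at the top of each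
stack, so finitely many indicator wires per cell suffice. The program is run reversibly on a
superposition of inputs, a `Z` is applied to the result wire, and the program is uncomputed, which
returns all scratch qubits to zero and leaves a pure state (`exists_circuit_binaryPhase`). -/

lemma sum_prod_mul_eq_eq {β : Type*} [Fintype β] [DecidableEq β] {t : ℕ} (p : β → ℝ)
    (h1 : ∑ b, p b = 1) {i j : Fin t} (hij : i ≠ j) :
    ∑ x : Fin t → β, (if x i = x j then ∏ k, p (x k) else 0) = ∑ b, p b ^ 2 := by
  -- Requiring both coordinates to equal `b` is a product of conditions on single coordinates, so
  -- the weight factorises: `p b` at `i` and at `j`, total mass one elsewhere.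
  have key : ∀ b, ∑ x : Fin t → β, (∏ k, if k = i ∨ k = j then (if x k = b then p b else 0)
      else p (x k)) = p b ^ 2 := by
    intro b
    have := (Fintype.prod_sum (fun (k : Fin t) (a : β) =>
      if k = i ∨ k = j then (if a = b then p b else 0) else p a))
    rw [← this]
    have h2 : ∀ k : Fin t, (∑ a, if k = i ∨ k = j then (if a = b then p b else 0) else p a)
        = if k ∈ ({i, j} : Finset (Fin t)) then p b else 1 := by
      intro k
      by_cases hk : k = i ∨ k = j <;> simp [hk, h1]
    rw [Finset.prod_congr rfl fun k _ => h2 k, Finset.prod_ite_mem, Finset.univ_inter,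
      Finset.prod_const, Finset.card_pair hij]
  rw [← Finset.sum_congr rfl fun b _ => key b, Finset.sum_comm]
  refine Finset.sum_congr rfl fun x _ => ?_
  split_ifs with h
  · rw [Finset.sum_eq_single (x i)]
    · refine Finset.prod_congr rfl fun k _ => ?_
      by_cases hk : k = i ∨ k = j
      · rcases hk with rfl | rfl <;> simp [h]
      · simp [hk]
    · intro b _ hb
      exact Finset.prod_eq_zero (Finset.mem_univ i) (by simp [Ne.symm hb])
    · simp
  · symm
    refine Finset.sum_eq_zero fun b _ => ?_
    by_cases hb : x i = b
    · exact Finset.prod_eq_zero (Finset.mem_univ j) (by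
        have : x j ≠ b := fun h' => h (hb.trans h'.symm)
        simp [this])
    · exact Finset.prod_eq_zero (Finset.mem_univ i) (by simp [hb])

open Classical in
-- Birthday bound: a union bound over ordered pairs of positions, each pair colliding with weight `∑
-- b, p b ^ 2`.
lemma sum_prod_not_injective_le {β : Type*} [Fintype β] {t : ℕ} (p : β → ℝ)
    (h0 : ∀ b, 0 ≤ p b) (h1 : ∑ b, p b = 1) :
    ∑ x : Fin t → β, (if Function.Injective x then 0 else ∏ k, p (x k)) ≤
      t ^ 2 * ∑ b, p b ^ 2 := by
  have hprod : ∀ x : Fin t → β, 0 ≤ ∏ k, p (x k) := fun x => Finset.prod_nonneg fun k _ => h0 _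
  calc ∑ x : Fin t → β, (if Function.Injective x then 0 else ∏ k, p (x k))
      ≤ ∑ x : Fin t → β, ∑ i : Fin t, ∑ j : Fin t,
          (if i ≠ j then (if x i = x j then ∏ k, p (x k) else 0) else 0) := by
        refine Finset.sum_le_sum fun x _ => ?_
        have hnn : ∀ i j : Fin t,
            0 ≤ (if i ≠ j then (if x i = x j then ∏ k, p (x k) else 0) else 0) := by
          intro i j
          split_ifs <;> first | exact hprod x | exact le_rfl
        split_ifs with hx
        · exact Finset.sum_nonneg fun i _ => Finset.sum_nonneg fun j _ => hnn i j
        · simp only [Function.Injective, not_forall] at hx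
          obtain ⟨i, j, hij, hne⟩ := hx
          calc ∏ k, p (x k) = (if i ≠ j then (if x i = x j then ∏ k, p (x k) else 0) else 0) := by
                rw [if_pos hne, if_pos hij]
            _ ≤ ∑ j : Fin t, (if i ≠ j then (if x i = x j then ∏ k, p (x k) else 0) else 0) :=
                Finset.single_le_sum (fun j _ => hnn i j) (Finset.mem_univ j)
            _ ≤ _ := Finset.single_le_sum
                (f := fun i => ∑ j : Fin t,
                  (if i ≠ j then (if x i = x j then ∏ k, p (x k) else 0) else 0))
                (fun i _ => Finset.sum_nonneg fun j _ => hnn i j) (Finset.mem_univ i)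
    _ = ∑ i : Fin t, ∑ j : Fin t, ∑ x : Fin t → β,
          (if i ≠ j then (if x i = x j then ∏ k, p (x k) else 0) else 0) := by
        rw [Finset.sum_comm]
        exact Finset.sum_congr rfl fun i _ => Finset.sum_comm
    _ ≤ ∑ i : Fin t, ∑ j : Fin t, ∑ b, p b ^ 2 := by
        refine Finset.sum_le_sum fun i _ => Finset.sum_le_sum fun j _ => ?_
        by_cases hij : i = j
        · simpa [hij] using Finset.sum_nonneg fun b _ => sq_nonneg (p b)
        · simp only [ne_eq, hij, not_false_eq_true, if_true]
          exact (sum_prod_mul_eq_eq p h1 hij).le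
    _ = t ^ 2 * ∑ b, p b ^ 2 := by simp; ring

lemma sum_prod_eq_one {β : Type*} [Fintype β] {t : ℕ} (p : β → ℝ) (h1 : ∑ b, p b = 1) :
    ∑ x : Fin t → β, ∏ k, p (x k) = 1 := by
  classical
  rw [← Fintype.prod_sum (fun (_ : Fin t) b => p b)]
  simp [h1]

/-! ### Moments of phase-invariant and permutation-invariant random states -/

/-- The coordinates of `θ^{⊗ t}`. -/
def tensorCoord {β : Type*} {t : ℕ} (θ : β → ℂ) (x : Fin t → β) : ℂ := ∏ i, θ (x i)

lemma normSq_tensorCoord {β : Type*} {t : ℕ} (θ : β → ℂ) (x : Fin t → β) :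
    ‖tensorCoord θ x‖ ^ 2 = ∏ i, ‖θ (x i)‖ ^ 2 := by
  simp [tensorCoord, norm_prod, Finset.prod_pow]

lemma norm_tensorCoord_le_one {β : Type*} [Fintype β] {t : ℕ} {θ : β → ℂ}
    (h : ∑ b, ‖θ b‖ ^ 2 = 1) (x : Fin t → β) : ‖tensorCoord θ x‖ ≤ 1 := by
  rw [tensorCoord, norm_prod]
  refine Finset.prod_le_one (fun _ _ => norm_nonneg _) fun i _ => ?_
  have h2 : ‖θ (x i)‖ ^ 2 ≤ 1 := h ▸ Finset.single_le_sum (f := fun b => ‖θ b‖ ^ 2)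
    (fun _ _ => sq_nonneg _) (Finset.mem_univ (x i))
  nlinarith [norm_nonneg (θ (x i))]

open MeasureTheory

open Classical in
/-- The first `t` moments of a random unit vector, restricted to tuples without repetition, are
`c` on pairs of tuples that are permutations of each other and zero otherwise. -/
structure SymmetricMoments {Ω β : Type*} [MeasurableSpace Ω] [Fintype β] (t : ℕ)
    (μ : Measure Ω) (θ : Ω → β → ℂ) (c : ℝ) : Prop where
  measurable : ∀ b, Measurable fun ω => θ ω b
  unit : ∀ ω, ∑ b, ‖θ ω b‖ ^ 2 = 1
  moment : ∀ x y : Fin t → β, Function.Injective x →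
    ∫ ω, tensorCoord (θ ω) x * star (tensorCoord (θ ω) y) ∂μ =
      if ∃ π : Equiv.Perm (Fin t), y = x ∘ π then (c : ℂ) else 0

/-- The sesquilinear form of a matrix. -/
def sesqForm {X : Type*} [Fintype X] (M : X → X → ℂ) (v : X → ℂ) : ℂ :=
  ∑ x, ∑ y, M x y * (v x * star (v y))

/-- `M` is the matrix of a positive operator bounded by the identity. -/
def IsEffect {X : Type*} [Fintype X] (M : X → X → ℂ) : Prop :=
  ∀ v : X → ℂ, 0 ≤ (sesqForm M v).re ∧ (sesqForm M v).re ≤ ∑ x, ‖v x‖ ^ 2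

/-! ### Comparing two families with symmetric moments on an effect -/

namespace SymmetricMoments

set_option linter.unusedSectionVars false

variable {Ω β : Type*} [MeasurableSpace Ω] [Fintype β] {t : ℕ} {μ : Measure Ω}
  [IsProbabilityMeasure μ] {θ : Ω → β → ℂ} {c : ℝ}

lemma integrable (h : SymmetricMoments t μ θ c) (x y : Fin t → β) :
    Integrable (fun ω => tensorCoord (θ ω) x * star (tensorCoord (θ ω) y)) μ := by
  have hm : ∀ x : Fin t → β, Measurable fun ω => tensorCoord (θ ω) x := fun x =>
    Finset.measurable_prod _ fun i _ => h.measurable (x i)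
  refine Integrable.of_bound (C := 1)
    ((hm x).mul (continuous_star.measurable.comp (hm y))).aestronglyMeasurable
    (Filter.Eventually.of_forall fun ω => ?_)
  rw [norm_mul, norm_star]
  exact mul_le_one₀ (norm_tensorCoord_le_one (h.unit ω) x) (norm_nonneg _)
    (norm_tensorCoord_le_one (h.unit ω) y)

/-- The moment matrix. -/
def gram (t : ℕ) (μ : Measure Ω) (θ : Ω → β → ℂ) (x y : Fin t → β) : ℂ :=
  ∫ ω, tensorCoord (θ ω) x * star (tensorCoord (θ ω) y) ∂μ

/-- The weight `w` serves to cut the moment matrix into blocks: it will be the indicator of the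
tuples without repetition, or of the others. -/
lemma integral_sesqForm (h : SymmetricMoments t μ θ c) (M : (Fin t → β) → (Fin t → β) → ℂ)
    (w : (Fin t → β) → ℝ) :
    ∫ ω, (sesqForm M fun x => w x * tensorCoord (θ ω) x).re ∂μ =
      (∑ x, ∑ y, M x y * (w x * w y * gram t μ θ x y)).re := by
  have e : ∀ ω, (sesqForm M fun x => w x * tensorCoord (θ ω) x) =
      ∑ x, ∑ y, (M x y * (w x * w y)) *
        (tensorCoord (θ ω) x * star (tensorCoord (θ ω) y)) := by
    intro ω
    refine Finset.sum_congr rfl fun x _ => Finset.sum_congr rfl fun y _ => ?_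
    simp only [star_mul', Complex.star_def, Complex.conj_ofReal]
    ring
  have hint : ∀ x y, Integrable (fun ω => (M x y * (w x * w y)) *
        (tensorCoord (θ ω) x * star (tensorCoord (θ ω) y))) μ := fun x y =>
    (h.integrable x y).const_mul _
  have hI : Integrable (fun ω => sesqForm M fun x => w x * tensorCoord (θ ω) x) μ := by
    simp only [e]
    exact integrable_finsetSum _ fun x _ => integrable_finsetSum _ fun y _ => hint x y
  have hre := integral_re (𝕜 := ℂ) hI
  simp only [RCLike.re_to_complex] at hre
  rw [hre]
  congr 1
  simp only [e]
  rw [integral_finsetSum _ fun x _ => integrable_finsetSum _ fun y _ => hint x y]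
  refine Finset.sum_congr rfl fun x _ => ?_
  rw [integral_finsetSum _ fun y _ => hint x y]
  refine Finset.sum_congr rfl fun y _ => ?_
  rw [integral_const_mul, gram]
  ring

lemma integrable_sesqForm (h : SymmetricMoments t μ θ c) (M : (Fin t → β) → (Fin t → β) → ℂ)
    (w : (Fin t → β) → ℝ) :
    Integrable (fun ω => (sesqForm M fun x => w x * tensorCoord (θ ω) x).re) μ := by
  have : Integrable (fun ω => (sesqForm M fun x => w x * tensorCoord (θ ω) x)) μ := by
    have e : ∀ ω, (sesqForm M fun x => w x * tensorCoord (θ ω) x) =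
        ∑ x, ∑ y, (M x y * (w x * w y)) *
          (tensorCoord (θ ω) x * star (tensorCoord (θ ω) y)) := by
      intro ω
      refine Finset.sum_congr rfl fun x _ => Finset.sum_congr rfl fun y _ => ?_
      simp only [star_mul', Complex.star_def, Complex.conj_ofReal]
      ring
    simp only [e]
    exact integrable_finsetSum _ fun x _ => integrable_finsetSum _ fun y _ =>
      (h.integrable x y).const_mul _
  exact this.re

lemma integral_normSq (h : SymmetricMoments t μ θ c) (x : Fin t → β) :
    Integrable (fun ω => ‖tensorCoord (θ ω) x‖ ^ 2) μ ∧
      ((∫ ω, ‖tensorCoord (θ ω) x‖ ^ 2 ∂μ : ℝ) : ℂ) = gram t μ θ x x := by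
  have e : ∀ ω, tensorCoord (θ ω) x * star (tensorCoord (θ ω) x) =
      ((‖tensorCoord (θ ω) x‖ ^ 2 : ℝ) : ℂ) := by
    intro ω
    rw [Complex.star_def, Complex.mul_conj, Complex.normSq_eq_norm_sq]
  constructor
  · have := (h.integrable x x).re
    simpa only [e, RCLike.re_to_complex, Complex.ofReal_re] using this
  · rw [gram]
    simp only [e]
    exact integral_ofReal.symm

open Classical in
/-- The total weight of the tuples with a repetition. -/
def collision (t : ℕ) (μ : Measure Ω) (θ : Ω → β → ℂ) : ℝ :=
  ∑ x : Fin t → β, if Function.Injective x then 0 else ∫ ω, ‖tensorCoord (θ ω) x‖ ^ 2 ∂μ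

open Classical in
-- The birthday bound applied pointwise to the probability weights `‖θ ω b‖ ^ 2`, then integrated.
lemma collision_le (h : SymmetricMoments t μ θ c) :
    collision t μ θ ≤ t ^ 2 * ∫ ω, ∑ b, ‖θ ω b‖ ^ 4 ∂μ := by
  have hi : Integrable (fun ω => ∑ b, ‖θ ω b‖ ^ 4) μ := by
    refine Integrable.of_bound (C := ∑ b : β, 1) ?_ (Filter.Eventually.of_forall fun ω => ?_)
    · exact (Finset.measurable_sum _ fun b _ => (h.measurable b).norm.pow_const 4).aestronglyMeasurable
    · rw [Real.norm_of_nonneg (Finset.sum_nonneg fun b _ => by positivity)]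
      refine Finset.sum_le_sum fun b _ => ?_
      have h2 : ‖θ ω b‖ ^ 2 ≤ 1 := h.unit ω ▸ Finset.single_le_sum (f := fun b => ‖θ ω b‖ ^ 2)
        (fun _ _ => sq_nonneg _) (Finset.mem_univ b)
      nlinarith [sq_nonneg (‖θ ω b‖)]
  have hterm : ∀ x : Fin t → β, Integrable
      (fun ω => if Function.Injective x then 0 else ‖tensorCoord (θ ω) x‖ ^ 2) μ := by
    intro x
    by_cases hx : Function.Injective x
    · simp [hx]
    · simpa [hx] using (h.integral_normSq x).1
  have e : collision t μ θ = ∫ ω, ∑ x : Fin t → β,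
      (if Function.Injective x then 0 else ‖tensorCoord (θ ω) x‖ ^ 2) ∂μ := by
    rw [integral_finsetSum _ fun x _ => hterm x]
    refine Finset.sum_congr rfl fun x _ => ?_
    split_ifs <;> simp
  rw [e, ← integral_const_mul]
  refine integral_mono (integrable_finsetSum _ fun x _ => hterm x) (hi.const_mul _) fun ω => ?_
  have := sum_prod_not_injective_le (t := t) (fun b => ‖θ ω b‖ ^ 2) (fun b => sq_nonneg _)
    (h.unit ω)
  simp only [normSq_tensorCoord]
  refine this.trans_eq (congrArg _ (Finset.sum_congr rfl fun b _ => ?_))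
  ring

open Classical in
-- The moment matrix has trace one and each injective tuple contributes `c` to it. This ties `c` to
-- the collision weight.
lemma card_injective_mul (h : SymmetricMoments t μ θ c) :
    (∑ x : Fin t → β, if Function.Injective x then c else 0) = 1 - collision t μ θ := by
  have h1 : ∑ x : Fin t → β, ∫ ω, ‖tensorCoord (θ ω) x‖ ^ 2 ∂μ = 1 := by
    rw [← integral_finsetSum _ fun x _ => (h.integral_normSq x).1]
    simp only [normSq_tensorCoord]
    rw [integral_congr_ae (Filter.Eventually.of_forall fun ω =>
      sum_prod_eq_one (t := t) (fun b => ‖θ ω b‖ ^ 2) (h.unit ω))]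
    simp
  rw [eq_sub_iff_add_eq, ← h1, collision, ← Finset.sum_add_distrib]
  refine Finset.sum_congr rfl fun x _ => ?_
  split_ifs with hx
  · have h2 := (h.integral_normSq x).2
    rw [gram, h.moment x x hx, if_pos ⟨1, by simp⟩] at h2
    rw [add_zero]
    exact_mod_cast h2.symm
  · simp

lemma collision_nonneg : 0 ≤ collision t μ θ := by
  refine Finset.sum_nonneg fun x _ => ?_
  split_ifs
  · exact le_rfl
  · exact integral_nonneg fun ω => sq_nonneg _

open Classical in
/-- The value of the form on the projector-like matrix supported on tuples without repetition. -/
def core {X : Type*} (M : (Fin t → X) → (Fin t → X) → ℂ) [Fintype X] : ℝ :=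
  (∑ x, ∑ y, M x y *
    (if Function.Injective x ∧ ∃ π : Equiv.Perm (Fin t), y = x ∘ π then 1 else 0)).re

open Classical in
-- A permutation of an injective tuple is injective, so the entries between injective and repeating
-- tuples vanish. The case where only `y` is injective reduces to the other by Hermitian symmetry.
lemma gram_of_injective (h : SymmetricMoments t μ θ c) {x y : Fin t → β}
    (hx : Function.Injective x ∨ Function.Injective y) :
    gram t μ θ x y = c * (if Function.Injective x ∧ ∃ π : Equiv.Perm (Fin t), y = x ∘ π
      then 1 else 0) := by
  by_cases hx' : Function.Injective x
  · rw [gram, h.moment x y hx']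
    simp [hx']
  · have hy := hx.resolve_left hx'
    have e : gram t μ θ x y = star (gram t μ θ y x) := by
      rw [gram, gram, Complex.star_def, ← integral_conj]
      congr 1
      ext ω
      simp [mul_comm]
    rw [e, gram, h.moment y x hy, if_neg]
    · simp [hx']
    · rintro ⟨π, rfl⟩
      exact hx' (hy.comp π.injective)

open Classical in
-- `c * core M` is the mean value of `M` on `θ^{⊗ t}` truncated to the injective tuples, a vector of
-- mean squared norm `1 - collision t μ θ`.
lemma core_bounds (h : SymmetricMoments t μ θ c) {M : (Fin t → β) → (Fin t → β) → ℂ}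
    (hM : IsEffect M) :
    0 ≤ c * core M ∧ c * core M ≤ 1 - collision t μ θ := by
  set w : (Fin t → β) → ℝ := fun x => if Function.Injective x then 1 else 0 with hw
  have e : c * core M = ∫ ω, (sesqForm M fun x => w x * tensorCoord (θ ω) x).re ∂μ := by
    rw [h.integral_sesqForm M w, core, ← Complex.re_ofReal_mul, Finset.mul_sum]
    congr 1
    refine Finset.sum_congr rfl fun x _ => ?_
    rw [Finset.mul_sum]
    refine Finset.sum_congr rfl fun y _ => ?_
    by_cases hx : Function.Injective x
    · by_cases hy : Function.Injective y
      · rw [h.gram_of_injective (Or.inl hx)]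
        simp only [hw, hx, hy, if_true]
        push_cast
        ring
      · have : ¬ ∃ π : Equiv.Perm (Fin t), y = x ∘ π := by
          rintro ⟨π, rfl⟩
          exact hy (hx.comp π.injective)
        simp [hw, hy, this]
    · simp [hw, hx]
  rw [e]
  refine ⟨integral_nonneg fun ω => (hM _).1, ?_⟩
  calc _ ≤ ∫ ω, ∑ x, ‖(w x : ℂ) * tensorCoord (θ ω) x‖ ^ 2 ∂μ := by
        refine integral_mono (h.integrable_sesqForm M w) ?_ fun ω => (hM _).2
        refine integrable_finsetSum _ fun x _ => ?_
        simp only [norm_mul, mul_pow]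
        exact (h.integral_normSq x).1.const_mul _
    _ = ∑ x, (w x) ^ 2 * ∫ ω, ‖tensorCoord (θ ω) x‖ ^ 2 ∂μ := by
        rw [integral_finsetSum]
        · refine Finset.sum_congr rfl fun x _ => ?_
          simp only [norm_mul, mul_pow, integral_const_mul]
          simp
        · intro x _
          simp only [norm_mul, mul_pow]
          exact (h.integral_normSq x).1.const_mul _
    _ = ∑ x : Fin t → β, (if Function.Injective x then c else 0) := by
        refine Finset.sum_congr rfl fun x _ => ?_
        by_cases hx : Function.Injective x
        · have h2 := (h.integral_normSq x).2
          rw [gram, h.moment x x hx, if_pos ⟨1, by simp⟩] at h2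
          simp only [hw, hx, if_true]
          rw [one_pow, one_mul]
          exact_mod_cast h2
        · simp [hw, hx]
    _ = _ := h.card_injective_mul

open Classical in
-- Since the mixed blocks vanish, the remainder is the mean value of `M` on the complementary
-- truncation, whose mean squared norm is the collision weight.
lemma integral_sub_core (h : SymmetricMoments t μ θ c) {M : (Fin t → β) → (Fin t → β) → ℂ}
    (hM : IsEffect M) :
    0 ≤ (∫ ω, (sesqForm M (tensorCoord (θ ω))).re ∂μ) - c * core M ∧
      (∫ ω, (sesqForm M (tensorCoord (θ ω))).re ∂μ) - c * core M ≤ collision t μ θ := by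
  set w : (Fin t → β) → ℝ := fun x => if Function.Injective x then 0 else 1 with hw
  have e : (∫ ω, (sesqForm M (tensorCoord (θ ω))).re ∂μ) - c * core M =
      ∫ ω, (sesqForm M fun x => w x * tensorCoord (θ ω) x).re ∂μ := by
    have h1 := h.integral_sesqForm M fun _ => 1
    simp only [Complex.ofReal_one, one_mul] at h1
    rw [h.integral_sesqForm M w, h1, core, ← Complex.re_ofReal_mul, Finset.mul_sum,
      ← Complex.sub_re, ← Finset.sum_sub_distrib]
    congr 1
    refine Finset.sum_congr rfl fun x _ => ?_
    rw [Finset.mul_sum, ← Finset.sum_sub_distrib]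
    refine Finset.sum_congr rfl fun y _ => ?_
    by_cases hx : Function.Injective x
    · rw [h.gram_of_injective (Or.inl hx)]
      simp only [hw, hx, if_true]
      push_cast
      ring
    · by_cases hy : Function.Injective y
      · rw [h.gram_of_injective (Or.inr hy)]
        simp only [hw, hy, if_true]
        push_cast
        ring
      · simp [hw, hx, hy]
  rw [e]
  refine ⟨integral_nonneg fun ω => (hM _).1, ?_⟩
  calc _ ≤ ∫ ω, ∑ x, ‖(w x : ℂ) * tensorCoord (θ ω) x‖ ^ 2 ∂μ := by
        refine integral_mono (h.integrable_sesqForm M w) ?_ fun ω => (hM _).2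
        refine integrable_finsetSum _ fun x _ => ?_
        simp only [norm_mul, mul_pow]
        exact (h.integral_normSq x).1.const_mul _
    _ = ∑ x, (w x) ^ 2 * ∫ ω, ‖tensorCoord (θ ω) x‖ ^ 2 ∂μ := by
        rw [integral_finsetSum]
        · refine Finset.sum_congr rfl fun x _ => ?_
          simp only [norm_mul, mul_pow, integral_const_mul]
          simp
        · intro x _
          simp only [norm_mul, mul_pow]
          exact (h.integral_normSq x).1.const_mul _
    _ = _ := by
        refine Finset.sum_congr rfl fun x _ => ?_
        by_cases hx : Function.Injective x <;> simp [hw, hx]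

open Classical in
/-- Two random states with symmetric moments are close on `t` copies. -/
theorem abs_integral_sub_integral_le {Ω' : Type*} [MeasurableSpace Ω'] {ν : Measure Ω'}
    [IsProbabilityMeasure ν] {η : Ω' → β → ℂ} {d : ℝ} (h : SymmetricMoments t μ θ c)
    (hc : 0 < c) (h' : SymmetricMoments t ν η d) {M : (Fin t → β) → (Fin t → β) → ℂ}
    (hM : IsEffect M) :
    |(∫ ω, (sesqForm M (tensorCoord (θ ω))).re ∂μ) -
      ∫ ω, (sesqForm M (tensorCoord (η ω))).re ∂ν| ≤
      2 * (collision t μ θ + collision t ν η) := by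
  set K : ℝ := ∑ x : Fin t → β, if Function.Injective x then 1 else 0 with hK
  have hKc : ∀ a : ℝ, (∑ x : Fin t → β, if Function.Injective x then a else 0) = a * K := by
    intro a
    rw [hK, Finset.mul_sum]
    exact Finset.sum_congr rfl fun x _ => by split_ifs <;> simp
  have h1 := h.core_bounds hM
  rw [← h.card_injective_mul, hKc] at h1
  -- The upper bound now reads `c * core M ≤ c * K`, so `c` cancels and `core M` lies between `0`
  -- and `K`. Only one of the two constants has to be positive for this.
  have b0 : 0 ≤ core M := by
    by_contra hb
    nlinarith [h1.1]
  have b1 : core M ≤ K := le_of_mul_le_mul_left h1.2 hc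
  have e1 := h.card_injective_mul
  have e2 := h'.card_injective_mul
  rw [hKc] at e1 e2
  have r1 := h.integral_sub_core hM
  have r2 := h'.integral_sub_core hM
  have n1 : 0 ≤ collision t μ θ := collision_nonneg
  have n2 : 0 ≤ collision t ν η := collision_nonneg
  -- Subtracting `c * K = 1 - collision t μ θ` from `d * K = 1 - collision t ν η` expresses the gap
  -- between the constants through the collision weights.
  have hd : |(c - d) * core M| ≤ |collision t ν η - collision t μ θ| := by
    rw [show collision t ν η - collision t μ θ = (c - d) * K by linarith, abs_mul, abs_mul]
    refine mul_le_mul_of_nonneg_left ?_ (abs_nonneg _)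
    rw [abs_of_nonneg b0, abs_of_nonneg (b0.trans b1)]
    exact b1
  have hd2 : |collision t ν η - collision t μ θ| ≤ collision t μ θ + collision t ν η := by
    rw [abs_le]; constructor <;> linarith
  have hd3 := abs_le.1 (hd.trans hd2)
  rw [abs_le]
  constructor <;> nlinarith [hd3.1, hd3.2]

end SymmetricMoments

end QCrypto

namespace QCrypto
open MeasureTheory

/-! ### Invariance of the Haar measure on states -/

/-- The action of an isometry on unit vectors. -/
def sphereMap {n : ℕ} (e : Ket n ≃ₗᵢ[ℝ] Ket n) (θ : Metric.sphere (0 : Ket n) 1) :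
    Metric.sphere (0 : Ket n) 1 :=
  ⟨e θ, by simp⟩

lemma continuous_sphereMap {n : ℕ} (e : Ket n ≃ₗᵢ[ℝ] Ket n) : Continuous (sphereMap e) :=
  Continuous.subtype_mk (e.continuous.comp continuous_subtype_val) _

open scoped Pointwise in
-- Up to a dimension factor, the sphere measure of a set is the volume of the truncated cone over
-- it; a linear isometry maps cones to cones and preserves volume.
lemma measurePreserving_sphereMap {n : ℕ} (e : Ket n ≃ₗᵢ[ℝ] Ket n) :
    MeasurePreserving (sphereMap e) (haarState n) (haarState n) := by
  have key : MeasurePreserving (sphereMap e) (volume : Measure (Ket n)).toSphere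
      (volume : Measure (Ket n)).toSphere := by
    refine ⟨(continuous_sphereMap e).measurable, ?_⟩
    ext s hs
    rw [Measure.map_apply (continuous_sphereMap e).measurable hs, Measure.toSphere_apply' _ hs,
      Measure.toSphere_apply' _ ((continuous_sphereMap e).measurable hs)]
    congr 1
    have himg : Set.Ioo (0 : ℝ) 1 • ((↑) '' (sphereMap e ⁻¹' s) : Set (Ket n)) =
        e ⁻¹' (Set.Ioo (0 : ℝ) 1 • ((↑) '' s)) := by
      ext v
      simp only [Set.mem_smul, Set.mem_image, Set.mem_preimage]
      constructor
      · rintro ⟨r, hr, _, ⟨θ, hθ, rfl⟩, rfl⟩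
        exact ⟨r, hr, _, ⟨_, hθ, rfl⟩, by simp [sphereMap]⟩
      · rintro ⟨r, hr, _, ⟨θ, hθ, rfl⟩, h⟩
        refine ⟨r, hr, _, ⟨sphereMap e.symm θ, ?_, rfl⟩, ?_⟩
        · convert hθ
          ext1
          simp [sphereMap]
        · simp only [sphereMap]
          rw [← map_smul, h, e.symm_apply_apply]
    rw [himg]
    exact (LinearIsometryEquiv.measurePreserving e).measure_preimage_emb
      e.toHomeomorph.measurableEmbedding _
  exact key.smul_measure _

lemma integral_haarState_comp {n : ℕ} {E : Type*} [NormedAddCommGroup E] [NormedSpace ℝ E]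
    (e : Ket n ≃ₗᵢ[ℝ] Ket n) (g : Ket n → E) :
    ∫ θ, g (e (θ : Ket n)) ∂haarState n = ∫ θ, g (θ : Ket n) ∂haarState n := by
  have hemb : MeasurableEmbedding (sphereMap e) := by
    refine (Homeomorph.measurableEmbedding ⟨⟨sphereMap e, sphereMap e.symm, ?_, ?_⟩,
      continuous_sphereMap e, continuous_sphereMap e.symm⟩)
    · intro θ; ext1; simp [sphereMap]
    · intro θ; ext1; simp [sphereMap]
  exact (measurePreserving_sphereMap e).integral_comp hemb
    fun θ : Metric.sphere (0 : Ket n) 1 => g θ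

lemma integrable_haarState {n : ℕ} {E : Type*} [NormedAddCommGroup E]
    {g : Ket n → E} (hg : Continuous g) :
    Integrable (fun θ : Metric.sphere (0 : Ket n) 1 => g θ) (haarState n) :=
  (hg.comp continuous_subtype_val).integrable_of_hasCompactSupport
    (HasCompactSupport.of_compactSpace _)

lemma sum_normSq_of_mem_sphere {n : ℕ} (θ : Metric.sphere (0 : Ket n) 1) :
    ∑ b, ‖(θ : Ket n) b‖ ^ 2 = 1 := by
  rw [← EuclideanSpace.norm_sq_eq, norm_eq_of_mem_sphere θ, one_pow]

/-- Multiplication of the coordinate `v` by a phase. -/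
def phaseAt {n : ℕ} (v : Fin n → Bool) (u : Circle) : Ket n ≃ₗᵢ[ℝ] Ket n :=
  LinearIsometryEquiv.piLpCongrRight 2 fun b =>
    if b = v then rotation u else LinearIsometryEquiv.refl ℝ ℂ

lemma phaseAt_apply {n : ℕ} (v : Fin n → Bool) (u : Circle) (θ : Ket n) (b : Fin n → Bool) :
    phaseAt v u θ b = (if b = v then (u : ℂ) else 1) * θ b := by
  simp only [phaseAt, LinearIsometryEquiv.piLpCongrRight_apply]
  split_ifs <;> simp

/-- Permutation of the coordinates. -/
def permuteCoord {n : ℕ} (π : Equiv.Perm (Fin n → Bool)) : Ket n ≃ₗᵢ[ℝ] Ket n :=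
  LinearIsometryEquiv.piLpCongrLeft 2 ℝ ℂ π.symm

lemma permuteCoord_apply {n : ℕ} (π : Equiv.Perm (Fin n → Bool)) (θ : Ket n)
    (b : Fin n → Bool) : permuteCoord π θ b = θ (π b) := by
  simp [permuteCoord, LinearIsometryEquiv.piLpCongrLeft_apply]

/-- The Hadamard rotation in the plane of two coordinates. -/
def hadamardPlaneLinear {n : ℕ} (x y : Fin n → Bool) : Ket n →ₗ[ℝ] Ket n where
  toFun θ := WithLp.toLp 2 fun b =>
    if b = x then ((Real.sqrt 2)⁻¹ : ℝ) * (θ x + θ y)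
    else if b = y then ((Real.sqrt 2)⁻¹ : ℝ) * (θ x - θ y) else θ b
  map_add' θ η := by
    ext b
    simp only [PiLp.add_apply]
    split_ifs <;> ring
  map_smul' r θ := by
    ext b
    simp only [PiLp.smul_apply, RingHom.id_apply, Complex.real_smul]
    split_ifs <;> ring

lemma parallelogram_sqrt_two (a b : ℂ) :
    ‖((Real.sqrt 2)⁻¹ : ℝ) * (a + b)‖ ^ 2 + ‖((Real.sqrt 2)⁻¹ : ℝ) * (a - b)‖ ^ 2 =
      ‖a‖ ^ 2 + ‖b‖ ^ 2 := by
  have h2 : ((Real.sqrt 2)⁻¹) ^ 2 = (1 / 2 : ℝ) := by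
    rw [inv_pow, Real.sq_sqrt (by norm_num)]; norm_num
  rw [norm_mul, norm_mul, mul_pow, mul_pow, Complex.norm_real, Real.norm_eq_abs, sq_abs, h2]
  have := parallelogram_law_with_norm ℝ a b
  nlinarith

lemma norm_hadamardPlaneLinear {n : ℕ} {x y : Fin n → Bool} (hxy : x ≠ y) (θ : Ket n) :
    ‖hadamardPlaneLinear x y θ‖ = ‖θ‖ := by
  have : ‖hadamardPlaneLinear x y θ‖ ^ 2 = ‖θ‖ ^ 2 := by
    rw [EuclideanSpace.norm_sq_eq, EuclideanSpace.norm_sq_eq,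
      ← Finset.add_sum_erase _ _ (Finset.mem_univ x),
      ← Finset.add_sum_erase _ _ (Finset.mem_erase.2 ⟨hxy.symm, Finset.mem_univ y⟩),
      ← Finset.add_sum_erase (a := x) (f := fun b => ‖θ b‖ ^ 2) _ (Finset.mem_univ x),
      ← Finset.add_sum_erase (a := y) (f := fun b => ‖θ b‖ ^ 2) _
        (Finset.mem_erase.2 ⟨hxy.symm, Finset.mem_univ y⟩), ← add_assoc, ← add_assoc]
    congr 1
    · simp only [hadamardPlaneLinear, LinearMap.coe_mk, AddHom.coe_mk, if_true, hxy.symm, if_false]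
      exact parallelogram_sqrt_two _ _
    · refine Finset.sum_congr rfl fun b hb => ?_
      simp only [Finset.mem_erase] at hb
      simp [hadamardPlaneLinear, hb.1, hb.2.1]
  exact (sq_eq_sq₀ (norm_nonneg _) (norm_nonneg _)).1 this

/-- The Hadamard rotation as an isometry. -/
def hadamardPlane {n : ℕ} {x y : Fin n → Bool} (hxy : x ≠ y) : Ket n ≃ₗᵢ[ℝ] Ket n :=
  LinearIsometry.toLinearIsometryEquiv
    ⟨hadamardPlaneLinear x y, norm_hadamardPlaneLinear hxy⟩ rfl

lemma hadamardPlane_apply {n : ℕ} {x y : Fin n → Bool} (hxy : x ≠ y) (θ : Ket n) :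
    hadamardPlane hxy θ x = ((Real.sqrt 2)⁻¹ : ℝ) * (θ x + θ y) := by
  simp [hadamardPlane, hadamardPlaneLinear]

/-! ### The fourth moment of a coordinate -/

/-- Averaging over the fourth roots of unity kills every term of the expansion in which the phases
do not balance. -/
lemma sum_phases_norm_pow_four (a b : ℂ) :
    ‖a + b‖ ^ 4 + ‖a + Complex.I * b‖ ^ 4 + ‖a + (-1) * b‖ ^ 4 + ‖a + (-Complex.I) * b‖ ^ 4 =
      4 * (‖a‖ ^ 4 + ‖b‖ ^ 4 + 4 * (‖a‖ ^ 2 * ‖b‖ ^ 2)) := by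
  have h : ∀ z : ℂ, ‖z‖ ^ 4 = (Complex.normSq z) ^ 2 := fun z => by
    rw [Complex.normSq_eq_norm_sq]; ring
  have h2 : ∀ z : ℂ, ‖z‖ ^ 2 = (Complex.normSq z) := fun z => (Complex.normSq_eq_norm_sq z).symm
  simp only [h, h2, Complex.normSq_apply]
  simp
  ring

/-- `(θ x + u * θ y) / √2` is a coordinate of the image of `θ` under a phase followed by the
Hadamard rotation, so it has the law of `θ x`; the factor is `√2 ^ 4`. -/
lemma integral_norm_pow_four_plane {n : ℕ} {x y : Fin n → Bool} (hxy : x ≠ y) (u : Circle) :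
    ∫ θ, ‖(θ : Ket n) x + u * (θ : Ket n) y‖ ^ 4 ∂haarState n =
      4 * ∫ θ, ‖(θ : Ket n) x‖ ^ 4 ∂haarState n := by
  have h4 : ((Real.sqrt 2)⁻¹) ^ 4 = (1 / 4 : ℝ) := by
    rw [show (4 : ℕ) = 2 * 2 from rfl, pow_mul, inv_pow, Real.sq_sqrt (by norm_num)]; norm_num
  have h1 := integral_haarState_comp (hadamardPlane hxy) fun θ => ‖θ x‖ ^ 4
  have h2 := integral_haarState_comp (phaseAt y u) fun θ => ‖hadamardPlane hxy θ x‖ ^ 4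
  rw [h1] at h2
  simp only [hadamardPlane_apply, phaseAt_apply, hxy, if_true, if_false, one_mul, norm_mul,
    mul_pow, Complex.norm_real, Real.norm_of_nonneg (inv_nonneg.2 (Real.sqrt_nonneg 2)), h4] at h2
  rw [integral_const_mul] at h2
  linarith

lemma integral_norm_pow_four_eq {n : ℕ} (x y : Fin n → Bool) :
    ∫ θ, ‖(θ : Ket n) x‖ ^ 4 ∂haarState n = ∫ θ, ‖(θ : Ket n) y‖ ^ 4 ∂haarState n := by
  have := integral_haarState_comp (permuteCoord (Equiv.swap x y)) fun θ => ‖θ y‖ ^ 4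
  simpa only [permuteCoord_apply, Equiv.swap_apply_right] using this

lemma continuous_coord {n : ℕ} (x : Fin n → Bool) : Continuous fun θ : Ket n => θ x :=
  PiLp.continuous_apply 2 _ x

lemma integral_add_four {Ω : Type*} [MeasurableSpace Ω] {μ : Measure Ω} {f g h k : Ω → ℝ}
    (hf : Integrable f μ) (hg : Integrable g μ) (hh : Integrable h μ) (hk : Integrable k μ) :
    ∫ a, f a + g a + h a + k a ∂μ =
      ∫ a, f a ∂μ + ∫ a, g a ∂μ + ∫ a, h a ∂μ + ∫ a, k a ∂μ := by
  have h2 := integral_add (hf.add hg) hh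
  have h3 := integral_add ((hf.add hg).add hh) hk
  simp only [Pi.add_apply] at h2 h3
  rw [h3, h2, integral_add hf hg]

/-- With `A` the fourth moment and `B` the mixed moment, summing the plane identity over the four
phases gives `16 * A = 8 * A + 16 * B`. -/
lemma integral_norm_pow_four_eq_two_mul {n : ℕ} {x y : Fin n → Bool} (hxy : x ≠ y) :
    ∫ θ, ‖(θ : Ket n) x‖ ^ 4 ∂haarState n =
      2 * ∫ θ, ‖(θ : Ket n) x‖ ^ 2 * ‖(θ : Ket n) y‖ ^ 2 ∂haarState n := by
  have cx := continuous_coord x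
  have cy := continuous_coord y
  have hI : ∀ u : ℂ, Integrable (fun θ : Metric.sphere (0 : Ket n) 1 =>
      ‖(θ : Ket n) x + u * (θ : Ket n) y‖ ^ 4) (haarState n) := fun u =>
    integrable_haarState (g := fun θ : Ket n => ‖θ x + u * θ y‖ ^ 4) (by fun_prop)
  have i1 : Integrable (fun θ : Metric.sphere (0 : Ket n) 1 => ‖(θ : Ket n) x‖ ^ 4)
      (haarState n) := integrable_haarState (g := fun θ : Ket n => ‖θ x‖ ^ 4) (by fun_prop)
  have i2 : Integrable (fun θ : Metric.sphere (0 : Ket n) 1 => ‖(θ : Ket n) y‖ ^ 4)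
      (haarState n) := integrable_haarState (g := fun θ : Ket n => ‖θ y‖ ^ 4) (by fun_prop)
  have i3 : Integrable (fun θ : Metric.sphere (0 : Ket n) 1 =>
      ‖(θ : Ket n) x‖ ^ 2 * ‖(θ : Ket n) y‖ ^ 2) (haarState n) :=
    integrable_haarState (g := fun θ : Ket n => ‖θ x‖ ^ 2 * ‖θ y‖ ^ 2) (by fun_prop)
  have e := integral_congr_ae (μ := haarState n) (Filter.Eventually.of_forall
    fun θ : Metric.sphere (0 : Ket n) 1 =>
      sum_phases_norm_pow_four ((θ : Ket n) x) ((θ : Ket n) y))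
  have p0 := integral_norm_pow_four_plane hxy 1
  have p1 := integral_norm_pow_four_plane hxy ⟨Complex.I, by simp [Submonoid.unitSphere]⟩
  have p2 := integral_norm_pow_four_plane hxy (-1)
  have p3 := integral_norm_pow_four_plane hxy ⟨-Complex.I, by simp [Submonoid.unitSphere]⟩
  simp only [Circle.coe_one, one_mul, Circle.coe_neg] at p0 p1 p2 p3
  have hI0 := hI 1
  simp only [one_mul] at hI0
  have e3 := integral_add (i1.add i2) (i3.const_mul 4)
  simp only [Pi.add_apply] at e3
  rw [integral_add_four hI0 (hI _) (hI _) (hI _), p0, p1, p2, p3, integral_const_mul, e3, integral_add i1 i2,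
    integral_const_mul, integral_norm_pow_four_eq y x] at e
  linarith

/-- Integrating `(∑ b, ‖θ b‖ ^ 2) ^ 2 = 1` gives `2 ^ n * 2 ^ n` terms, each at least half the
common fourth moment `a`. The diagonal terms equal `a`; bounding them by `a / 2` costs little. -/
lemma integral_sum_norm_pow_four_le (n : ℕ) :
    ∫ θ, ∑ b, ‖(θ : Ket n) b‖ ^ 4 ∂haarState n ≤ 2 / 2 ^ n := by
  set a := ∫ θ, ‖(θ : Ket n) (fun _ => false)‖ ^ 4 ∂haarState n with ha
  have a0 : 0 ≤ a := integral_nonneg fun θ => by positivity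
  have i4 : ∀ b : Fin n → Bool, Integrable (fun θ : Metric.sphere (0 : Ket n) 1 =>
      ‖(θ : Ket n) b‖ ^ 4) (haarState n) := fun b =>
    have := continuous_coord b
    integrable_haarState (g := fun θ : Ket n => ‖θ b‖ ^ 4) (by fun_prop)
  have i22 : ∀ x y : Fin n → Bool, Integrable (fun θ : Metric.sphere (0 : Ket n) 1 =>
      ‖(θ : Ket n) x‖ ^ 2 * ‖(θ : Ket n) y‖ ^ 2) (haarState n) := fun x y =>
    have := continuous_coord x
    have := continuous_coord y
    integrable_haarState (g := fun θ : Ket n => ‖θ x‖ ^ 2 * ‖θ y‖ ^ 2) (by fun_prop)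
  have hN : (Fintype.card (Fin n → Bool) : ℝ) = 2 ^ n := by simp
  have hsum : ∫ θ, ∑ b, ‖(θ : Ket n) b‖ ^ 4 ∂haarState n = 2 ^ n * a := by
    rw [integral_finsetSum _ fun b _ => i4 b,
      Finset.sum_congr rfl fun b _ => integral_norm_pow_four_eq b fun _ => false]
    simp [ha]
  have hb : ∀ x y : Fin n → Bool,
      a / 2 ≤ ∫ θ, ‖(θ : Ket n) x‖ ^ 2 * ‖(θ : Ket n) y‖ ^ 2 ∂haarState n := by
    intro x y
    by_cases hxy : x = y
    · subst hxy
      have : ∫ θ, ‖(θ : Ket n) x‖ ^ 2 * ‖(θ : Ket n) x‖ ^ 2 ∂haarState n = a := by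
        rw [ha, ← integral_norm_pow_four_eq x]
        congr 1
        ext θ
        ring
      rw [this]
      linarith
    · have := integral_norm_pow_four_eq_two_mul hxy
      rw [integral_norm_pow_four_eq x fun _ => false] at this
      linarith
  have one : (1 : ℝ) = ∑ x, ∑ y, ∫ θ, ‖(θ : Ket n) x‖ ^ 2 * ‖(θ : Ket n) y‖ ^ 2 ∂haarState n := by
    have : ∀ θ : Metric.sphere (0 : Ket n) 1,
        ∑ x, ∑ y, ‖(θ : Ket n) x‖ ^ 2 * ‖(θ : Ket n) y‖ ^ 2 = 1 := by
      intro θ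
      rw [← Finset.sum_mul_sum, sum_normSq_of_mem_sphere, one_mul]
    have h := integral_congr_ae (μ := haarState n) (Filter.Eventually.of_forall this)
    rw [integral_finsetSum _ fun x _ => integrable_finsetSum _ fun y _ => i22 x y] at h
    simp only [integral_finsetSum _ fun y _ => i22 _ y] at h
    rw [h]
    simp
  have : (2 ^ n * 2 ^ n) * (a / 2) ≤ 1 := by
    rw [one]
    refine le_trans (le_of_eq ?_)
      (Finset.sum_le_sum fun x _ => Finset.sum_le_sum fun y _ => hb x y)
    simp
    ring
  rw [hsum, le_div_iff₀ (by positivity)]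
  nlinarith

end QCrypto

namespace QCrypto
open MeasureTheory

/-! ### Haar-random states and binary phase states on several copies -/

lemma tensorCoord_comp_perm {β : Type*} {t : ℕ} (θ : β → ℂ) (x : Fin t → β)
    (π : Equiv.Perm (Fin t)) : tensorCoord θ (x ∘ π) = tensorCoord θ x :=
  Equiv.prod_comp π fun i => θ (x i)

lemma tensorCoord_mul_star_self {β : Type*} {t : ℕ} (θ : β → ℂ) (x : Fin t → β) :
    tensorCoord θ x * star (tensorCoord θ x) = ((∏ i, ‖θ (x i)‖ ^ 2 : ℝ) : ℂ) := by
  rw [Complex.star_def, Complex.mul_conj, Complex.normSq_eq_norm_sq, normSq_tensorCoord]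

/-- Change of sign of the coordinate `v`. -/
def flipAt {β : Type*} [DecidableEq β] (v : β) (θ : β → ℂ) (b : β) : ℂ :=
  (if b = v then -1 else 1) * θ b

/-- If every value of `x` occurred in `y`, choosing positions would give an injection, hence a
permutation, of `Fin t`, and `y` would be a rearrangement of `x`. -/
lemma exists_mem_range_notMem_range {β : Type*} {t : ℕ} {x y : Fin t → β}
    (hx : Function.Injective x) (h : ¬ ∃ π : Equiv.Perm (Fin t), y = x ∘ π) :
    ∃ j, ∀ i, y i ≠ x j := by
  by_contra hcon
  push Not at hcon
  choose σ hσ using hcon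
  have hinj : Function.Injective σ := fun i j hij => hx (by rw [← hσ i, ← hσ j, hij])
  refine h ⟨(Equiv.ofBijective σ (Finite.injective_iff_bijective.1 hinj)).symm, ?_⟩
  ext i
  have := hσ ((Equiv.ofBijective σ (Finite.injective_iff_bijective.1 hinj)).symm i)
  rw [Function.comp_apply, ← this]
  congr 1
  exact ((Equiv.ofBijective σ (Finite.injective_iff_bijective.1 hinj)).apply_symm_apply i).symm

lemma tensorCoord_flipAt_of_injective {β : Type*} [DecidableEq β] {t : ℕ} (θ : β → ℂ)
    {x : Fin t → β} (hx : Function.Injective x) (j : Fin t) :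
    tensorCoord (flipAt (x j) θ) x = -tensorCoord θ x := by
  simp only [tensorCoord, flipAt, Finset.prod_mul_distrib, hx.eq_iff, Finset.prod_ite_eq',
    Finset.mem_univ, if_true, neg_one_mul]

lemma tensorCoord_flipAt_of_ne {β : Type*} [DecidableEq β] {t : ℕ} (θ : β → ℂ)
    {y : Fin t → β} {v : β} (h : ∀ i, y i ≠ v) :
    tensorCoord (flipAt v θ) y = tensorCoord θ y := by
  simp [tensorCoord, flipAt, h]

/-- If `y` misses the value `x j`, changing the sign of that coordinate negates the monomial of `x`,
which contains it exactly once, and fixes that of `y`; so the moment equals its negative. If `y`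
rearranges `x`, the moment is a diagonal one. -/
lemma SymmetricMoments.of_flip {Ω β : Type*} [MeasurableSpace Ω] [Fintype β] [DecidableEq β]
    {t : ℕ} {μ : Measure Ω} {θ : Ω → β → ℂ} {c : ℝ} (hm : ∀ b, Measurable fun ω => θ ω b)
    (hu : ∀ ω, ∑ b, ‖θ ω b‖ ^ 2 = 1)
    (hflip : ∀ (v : β) (g : (β → ℂ) → ℂ), ∫ ω, g (flipAt v (θ ω)) ∂μ = ∫ ω, g (θ ω) ∂μ)
    (hc : ∀ x : Fin t → β, Function.Injective x → ∫ ω, ∏ i, ‖θ ω (x i)‖ ^ 2 ∂μ = c) :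
    SymmetricMoments t μ θ c := by
  refine ⟨hm, hu, fun x y hx => ?_⟩
  split_ifs with h
  · obtain ⟨π, rfl⟩ := h
    simp only [tensorCoord_comp_perm, tensorCoord_mul_star_self]
    rw [← hc x hx]
    exact integral_ofReal
  · obtain ⟨j, hj⟩ := exists_mem_range_notMem_range hx h
    have := hflip (x j) fun θ => tensorCoord θ x * star (tensorCoord θ y)
    simp only [tensorCoord_flipAt_of_injective _ hx, tensorCoord_flipAt_of_ne _ hj, neg_mul,
      integral_neg] at this
    exact self_eq_neg.1 this.symm

/-- Permutations of the basis act transitively on injective `t`-tuples, so the diagonal moments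
agree; a sign change is a phase rotation by `-1`. -/
lemma exists_symmetricMoments_haarState (n t : ℕ) :
    ∃ c, SymmetricMoments t (haarState n)
      (fun θ (b : Fin n → Bool) => (θ : Ket n) b) c := by
  have hperm : ∀ x y : Fin t ↪ (Fin n → Bool),
      ∫ θ, ∏ i, ‖(θ : Ket n) (x i)‖ ^ 2 ∂haarState n =
        ∫ θ, ∏ i, ‖(θ : Ket n) (y i)‖ ^ 2 ∂haarState n := by
    intro x y
    obtain ⟨σ, hσ⟩ := (Equiv.Perm.isMultiplyPretransitive (Fin n → Bool) t).exists_smul_eq y x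
    have := integral_haarState_comp (permuteCoord σ) fun θ => ∏ i, ‖θ (y i)‖ ^ 2
    rw [← this, ← hσ]
    simp [permuteCoord_apply]
  have hc : ∃ c, ∀ x : Fin t → (Fin n → Bool), Function.Injective x →
      ∫ θ, ∏ i, ‖(θ : Ket n) (x i)‖ ^ 2 ∂haarState n = c := by
    by_cases hne : Nonempty (Fin t ↪ (Fin n → Bool))
    · obtain ⟨x0⟩ := hne
      exact ⟨_, fun x hx => hperm ⟨x, hx⟩ x0⟩
    -- With more copies than basis vectors there are no injective tuples and any constant will do.
    · exact ⟨0, fun x hx => (hne ⟨⟨x, hx⟩⟩).elim⟩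
  obtain ⟨c, hc⟩ := hc
  refine ⟨c, SymmetricMoments.of_flip
    (fun b => ((continuous_coord b).comp continuous_subtype_val).measurable)
    sum_normSq_of_mem_sphere (fun v g => ?_) hc⟩
  rw [← integral_haarState_comp (phaseAt v (-1)) fun θ => g θ]
  refine integral_congr_ae (Filter.Eventually.of_forall fun θ => congrArg g ?_)
  ext b
  simp [flipAt, phaseAt_apply]

/-- The uniform distribution on Boolean functions. -/
def randomFunction (n : ℕ) : Measure ((Fin n → Bool) → Bool) :=
  (PMF.uniformOfFintype ((Fin n → Bool) → Bool)).toMeasure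

instance (n : ℕ) : IsProbabilityMeasure (randomFunction n) :=
  inferInstanceAs (IsProbabilityMeasure (PMF.toMeasure _))

lemma integral_randomFunction {n : ℕ} {E : Type*} [NormedAddCommGroup E] [NormedSpace ℝ E]
    [CompleteSpace E] (g : ((Fin n → Bool) → Bool) → E) :
    ∫ f, g f ∂randomFunction n =
      ((Fintype.card ((Fin n → Bool) → Bool) : ℝ))⁻¹ • ∑ f, g f := by
  rw [randomFunction, PMF.integral_eq_sum, Finset.smul_sum]
  simp

lemma norm_binaryPhase_apply {n : ℕ} (f : (Fin n → Bool) → Bool) (b : Fin n → Bool) :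
    ‖binaryPhase f b‖ ^ 2 = ((2 : ℝ) ^ n)⁻¹ := by
  simp only [binaryPhase, norm_mul, norm_inv, Complex.norm_real, norm_pow, norm_neg,
    norm_one, one_pow, mul_one]
  rw [Real.norm_of_nonneg (Real.sqrt_nonneg _), inv_pow, Real.sq_sqrt (by positivity)]

lemma sum_norm_binaryPhase {n : ℕ} (f : (Fin n → Bool) → Bool) :
    ∑ b, ‖binaryPhase f b‖ ^ 2 = 1 := by
  simp [norm_binaryPhase_apply]

lemma norm_binaryPhase {n : ℕ} (f : (Fin n → Bool) → Bool) : ‖binaryPhase f‖ = 1 := by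
  have := EuclideanSpace.norm_sq_eq (binaryPhase f)
  rw [sum_norm_binaryPhase] at this
  nlinarith [norm_nonneg (binaryPhase f)]

lemma flipAt_binaryPhase {n : ℕ} (v : Fin n → Bool) (f : (Fin n → Bool) → Bool) :
    flipAt v (binaryPhase f) = binaryPhase (Function.update f v (!f v)) := by
  ext b
  by_cases h : b = v
  · subst h
    cases hf : f b <;> simp [flipAt, binaryPhase, hf]
  · simp [flipAt, binaryPhase, h]

/-- Changing the sign of a coordinate amounts to negating one entry of the truth table, an
involution that preserves the uniform law. Every coordinate has squared modulus `(2 ^ n)⁻¹`, which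
gives the constant. -/
lemma symmetricMoments_binaryPhase (n t : ℕ) :
    SymmetricMoments t (randomFunction n)
      (fun f (b : Fin n → Bool) => binaryPhase f b) (((2 : ℝ) ^ n)⁻¹ ^ t) := by
  refine SymmetricMoments.of_flip (fun b => measurable_of_countable _) sum_norm_binaryPhase
    (fun v g => ?_) fun x _ => by simp [norm_binaryPhase_apply]
  rw [integral_randomFunction, integral_randomFunction]
  congr 1
  have hinv : Function.Involutive fun f : (Fin n → Bool) → Bool =>
      Function.update f v (!f v) := by
    intro f
    simp
  refine Fintype.sum_equiv hinv.toPerm _ _ fun f => congrArg g ?_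
  exact flipAt_binaryPhase v f

/-- On `t` copies, a random binary phase state is statistically close to a Haar-random state. -/
theorem abs_avg_binaryPhase_sub_integral_haarState_le (n t : ℕ)
    {M : (Fin t → Fin n → Bool) → (Fin t → Fin n → Bool) → ℂ} (hM : IsEffect M) :
    |uniformAvg (fun f : (Fin n → Bool) → Bool => (sesqForm M (tensorCoord (binaryPhase f))).re) -
      ∫ θ, (sesqForm M (tensorCoord (θ : Ket n))).re ∂haarState n| ≤
      6 * ((t : ℝ) ^ 2 / 2 ^ n) := by
  obtain ⟨c, hc⟩ := exists_symmetricMoments_haarState n t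
  have hf := symmetricMoments_binaryPhase n t
  have h := hf.abs_integral_sub_integral_le (by positivity) hc hM
  have e : uniformAvg (fun f : (Fin n → Bool) → Bool =>
      (sesqForm M (tensorCoord (binaryPhase f))).re) =
      ∫ f, (sesqForm M (tensorCoord (binaryPhase f))).re ∂randomFunction n := by
    rw [integral_randomFunction, uniformAvg, smul_eq_mul, div_eq_inv_mul]
  rw [e]
  refine h.trans ?_
  have h1 := hf.collision_le
  have h2 := hc.collision_le
  have h3 : ∀ f : (Fin n → Bool) → Bool, ∑ b, ‖binaryPhase f b‖ ^ 4 = ((2 : ℝ) ^ n)⁻¹ := by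
    intro f
    have : ∀ b, ‖binaryPhase f b‖ ^ 4 = (((2 : ℝ) ^ n)⁻¹) ^ 2 := fun b => by
      rw [← norm_binaryPhase_apply f b]; ring
    simp only [this]
    simp
    field_simp
  simp only [h3] at h1
  simp only [integral_const, probReal_univ, one_smul] at h1
  have h4 := mul_le_mul_of_nonneg_left (integral_sum_norm_pow_four_le n) (sq_nonneg (t : ℝ))
  have h5 : (t : ℝ) ^ 2 * (2 / 2 ^ n) = 2 * ((t : ℝ) ^ 2 / 2 ^ n) := by ring
  have h6 : (t : ℝ) ^ 2 * ((2 : ℝ) ^ n)⁻¹ = (t : ℝ) ^ 2 / 2 ^ n := by ring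
  rw [h5] at h4
  rw [h6] at h1
  -- The constant is `2 * (1 + 2)`: collision weights `t ^ 2 / 2 ^ n` for phase states and twice
  -- that for Haar states.
  linarith

end QCrypto

namespace QCrypto

/-! ### Straight-line programs of NAND gates

The wires of a program carry Boolean functions of the input. -/

/-- `NandExtends L L'`: the wires `L'` arise from `L` by appending NAND gates. -/
inductive NandExtends {X : Type} (L : List (X → Bool)) : List (X → Bool) → Prop
  | refl : NandExtends L L
  | step {L' : List (X → Bool)} {f g : X → Bool} : NandExtends L L' → f ∈ L' → g ∈ L' →
      NandExtends L ((fun x => !(f x && g x)) :: L')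

lemma NandExtends.subset {X : Type} {L L' : List (X → Bool)} (h : NandExtends L L') :
    L ⊆ L' := by
  induction h with
  | refl => exact List.Subset.refl _
  | step _ _ _ ih => exact List.Subset.trans ih (List.subset_cons_self _ _)

lemma NandExtends.trans {X : Type} {L L' L'' : List (X → Bool)} (h : NandExtends L L')
    (h' : NandExtends L' L'') : NandExtends L L'' := by
  induction h' with
  | refl => exact h
  | step _ hf hg ih => exact ih.step hf hg

/-- From the functions in `A`, the functions in `B` are computed by `s` NAND gates. -/
def Computes {X : Type} (A : Set (X → Bool)) (s : ℕ) (B : Set (X → Bool)) : Prop :=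
  ∀ L : List (X → Bool), (∀ f ∈ A, f ∈ L) →
    ∃ L', NandExtends L L' ∧ L'.length ≤ L.length + s ∧ ∀ f ∈ B, f ∈ L'

namespace Computes

variable {X : Type} {A A' B B' C : Set (X → Bool)} {s s' : ℕ}

lemma of_subset (h : B ⊆ A) : Computes A s B :=
  fun L hL => ⟨L, .refl, by omega, fun f hf => hL f (h hf)⟩

lemma mono (h : Computes A s B) (hA : A ⊆ A') (hs : s ≤ s') (hB : B' ⊆ B) :
    Computes A' s' B' := fun L hL => by
  obtain ⟨L', h1, h2, h3⟩ := h L fun f hf => hL f (hA hf)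
  exact ⟨L', h1, by omega, fun f hf => h3 f (hB hf)⟩

/-- Programs can be concatenated because the initial list of wires in `Computes` is arbitrary and
wires are never discarded. -/
lemma trans (h : Computes A s B) (h' : Computes (A ∪ B) s' C) : Computes A (s + s') (B ∪ C) :=
  fun L hL => by
    obtain ⟨L', h1, h2, h3⟩ := h L hL
    obtain ⟨L'', k1, k2, k3⟩ := h' L' (by
      rintro f (hf | hf)
      · exact h1.subset (hL f hf)
      · exact h3 f hf)
    refine ⟨L'', h1.trans k1, by omega, ?_⟩
    rintro f (hf | hf)
    · exact k1.subset (h3 f hf)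
    · exact k3 f hf

lemma comp (h : Computes A s B) (h' : Computes (A ∪ B) s' C) : Computes A (s + s') C :=
  (h.trans h').mono le_rfl le_rfl Set.subset_union_right

lemma union (h : Computes A s B) (h' : Computes A s' C) : Computes A (s + s') (B ∪ C) :=
  h.trans (h'.mono Set.subset_union_left le_rfl le_rfl)

lemma biUnion {ι : Type*} (I : Finset ι) (B : ι → Set (X → Bool))
    (h : ∀ i ∈ I, Computes A s (B i)) : Computes A (I.card * s) (⋃ i ∈ I, B i) := by
  classical
  induction I using Finset.induction_on with
  | empty => exact of_subset (by simp)
  | insert i I hi ih =>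
    have h1 := (h i (Finset.mem_insert_self i I)).union
      (ih fun j hj => h j (Finset.mem_insert_of_mem hj))
    refine h1.mono le_rfl ?_ ?_
    · rw [Finset.card_insert_of_notMem hi]; apply le_of_eq; ring
    · rw [Finset.set_biUnion_insert]

lemma nand {f g : X → Bool} (hf : f ∈ A) (hg : g ∈ A) :
    Computes A 1 {fun x => !(f x && g x)} := fun L hL =>
  ⟨_, NandExtends.refl.step (hL f hf) (hL g hg), by simp, by simp⟩

lemma not {f : X → Bool} (hf : f ∈ A) : Computes A 1 {fun x => !f x} := by
  simpa using nand hf hf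

lemma and {f g : X → Bool} (hf : f ∈ A) (hg : g ∈ A) :
    Computes A 2 {fun x => f x && g x} := by
  have h := (nand hf hg).comp (not (A := A ∪ {fun x => !(f x && g x)}) (Or.inr rfl))
  simpa using h

lemma or {f g : X → Bool} (hf : f ∈ A) (hg : g ∈ A) :
    Computes A 3 {fun x => f x || g x} := by
  have h := ((not hf).union (not hg)).comp
    (nand (A := A ∪ ({fun x => !f x} ∪ {fun x => !g x})) (f := fun x => !f x)
      (g := fun x => !g x) (Or.inr (Or.inl rfl)) (Or.inr (Or.inr rfl)))
  simpa using h

/-- Each index costs two gates for the conjunction and three for joining it to the disjunction; the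
empty disjunction is the constant wire. -/
lemma exists_and {ι : Type*} (I : Finset ι) (f g : ι → X → Bool)
    (h0 : (fun _ => false) ∈ A) (hf : ∀ i ∈ I, f i ∈ A) (hg : ∀ i ∈ I, g i ∈ A) :
    Computes A (5 * I.card) {fun x => decide (∃ i ∈ I, f i x = true ∧ g i x = true)} := by
  classical
  induction I using Finset.induction_on with
  | empty => exact of_subset (by simpa using h0)
  | insert i I hi ih =>
    have h1 := ih (fun j hj => hf j (Finset.mem_insert_of_mem hj))
      fun j hj => hg j (Finset.mem_insert_of_mem hj)
    have h2 := and (hf i (Finset.mem_insert_self i I)) (hg i (Finset.mem_insert_self i I))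
    have h3 := (h1.union h2).comp (or (Or.inr (Or.inr rfl)) (Or.inr (Or.inl rfl)))
    refine h3.mono le_rfl ?_ ?_
    · rw [Finset.card_insert_of_notMem hi]; omega
    · rw [Set.singleton_subset_iff, Set.mem_singleton_iff]
      ext x
      rw [Bool.eq_iff_iff]
      simp

end Computes

/-! ### Indicators of functions into a finite set -/

open Classical in
/-- The indicators of the events `c = a` for `a ∈ S`. -/
def indicators {X A : Type} (c : X → A) (S : Finset A) : Set (X → Bool) :=
  {f | ∃ a ∈ S, f = fun x => decide (c x = a)}

lemma mem_indicators {X A : Type} {c : X → A} {S : Finset A} {a : A} (ha : a ∈ S)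
    {f : X → Bool} (h : ∀ x, f x = true ↔ c x = a) : f ∈ indicators c S :=
  ⟨a, ha, by ext x; rw [Bool.eq_iff_iff, h]; simp⟩

namespace Computes

variable {X : Type} {A : Set (X → Bool)}

lemma of_indicators {E : Type} {c : X → E} {S : Finset E} {s : ℕ}
    (h : ∀ a ∈ S, Computes A s {open Classical in fun x => decide (c x = a)}) :
    Computes A (S.card * s) (indicators c S) := by
  refine (biUnion S _ h).mono le_rfl le_rfl ?_
  rintro f ⟨a, ha, rfl⟩
  simp only [Set.mem_iUnion]
  exact ⟨a, ha, rfl⟩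

open Classical in
/-- Selection of the value of one of finitely many functions. -/
lemma select {O E : Type} [Fintype O] {o : X → O} {c : O → X → E} {S : Finset E}
    (h0 : (fun _ => false) ∈ A) (ho : indicators o Finset.univ ⊆ A)
    (hc : ∀ i, indicators (c i) S ⊆ A) :
    Computes A (S.card * (5 * Fintype.card O)) (indicators (fun x => c (o x) x) S) := by
  refine of_indicators fun a ha => ?_
  have h := exists_and (A := A) (Finset.univ : Finset O) (fun i x => decide (o x = i))
    (fun i x => decide (c i x = a)) h0 (fun i _ => ho ⟨i, Finset.mem_univ _, rfl⟩)
    fun i _ => hc i ⟨a, ha, rfl⟩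
  refine h.mono le_rfl le_rfl ?_
  rw [Set.singleton_subset_iff, Set.mem_singleton_iff]
  ext x
  rw [Bool.eq_iff_iff]
  simp

open Classical in
/-- A function of two values in finite sets. -/
lemma map₂ {E F G : Type} {c : X → E} {d : X → F} {S : Finset E} {T : Finset F} (φ : E → F → G)
    (U : Finset G) (h0 : (fun _ => false) ∈ A) (hc : indicators c S ⊆ A)
    (hd : indicators d T ⊆ A) (hcS : ∀ x, c x ∈ S) (hdT : ∀ x, d x ∈ T) :
    Computes A (U.card * (5 * (S.card * T.card))) (indicators (fun x => φ (c x) (d x)) U) := by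
  refine of_indicators fun e he => ?_
  have h := exists_and (A := A) ((S ×ˢ T).filter fun p => φ p.1 p.2 = e)
    (fun p x => decide (c x = p.1)) (fun p x => decide (d x = p.2)) h0
    (fun p hp => hc ⟨p.1, by simp at hp; exact hp.1.1, rfl⟩)
    fun p hp => hd ⟨p.2, by simp at hp; exact hp.1.2, rfl⟩
  refine h.mono le_rfl ?_ ?_
  · rw [← Finset.card_product]
    exact Nat.mul_le_mul_left _ (Finset.card_filter_le _ _)
  · rw [Set.singleton_subset_iff, Set.mem_singleton_iff]
    ext x
    rw [Bool.eq_iff_iff]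
    simp only [decide_eq_true_eq, Finset.mem_filter, Finset.mem_product]
    constructor
    · intro hx
      exact ⟨(c x, d x), ⟨⟨hcS x, hdT x⟩, hx⟩, rfl, rfl⟩
    · rintro ⟨⟨a, b⟩, ⟨_, hx⟩, rfl, rfl⟩
      exact hx

open Classical in
lemma map {E G : Type} {c : X → E} {S : Finset E} (φ : E → G) (U : Finset G)
    (h0 : (fun _ => false) ∈ A) (hc : indicators c S ⊆ A) (hcS : ∀ x, c x ∈ S) :
    Computes A (U.card * (5 * (S.card * S.card))) (indicators (fun x => φ (c x)) U) :=
  map₂ (fun a _ => φ a) U h0 hc hc hcS hcS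

end Computes

/-! ### Boolean circuits for stack machines -/

section StackMachine

open Turing

variable {K : Type} [Fintype K] [DecidableEq K] {Γ : K → Type} {Λ σ : Type} [Fintype Λ]
  [Fintype σ] {X : Type}

/-- Every symbol that the statement may push belongs to `S`. -/
def PushesIn (S : ∀ k, Finset (Option (Γ k))) : TM2.Stmt Γ Λ σ → Prop
  | .push k f q => (∀ v, some (f v) ∈ S k) ∧ PushesIn S q
  | .peek _ _ q => PushesIn S q
  | .pop _ _ q => PushesIn S q
  | .load _ q => PushesIn S q
  | .branch _ q₁ q₂ => PushesIn S q₁ ∧ PushesIn S q₂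
  | .goto _ => True
  | .halt => True

open Classical in
omit [Fintype K] [Fintype Λ] in
-- A stack alphabet may be infinite, but a pushed symbol is a function of the internal state, which
-- ranges over a finite type, so a statement pushes only finitely many symbols.
lemma exists_pushesIn (q : TM2.Stmt Γ Λ σ) :
    ∃ S₀ : ∀ k, Finset (Option (Γ k)), ∀ S, (∀ k, S₀ k ⊆ S k) → PushesIn S q := by
  induction q with
  | push k f q ih =>
    obtain ⟨S₀, h⟩ := ih
    refine ⟨fun j => S₀ j ∪ if e : j = k then
      (Finset.univ : Finset σ).image fun v => some (e ▸ f v) else ∅, fun S hS => ⟨fun v => ?_, ?_⟩⟩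
    · apply hS k
      simp
    · exact h S fun j => Finset.subset_union_left.trans (hS j)
  | peek _ _ q ih => exact ih
  | pop _ _ q ih => exact ih
  | load _ q ih => exact ih
  | branch _ q₁ q₂ ih₁ ih₂ =>
    obtain ⟨S₁, h₁⟩ := ih₁
    obtain ⟨S₂, h₂⟩ := ih₂
    exact ⟨fun k => S₁ k ∪ S₂ k, fun S hS =>
      ⟨h₁ S fun j => Finset.subset_union_left.trans (hS j),
        h₂ S fun j => Finset.subset_union_right.trans (hS j)⟩⟩
  | goto _ => exact ⟨fun _ => ∅, fun _ _ => trivial⟩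
  | halt => exact ⟨fun _ => ∅, fun _ _ => trivial⟩

/-- The constant zero, and the top `H` cells of the stacks. -/
def cellWires (S : ∀ k, Finset (Option (Γ k))) (H : ℕ) (T : X → ∀ k, List (Γ k)) :
    Set (X → Bool) :=
  ⋃ k ∈ (Finset.univ : Finset K), ⋃ i ∈ Finset.range H, indicators (fun x => (T x k)[i]?) (S k)

/-- The wires describing the internal state and the top `H` cells of the stacks. -/
def stateWires (S : ∀ k, Finset (Option (Γ k))) (H : ℕ) (v : X → σ)
    (T : X → ∀ k, List (Γ k)) : Set (X → Bool) :=
  {fun _ => false} ∪ indicators v Finset.univ ∪ cellWires S H T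

/-- The wires describing a configuration, with the top `H` cells of the stacks. -/
def cfgWires (S : ∀ k, Finset (Option (Γ k))) (H : ℕ) (c : X → TM2.Cfg Γ Λ σ) :
    Set (X → Bool) :=
  indicators (fun x => (c x).l) Finset.univ ∪
    stateWires S H (fun x => (c x).var) (fun x => (c x).stk)

/-- All symbols on the stacks belong to `S`. -/
def StacksIn (S : ∀ k, Finset (Option (Γ k))) (T : ∀ k, List (Γ k)) : Prop :=
  ∀ k, none ∈ S k ∧ ∀ a ∈ T k, some a ∈ S k

omit [Fintype K] [DecidableEq K] in
lemma StacksIn.getElem? {S : ∀ k, Finset (Option (Γ k))} {T : ∀ k, List (Γ k)}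
    (h : StacksIn S T) (k : K) (i : ℕ) : (T k)[i]? ∈ S k := by
  rcases hx : (T k)[i]? with _ | a
  · exact (h k).1
  · exact (h k).2 a (List.mem_of_getElem? hx)

omit [DecidableEq K] in
lemma mem_cellWires {S : ∀ k, Finset (Option (Γ k))} {H : ℕ} {T : X → ∀ k, List (Γ k)}
    {f : X → Bool} : f ∈ cellWires S H T ↔
      ∃ k, ∃ i < H, f ∈ indicators (fun x => (T x k)[i]?) (S k) := by
  simp [cellWires]

omit [DecidableEq K] in
lemma cellWires_mono (S : ∀ k, Finset (Option (Γ k))) {H H' : ℕ} (h : H ≤ H')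
    (T : X → ∀ k, List (Γ k)) : cellWires S H T ⊆ cellWires S H' T := by
  intro f hf
  rw [mem_cellWires] at hf ⊢
  obtain ⟨k, i, hi, hf⟩ := hf
  exact ⟨k, i, by omega, hf⟩

omit [DecidableEq K] in
lemma stateWires_mono (S : ∀ k, Finset (Option (Γ k))) {H H' : ℕ} (h : H ≤ H') (v : X → σ)
    (T : X → ∀ k, List (Γ k)) : stateWires S H v T ⊆ stateWires S H' v T :=
  Set.union_subset_union_right _ (cellWires_mono S h T)

omit [DecidableEq K] in
lemma cfgWires_mono (S : ∀ k, Finset (Option (Γ k))) {H H' : ℕ} (h : H ≤ H')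
    (c : X → TM2.Cfg Γ Λ σ) : cfgWires S H c ⊆ cfgWires S H' c :=
  Set.union_subset_union_right _ (stateWires_mono S h _ _)

omit [DecidableEq K] in
lemma indicators_cell_subset {S : ∀ k, Finset (Option (Γ k))} {H : ℕ} {v : X → σ}
    {T : X → ∀ k, List (Γ k)} (k : K) {i : ℕ} (hi : i < H) :
    indicators (fun x => (T x k)[i]?) (S k) ⊆ stateWires S H v T :=
  fun _ hf => Or.inr (mem_cellWires.2 ⟨k, i, hi, hf⟩)

omit [DecidableEq K] in
lemma indicators_state_subset {S : ∀ k, Finset (Option (Γ k))} {H : ℕ} {v : X → σ}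
    {T : X → ∀ k, List (Γ k)} : indicators v Finset.univ ⊆ stateWires S H v T :=
  fun _ hf => Or.inl (Or.inr hf)

omit [DecidableEq K] in
lemma false_mem_stateWires {S : ∀ k, Finset (Option (Γ k))} {H : ℕ} {v : X → σ}
    {T : X → ∀ k, List (Γ k)} : (fun _ => false) ∈ stateWires S H v T :=
  Or.inl (Or.inl rfl)

omit [DecidableEq K] in
/-- Selection between finitely many configurations. -/
lemma computes_select_cfg {O : Type} [Fintype O] (S : ∀ k, Finset (Option (Γ k))) :
    ∃ C : ℕ, ∀ {X : Type} (o : X → O) (c : O → X → TM2.Cfg Γ Λ σ) (H : ℕ),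
      Computes ({fun _ => false} ∪ indicators o Finset.univ ∪ ⋃ i, cfgWires S H (c i))
        (C * (H + 1)) (cfgWires S H fun x => c (o x) x) := by
  set m := 5 * Fintype.card O with hm
  set s := ∑ k, (S k).card with hs
  refine ⟨(Fintype.card (Option Λ) + Fintype.card σ + Fintype.card K * s) * m, ?_⟩
  intro X o c H
  set A : Set (X → Bool) :=
    {fun _ => false} ∪ indicators o Finset.univ ∪ ⋃ i, cfgWires S H (c i) with hA
  have h0 : (fun _ => false) ∈ A := Or.inl (Or.inl rfl)
  have ho : indicators o Finset.univ ⊆ A := fun f hf => Or.inl (Or.inr hf)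
  have hc : ∀ i, cfgWires S H (c i) ⊆ A := fun i f hf => Or.inr (Set.mem_iUnion.2 ⟨i, hf⟩)
  have h1 : Computes A ((Finset.univ : Finset (Option Λ)).card * m)
      (indicators (fun x => (c (o x) x).l) Finset.univ) :=
    Computes.select (c := fun i x => (c i x).l) h0 ho fun i f hf => hc i (Or.inl hf)
  have h2 : Computes A ((Finset.univ : Finset σ).card * m)
      (indicators (fun x => (c (o x) x).var) Finset.univ) :=
    Computes.select (c := fun i x => (c i x).var) h0 ho fun i f hf =>
      hc i (Or.inr (indicators_state_subset hf))
  have h3 : Computes A ((Finset.univ : Finset K).card * ((Finset.range H).card * (s * m)))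
      (cellWires S H fun x => (c (o x) x).stk) := by
    refine Computes.biUnion _ _ fun k _ => Computes.biUnion _ _ fun i hi => ?_
    refine (Computes.select (c := fun j x => ((c j x).stk k)[i]?) h0 ho fun j f hf =>
      hc j (Or.inr (indicators_cell_subset k (Finset.mem_range.1 hi) hf))).mono le_rfl ?_ le_rfl
    exact Nat.mul_le_mul_right _ (Finset.single_le_sum (f := fun k => (S k).card)
      (fun _ _ => Nat.zero_le _) (Finset.mem_univ k))
  have h4 := h1.union (((Computes.of_subset (s := 0) (Set.singleton_subset_iff.2 h0)).union
    h2).union h3)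
  refine h4.mono le_rfl ?_ le_rfl
  simp only [Finset.card_univ, Finset.card_range]
  nlinarith [Nat.zero_le (Fintype.card (Option Λ) * m * H), Nat.zero_le (Fintype.card σ * m * H),
    Nat.zero_le (Fintype.card K * s * m)]

/-- Execution of a statement is computed by linearly many gates. -/
lemma computes_stepAux (S : ∀ k, Finset (Option (Γ k))) (q : TM2.Stmt Γ Λ σ)
    (hq : PushesIn S q) :
    ∃ d C : ℕ, ∀ {X : Type} (v : X → σ) (T : X → ∀ k, List (Γ k)), (∀ x, StacksIn S (T x)) →
      (∀ x, StacksIn S (TM2.stepAux q (v x) (T x)).stk) ∧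
      ∀ H, Computes (stateWires S (H + d) v T) (C * (H + 1))
        (cfgWires S H fun x => TM2.stepAux q (v x) (T x)) := by
  classical
  induction q with
  | push k f q ih =>
    obtain ⟨d, C, h⟩ := ih hq.2
    refine ⟨d, (S k).card * (5 * (Fintype.card σ * Fintype.card σ)) + C, fun v T hT => ?_⟩
    obtain ⟨h1, h2⟩ := h v (fun x => Function.update (T x) k (f (v x) :: T x k)) (by
      intro x j
      by_cases hj : j = k
      · subst hj
        refine ⟨(hT x j).1, fun a ha => ?_⟩
        simp only [Function.update_self, List.mem_cons] at ha
        rcases ha with rfl | ha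
        · exact hq.1 _
        · exact (hT x j).2 a ha
      · simpa [hj] using hT x j)
    refine ⟨h1, fun H => ?_⟩
    have h3 : Computes (stateWires S (H + d) v T) _
        (indicators (fun x => (fun w => some (f w)) (v x)) (S k)) :=
      Computes.map (fun w => some (f w)) (S k) false_mem_stateWires indicators_state_subset
        fun x => Finset.mem_univ _
    refine (h3.comp ((h2 H).mono ?_ le_rfl le_rfl)).mono le_rfl ?_ le_rfl
    · rintro g ((hg | hg) | hg)
      · exact Or.inl (Or.inl (Or.inl hg))
      · exact Or.inl (Or.inl (Or.inr hg))
      · obtain ⟨j, i, hi, hg⟩ := mem_cellWires.1 hg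
        by_cases hj : j = k
        · subst hj
          simp only [Function.update_self] at hg
          -- Only cell `0` is new; cell `i + 1` is the old cell `i`, so shifting the stack costs no
          -- gates.
          cases i with
          | zero => exact Or.inr hg
          | succ i =>
            simp only [List.getElem?_cons_succ] at hg
            exact Or.inl (indicators_cell_subset j (by omega) hg)
        · simp only [Function.update_of_ne hj] at hg
          exact Or.inl (indicators_cell_subset j hi hg)
    · rw [Finset.card_univ]
      nlinarith [Nat.zero_le ((S k).card * (5 * (Fintype.card σ * Fintype.card σ)) * H)]
  | peek k f q ih =>
    obtain ⟨d, C, h⟩ := ih hq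
    -- The extra cell makes the top of the stack available even when `H + d = 0`.
    refine ⟨d + 1, Fintype.card σ * (5 * (Fintype.card σ * (S k).card)) + C, fun v T hT => ?_⟩
    obtain ⟨h1, h2⟩ := h (fun x => f (v x) (T x k).head?) T hT
    refine ⟨h1, fun H => ?_⟩
    have h3 : Computes (stateWires S (H + (d + 1)) v T) _
        (indicators (fun x => f (v x) ((T x k)[0]?)) Finset.univ) :=
      Computes.map₂ f Finset.univ false_mem_stateWires indicators_state_subset
        (indicators_cell_subset k (by omega)) (fun x => Finset.mem_univ _)
        fun x => (hT x).getElem? k 0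
    simp only [← List.head?_eq_getElem?] at h3
    refine (h3.comp ((h2 H).mono ?_ le_rfl le_rfl)).mono le_rfl ?_ le_rfl
    · rintro g ((hg | hg) | hg)
      · exact Or.inl (Or.inl (Or.inl hg))
      · exact Or.inr hg
      · exact Or.inl (Or.inr (cellWires_mono S (by omega) _ hg))
    · rw [Finset.card_univ]
      nlinarith [Nat.zero_le (Fintype.card σ * (5 * (Fintype.card σ * (S k).card)) * H)]
  | pop k f q ih =>
    obtain ⟨d, C, h⟩ := ih hq
    -- After a pop, the top `H + d` cells are among the top `H + d + 1` cells before it.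
    refine ⟨d + 1, Fintype.card σ * (5 * (Fintype.card σ * (S k).card)) + C, fun v T hT => ?_⟩
    obtain ⟨h1, h2⟩ := h (fun x => f (v x) (T x k).head?)
      (fun x => Function.update (T x) k (T x k).tail) (by
      intro x j
      by_cases hj : j = k
      · subst hj
        refine ⟨(hT x j).1, fun a ha => ?_⟩
        simp only [Function.update_self] at ha
        exact (hT x j).2 a (List.mem_of_mem_tail ha)
      · simpa [hj] using hT x j)
    refine ⟨h1, fun H => ?_⟩
    have h3 : Computes (stateWires S (H + (d + 1)) v T) _
        (indicators (fun x => f (v x) ((T x k)[0]?)) Finset.univ) :=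
      Computes.map₂ f Finset.univ false_mem_stateWires indicators_state_subset
        (indicators_cell_subset k (by omega)) (fun x => Finset.mem_univ _)
        fun x => (hT x).getElem? k 0
    simp only [← List.head?_eq_getElem?] at h3
    refine (h3.comp ((h2 H).mono ?_ le_rfl le_rfl)).mono le_rfl ?_ le_rfl
    · rintro g ((hg | hg) | hg)
      · exact Or.inl (Or.inl (Or.inl hg))
      · exact Or.inr hg
      · obtain ⟨j, i, hi, hg⟩ := mem_cellWires.1 hg
        by_cases hj : j = k
        · subst hj
          simp only [Function.update_self, List.getElem?_tail] at hg
          exact Or.inl (indicators_cell_subset j (by omega) hg)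
        · simp only [Function.update_of_ne hj] at hg
          exact Or.inl (indicators_cell_subset j (by omega) hg)
    · rw [Finset.card_univ]
      nlinarith [Nat.zero_le (Fintype.card σ * (5 * (Fintype.card σ * (S k).card)) * H)]
  | load a q ih =>
    obtain ⟨d, C, h⟩ := ih hq
    refine ⟨d, Fintype.card σ * (5 * (Fintype.card σ * Fintype.card σ)) + C, fun v T hT => ?_⟩
    obtain ⟨h1, h2⟩ := h (fun x => a (v x)) T hT
    refine ⟨h1, fun H => ?_⟩
    have h3 : Computes (stateWires S (H + d) v T) _
        (indicators (fun x => a (v x)) Finset.univ) :=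
      Computes.map a Finset.univ false_mem_stateWires indicators_state_subset
        fun x => Finset.mem_univ _
    refine (h3.comp ((h2 H).mono ?_ le_rfl le_rfl)).mono le_rfl ?_ le_rfl
    · rintro g ((hg | hg) | hg)
      · exact Or.inl (Or.inl (Or.inl hg))
      · exact Or.inr hg
      · exact Or.inl (Or.inr hg)
    · rw [Finset.card_univ]
      nlinarith [Nat.zero_le (Fintype.card σ * (5 * (Fintype.card σ * Fintype.card σ)) * H)]
  | branch p q₁ q₂ ih₁ ih₂ =>
    obtain ⟨d₁, C₁, h₁⟩ := ih₁ hq.1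
    obtain ⟨d₂, C₂, h₂⟩ := ih₂ hq.2
    obtain ⟨C, hC⟩ := computes_select_cfg (O := Bool) (Λ := Λ) (σ := σ) S
    refine ⟨d₁ + d₂, C₁ + C₂ + 2 * (5 * (Fintype.card σ * Fintype.card σ)) + C,
      fun {X} v T hT => ?_⟩
    obtain ⟨v₁, e₁⟩ := h₁ v T hT
    obtain ⟨v₂, e₂⟩ := h₂ v T hT
    refine ⟨fun x => ?_, fun H => ?_⟩
    · cases hp : p (v x)
      · simpa [hp] using v₂ x
      · simpa [hp] using v₁ x
    have h3 : Computes (stateWires S (H + (d₁ + d₂)) v T) _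
        (indicators (fun x => p (v x)) Finset.univ) :=
      Computes.map p Finset.univ false_mem_stateWires indicators_state_subset
        fun x => Finset.mem_univ _
    have e₁' := (e₁ H).mono (stateWires_mono S (show H + d₁ ≤ H + (d₁ + d₂) by omega) v T)
      le_rfl le_rfl
    have e₂' := (e₂ H).mono (stateWires_mono S (show H + d₂ ≤ H + (d₁ + d₂) by omega) v T)
      le_rfl le_rfl
    -- Both branches are computed, and the value of the test selects between the resulting
    -- configurations.
    have h4 := hC (fun x => p (v x)) (fun b x => cond b (TM2.stepAux q₁ (v x) (T x))
      (TM2.stepAux q₂ (v x) (T x))) H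
    refine ((h3.union (e₁'.union e₂')).comp (h4.mono ?_ le_rfl le_rfl)).mono le_rfl ?_ le_rfl
    · rintro g ((hg | hg) | hg)
      · rw [Set.mem_singleton_iff.1 hg]
        exact Or.inl false_mem_stateWires
      · exact Or.inr (Or.inl hg)
      · obtain ⟨b, hg⟩ := Set.mem_iUnion.1 hg
        cases b
        · exact Or.inr (Or.inr (Or.inr hg))
        · exact Or.inr (Or.inr (Or.inl hg))
    · simp only [Finset.card_univ, Fintype.card_bool]
      nlinarith [Nat.zero_le (2 * (5 * (Fintype.card σ * Fintype.card σ)) * H)]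
  | goto f =>
    refine ⟨0, Fintype.card (Option Λ) * (5 * (Fintype.card σ * Fintype.card σ)),
      fun v T hT => ⟨hT, fun H => ?_⟩⟩
    have h3 : Computes (stateWires S H v T) _
        (indicators (fun x => some (f (v x))) Finset.univ) :=
      Computes.map (fun w => some (f w)) Finset.univ false_mem_stateWires indicators_state_subset
        fun x => Finset.mem_univ _
    refine (h3.union (Computes.of_subset (s := 0) subset_rfl)).mono le_rfl ?_ le_rfl
    rw [Finset.card_univ, Finset.card_univ]
    exact Nat.le_mul_of_pos_right _ (Nat.succ_pos _)
  | halt =>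
    refine ⟨0, Fintype.card (Option Λ) * (5 * (Fintype.card σ * Fintype.card σ)),
      fun v T hT => ⟨hT, fun H => ?_⟩⟩
    have h3 : Computes (stateWires S H v T) _
        (indicators (fun x => (fun _ => (none : Option Λ)) (v x)) Finset.univ) :=
      Computes.map (fun _ : σ => (none : Option Λ)) Finset.univ false_mem_stateWires indicators_state_subset
        fun x => Finset.mem_univ _
    refine (h3.union (Computes.of_subset (s := 0) subset_rfl)).mono le_rfl ?_ le_rfl
    rw [Finset.card_univ, Finset.card_univ]
    exact Nat.le_mul_of_pos_right _ (Nat.succ_pos _)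

end StackMachine

end QCrypto

namespace QCrypto

/-! ### Iterating the step of a stack machine -/

section StackMachine

open Turing

variable {K : Type} [Fintype K] [DecidableEq K] {Γ : K → Type} {Λ σ : Type} [Fintype Λ]
  [Fintype σ] {X : Type}

/-- One step of a stack machine, where halting configurations are fixed. -/
def totalStep (M : Λ → TM2.Stmt Γ Λ σ) (c : TM2.Cfg Γ Λ σ) : TM2.Cfg Γ Λ σ :=
  match c.l with
  | none => c
  | some l => TM2.stepAux (M l) c.var c.stk

/-- The statements of all labels are executed in parallel and the current label selects the result;
the halted case selects the unchanged configuration. -/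
lemma computes_totalStep (S : ∀ k, Finset (Option (Γ k))) (M : Λ → TM2.Stmt Γ Λ σ)
    (hM : ∀ l, PushesIn S (M l)) :
    ∃ d C : ℕ, ∀ {X : Type} (c : X → TM2.Cfg Γ Λ σ), (∀ x, StacksIn S (c x).stk) →
      (∀ x, StacksIn S (totalStep M (c x)).stk) ∧
      ∀ H, Computes (cfgWires S (H + d) c) (C * (H + 1))
        (cfgWires S H fun x => totalStep M (c x)) := by
  choose d C h using fun l => computes_stepAux S (M l) (hM l)
  obtain ⟨C', hC'⟩ := computes_select_cfg (O := Option Λ) (Λ := Λ) (σ := σ) S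
  refine ⟨∑ l, d l, Fintype.card Λ * (∑ l, C l) + C', fun {X} c hc => ?_⟩
  have hd : ∀ l, d l ≤ ∑ l, d l := fun l =>
    Finset.single_le_sum (f := d) (fun _ _ => Nat.zero_le _) (Finset.mem_univ l)
  have hCl : ∀ l, C l ≤ ∑ l, C l := fun l =>
    Finset.single_le_sum (f := C) (fun _ _ => Nat.zero_le _) (Finset.mem_univ l)
  refine ⟨fun x => ?_, fun H => ?_⟩
  · rcases hl : (c x).l with _ | l
    · simpa [totalStep, hl] using hc x
    · simpa [totalStep, hl] using (h l (fun x => (c x).var) (fun x => (c x).stk) hc).1 x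
  · set c' : Option Λ → X → TM2.Cfg Γ Λ σ := fun o x =>
      match o with
      | none => c x
      | some l => TM2.stepAux (M l) (c x).var (c x).stk with hc'
    have h1 : Computes (cfgWires S (H + ∑ l, d l) c)
        ((Finset.univ : Finset Λ).card * ((∑ l, C l) * (H + 1)))
        (⋃ l ∈ (Finset.univ : Finset Λ), cfgWires S H (c' (some l))) := by
      refine Computes.biUnion _ _ fun l _ => ?_
      refine ((h l (fun x => (c x).var) (fun x => (c x).stk) hc).2 H).mono ?_
        (Nat.mul_le_mul_right _ (hCl l)) le_rfl
      exact (stateWires_mono S (by have := hd l; omega) _ _).trans Set.subset_union_right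
    have h2 := hC' (fun x => (c x).l) c' H
    have e : (fun x => c' (c x).l x) = fun x => totalStep M (c x) := by
      ext1 x
      simp only [hc', totalStep]
    rw [e] at h2
    refine (h1.comp (h2.mono ?_ le_rfl le_rfl)).mono le_rfl ?_ le_rfl
    · rintro g ((hg | hg) | hg)
      · rw [Set.mem_singleton_iff.1 hg]
        exact Or.inl (Or.inr false_mem_stateWires)
      · exact Or.inl (Or.inl hg)
      · obtain ⟨o, hg⟩ := Set.mem_iUnion.1 hg
        cases o with
        | none => exact Or.inl (cfgWires_mono S (by omega) _ hg)
        | some l =>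
          right
          simp only [Set.mem_iUnion]
          exact ⟨l, Finset.mem_univ l, hg⟩
    · rw [Finset.card_univ]
      apply le_of_eq
      ring

/-- Each step determines `d` cells fewer than it reads, so knowing `H` cells after `T` steps
requires `H + T * d` at the start. That depth also bounds the cost of every single step. -/
lemma computes_iterate_totalStep (S : ∀ k, Finset (Option (Γ k))) (M : Λ → TM2.Stmt Γ Λ σ)
    (hM : ∀ l, PushesIn S (M l)) :
    ∃ d C : ℕ, ∀ {X : Type} (c : X → TM2.Cfg Γ Λ σ), (∀ x, StacksIn S (c x).stk) → ∀ T H : ℕ,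
      Computes (cfgWires S (H + T * d) c) (T * (C * (H + T * d + 1)))
        (cfgWires S H fun x => (totalStep M)^[T] (c x)) := by
  obtain ⟨d, C, h⟩ := computes_totalStep S M hM
  refine ⟨d, C, fun c hc T => ?_⟩
  have hv : ∀ T x, StacksIn S ((totalStep M)^[T] (c x)).stk := by
    intro T
    induction T with
    | zero => exact hc
    | succ T ih =>
      intro x
      rw [Function.iterate_succ_apply']
      exact (h (fun x => (totalStep M)^[T] (c x)) ih).1 x
  induction T with
  | zero => intro H; simpa using Computes.of_subset le_rfl
  | succ T ih =>
    intro H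
    simp only [Function.iterate_succ_apply']
    have h1 := ih (H + d)
    have h2 := (h (fun x => (totalStep M)^[T] (c x)) (hv T)).2 H
    rw [show H + (T + 1) * d = H + d + T * d by ring]
    refine (h1.comp (h2.mono Set.subset_union_right le_rfl le_rfl)).mono le_rfl ?_ le_rfl
    rw [add_mul, one_mul]
    refine Nat.add_le_add_left (Nat.mul_le_mul_left _ (by omega)) _

omit [Fintype K] [Fintype Λ] [Fintype σ] in
-- The partial step is absorbed by `none`, so a run ending in `some b` never steps from a halted
-- configuration, and elsewhere the two step functions agree.
lemma iterate_totalStep_of_iterate_step (M : Λ → TM2.Stmt Γ Λ σ) {s : ℕ} :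
    ∀ {a b : TM2.Cfg Γ Λ σ}, (flip bind (TM2.step M))^[s] (some a) = some b →
      (totalStep M)^[s] a = b := by
  have hnone : ∀ s, (flip bind (TM2.step M))^[s] none = none := by
    intro s
    induction s with
    | zero => rfl
    | succ s ih => rw [Function.iterate_succ_apply]; exact ih
  induction s with
  | zero => intro a b h; exact Option.some_injective _ h
  | succ s ih =>
    intro a b h
    rw [Function.iterate_succ_apply] at h ⊢
    obtain ⟨l, v, T⟩ := a
    cases l with
    | none =>
      have : flip bind (TM2.step M) (some ⟨none, v, T⟩) = none := rfl
      rw [this, hnone] at h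
      exact absurd h (by simp)
    | some l => exact ih h

omit [Fintype K] [Fintype Λ] [Fintype σ] in
lemma iterate_totalStep_of_halted (M : Λ → TM2.Stmt Γ Λ σ) {c : TM2.Cfg Γ Λ σ} (h : c.l = none)
    (s : ℕ) : (totalStep M)^[s] c = c :=
  Function.iterate_fixed (by simp [totalStep, h]) s

end StackMachine

/-! ### From polynomial-time machines to NAND programs -/

lemma initList_stk_self (tm : Turing.FinTM2) (s : List (tm.Γ tm.k₀)) :
    (Turing.initList tm s).stk tm.k₀ = s := by
  simp [Turing.initList]

lemma initList_stk_of_ne (tm : Turing.FinTM2) (s : List (tm.Γ tm.k₀)) {k : tm.K}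
    (h : k ≠ tm.k₀) : (Turing.initList tm s).stk k = [] := by
  simp [Turing.initList, h]

lemma haltList_stk_self (tm : Turing.FinTM2) (s : List (tm.Γ tm.k₁)) :
    (Turing.haltList tm s).stk tm.k₁ = s := by
  simp [Turing.haltList]

/-- The constant zero and the bits of a key and an input. -/
def inputWires (l m : ℕ) : Set ((Fin l → Bool) × (Fin m → Bool) → Bool) :=
  {fun _ => false} ∪ (Set.range (fun (i : Fin l) x => x.1 i) ∪
    Set.range (fun (i : Fin m) x => x.2 i))

/-- One gate negates the bit, which yields both indicators; each value in `U` then costs `5 * (2 *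
2)` gates. -/
lemma computes_bit {X E : Type} {A : Set (X → Bool)} {b : X → Bool} (h0 : (fun _ => false) ∈ A)
    (hb : b ∈ A) (φ : Bool → E) (U : Finset E) :
    Computes A (1 + U.card * 20) (indicators (fun x => φ (b x)) U) := by
  have h1 : indicators b Finset.univ ⊆ A ∪ {fun x => !b x} := by
    rintro f ⟨a, -, rfl⟩
    cases a
    · right
      rw [Set.mem_singleton_iff]
      ext x
      cases b x <;> simp
    · left
      convert hb using 1
      ext x
      cases b x <;> simp
  have h2 := (Computes.not hb).comp
    (Computes.map φ U (A := A ∪ {fun x => !b x}) (Or.inl h0) h1 fun x => Finset.mem_univ _)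
  refine h2.mono le_rfl ?_ le_rfl
  simp

/-- A cell of the encoded word depends on a single bit of the key or of the input, and cells beyond
its end are constantly empty. -/
lemma exists_bit_encode (n : ℕ → ℕ) (l : ℕ) {E : Type} (g : Bool ⊕ Bool → E) (i : ℕ) :
    ∃ b ∈ inputWires l (n l), ∃ φ : Bool → Option E, ∀ x : (Fin l → Bool) × (Fin (n l) → Bool),
      ((encodeKeyInput (n := n) ⟨l, x⟩).map g)[i]? = φ (b x) := by
  by_cases h1 : i < l
  · refine ⟨fun x => x.1 ⟨i, h1⟩, Or.inr (Or.inl ⟨⟨i, h1⟩, rfl⟩), fun b => some (g (Sum.inl b)),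
      fun x => ?_⟩
    simp [encodeKeyInput, List.getElem?_append, h1]
  · by_cases h2 : i - l < n l
    · refine ⟨fun x => x.2 ⟨i - l, h2⟩, Or.inr (Or.inr ⟨⟨i - l, h2⟩, rfl⟩),
        fun b => some (g (Sum.inr b)), fun x => ?_⟩
      simp [encodeKeyInput, List.getElem?_append, h1, h2]
    · refine ⟨fun _ => false, Or.inl rfl, fun _ => none, fun x => ?_⟩
      simp [encodeKeyInput]
      omega

lemma length_encodeKeyInput (n : ℕ → ℕ) (l : ℕ) (x : (Fin l → Bool) × (Fin (n l) → Bool)) :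
    (encodeKeyInput (n := n) ⟨l, x⟩).length = l + n l := by
  simp [encodeKeyInput]

/-- Functions computed in polynomial time have NAND programs of polynomial length. -/
theorem IsPolyTime.computes {n : ℕ → ℕ}
    {F : ∀ l, (Fin l → Bool) → (Fin (n l) → Bool) → Bool} (hF : IsPolyTime n F) :
    ∃ p : Polynomial ℕ, ∀ l, Computes (inputWires l (n l)) (p.eval (l + n l))
      {fun x => F l x.1 x.2} := by
  classical
  obtain ⟨P⟩ := hF
  obtain ⟨⟨tm, inA, outA⟩, time, hout⟩ := P
  let _ := tm.kFin
  let _ := tm.ΛFin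
  let _ := tm.σFin
  let _ := tm.Γk₀Fin
  let _ := tm.kDecidableEq
  choose S₀ hS₀ using fun l => exists_pushesIn (tm.m l)
  -- All symbols that can occur: those pushed by statements, the empty cell, the input alphabet, and
  -- the code of `true`, whose indicator will be the output wire.
  set S : ∀ k, Finset (Option (tm.Γ k)) := fun k =>
    ((Finset.univ.biUnion fun l => S₀ l k) ∪ {none}) ∪
      ((if h : k = tm.k₀ then Finset.univ.image (fun a : tm.Γ tm.k₀ => some (h ▸ a)) else ∅) ∪
      (if h : k = tm.k₁ then {some (h ▸ outA.symm true)} else ∅)) with hS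
  have hpush : ∀ l, PushesIn S (tm.m l) := fun l => hS₀ l S fun k =>
    ((Finset.subset_biUnion_of_mem (fun l => S₀ l k) (Finset.mem_univ l)).trans
      Finset.subset_union_left).trans Finset.subset_union_left
  have hnone : ∀ k, none ∈ S k := fun k => by simp [hS]
  have hin : ∀ a : tm.Γ tm.k₀, some a ∈ S tm.k₀ := fun a => by simp [hS]
  have hone : some (outA.symm true) ∈ S tm.k₁ := by simp [hS]
  obtain ⟨d, C, hiter⟩ := computes_iterate_totalStep S tm.m hpush
  set s := ∑ k, (S k).card with hs
  set C₀ := (1 + Fintype.card (Option tm.Λ) * 20) + (1 + Fintype.card tm.σ * 20) +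
    Fintype.card tm.K * (1 + s * 20) with hC₀
  -- The first summand loads `1 + T * d` cells per stack, the second runs `T` steps down to one cell
  -- per stack; both have `T * d + 2` as the factor `H + 1` or `H + T * d + 1`.
  refine ⟨Polynomial.C C₀ * (time * Polynomial.C d + 2) +
    time * (Polynomial.C C * (time * Polynomial.C d + 2)), fun l => ?_⟩
  set T := time.eval (l + n l) with hT
  set c : (Fin l → Bool) × (Fin (n l) → Bool) → Turing.TM2.Cfg tm.Γ tm.Λ tm.σ := fun x =>
    Turing.initList tm ((encodeKeyInput (n := n) ⟨l, x⟩).map inA.invFun) with hc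
  have hvalid : ∀ x, StacksIn S (c x).stk := by
    intro x k
    refine ⟨hnone k, fun a ha => ?_⟩
    by_cases hk : k = tm.k₀
    · subst hk
      exact hin a
    · rw [hc] at ha
      simp only [initList_stk_of_ne tm _ hk] at ha
      exact absurd ha (by simp)
  have hres : ∀ x, (totalStep tm.m)^[T] (c x) =
      Turing.haltList tm ([F l x.1 x.2].map outA.invFun) := by
    intro x
    obtain ⟨⟨r, hr⟩, hle⟩ := hout ⟨l, x⟩
    have h1 := iterate_totalStep_of_iterate_step tm.m hr
    have h2 : r ≤ T := by
      rw [hT, ← length_encodeKeyInput n l x]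
      exact hle
    -- The halting time `r` depends on the input. Halted configurations are fixed points, so every
    -- run can be prolonged to the common length `T`.
    obtain ⟨r', hr'⟩ := Nat.exists_eq_add_of_le h2
    rw [hr', add_comm, Function.iterate_add_apply]
    refine (congrArg _ h1).trans ?_
    exact iterate_totalStep_of_halted tm.m rfl r'
  have h0 : (fun _ => false) ∈ inputWires l (n l) := Or.inl rfl
  have hinit : ∀ H, Computes (inputWires l (n l)) (C₀ * (H + 1)) (cfgWires S H c) := by
    intro H
    have g1 : Computes (inputWires l (n l)) (1 + (Finset.univ : Finset (Option tm.Λ)).card * 20)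
        (indicators (fun x => (c x).l) Finset.univ) :=
      computes_bit h0 h0 (fun _ => some tm.main) Finset.univ
    have g2 : Computes (inputWires l (n l)) (1 + (Finset.univ : Finset tm.σ).card * 20)
        (indicators (fun x => (c x).var) Finset.univ) :=
      computes_bit h0 h0 (fun _ => tm.initialState) Finset.univ
    have g3 : Computes (inputWires l (n l)) ((Finset.univ : Finset tm.K).card *
        ((Finset.range H).card * (1 + s * 20))) (cellWires S H fun x => (c x).stk) := by
      refine Computes.biUnion _ _ fun k _ => Computes.biUnion _ _ fun i _ => ?_
      have hk : ∃ b ∈ inputWires l (n l), ∃ φ : Bool → Option (tm.Γ k), ∀ x,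
          ((c x).stk k)[i]? = φ (b x) := by
        by_cases hk : k = tm.k₀
        · subst hk
          obtain ⟨b, hb, φ, hφ⟩ := exists_bit_encode n l inA.invFun i
          refine ⟨b, hb, φ, fun x => ?_⟩
          rw [← hφ x, hc]
          simp only [initList_stk_self]
        · refine ⟨_, h0, fun _ => none, fun x => ?_⟩
          rw [hc]
          simp only [initList_stk_of_ne tm _ hk]
          rfl
      obtain ⟨b, hb, φ, hφ⟩ := hk
      simp only [hφ]
      refine (computes_bit h0 hb φ (S k)).mono le_rfl ?_ le_rfl
      have : (S k).card ≤ s := Finset.single_le_sum (f := fun k => (S k).card)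
        (fun _ _ => Nat.zero_le _) (Finset.mem_univ k)
      omega
    refine (g1.union (((Computes.of_subset (s := 0)
      (Set.singleton_subset_iff.2 h0)).union g2).union g3)).mono le_rfl ?_ le_rfl
    simp only [Finset.card_univ, Finset.card_range, hC₀]
    nlinarith [Nat.zero_le ((1 + Fintype.card (Option tm.Λ) * 20) * H),
      Nat.zero_le ((1 + Fintype.card tm.σ * 20) * H),
      Nat.zero_le (Fintype.card tm.K * (1 + s * 20))]
  refine ((hinit (1 + T * d)).comp
    ((hiter c hvalid T 1).mono Set.subset_union_right le_rfl le_rfl)).mono le_rfl ?_ ?_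
  · simp only [Polynomial.eval_add, Polynomial.eval_mul, Polynomial.eval_C,
      Polynomial.eval_ofNat, ← hT]
    apply le_of_eq
    ring
  · rw [Set.singleton_subset_iff]
    -- The result is the indicator that the top cell of the output stack encodes `true`.
    refine Or.inr (indicators_cell_subset tm.k₁ (i := 0) (by omega)
      (mem_indicators hone fun x => ?_))
    change _ ↔ (((totalStep tm.m)^[T] (c x)).stk tm.k₁)[0]? = _
    rw [hres x, haltList_stk_self]
    cases hFx : F l x.1 x.2 <;> simp

end QCrypto

namespace QCrypto

/-! ### Lists of gates acting on vectors -/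

/-- The computational basis vector `|z⟩`. -/
def ket {ι : Type} [DecidableEq ι] [Fintype ι] (z : ι → Bool) : (ι → Bool) → ℂ := Pi.single z 1

lemma ket_apply {ι : Type} [DecidableEq ι] [Fintype ι] (z w : ι → Bool) :
    ket z w = if w = z then 1 else 0 := by
  simp [ket, Pi.single_apply]

lemma mulVec_ket {ι : Type} [DecidableEq ι] [Fintype ι] {m : Type*}
    (M : Matrix m (ι → Bool) ℂ) (z : ι → Bool) (w : m) : (M *ᵥ ket z) w = M w z := by
  simp [ket]

lemma matrix_ext_ket {ι : Type} [DecidableEq ι] [Fintype ι] {m : Type*}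
    {M M' : Matrix m (ι → Bool) ℂ} (h : ∀ z, M *ᵥ ket z = M' *ᵥ ket z) : M = M' := by
  ext w z
  rw [← mulVec_ket M, ← mulVec_ket M', h]

/-- The operator of a list of gates, whose head is applied first. -/
def gatesOp {G : Type} {N : ℕ} (op : G → Op (Fin N)) (gs : List G) : Op (Fin N) :=
  gs.foldl (fun U γ => op γ * U) 1

section gatesOp

variable {G : Type} {N : ℕ} (op : G → Op (Fin N))

lemma foldl_mul_eq (gs : List G) (V : Op (Fin N)) :
    gs.foldl (fun U γ => op γ * U) V = gatesOp op gs * V := by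
  induction gs generalizing V with
  | nil => simp [gatesOp]
  | cons γ gs ih =>
    rw [gatesOp, List.foldl_cons, List.foldl_cons, ih, ih (op γ * 1), mul_one, Matrix.mul_assoc]

@[simp] lemma gatesOp_nil : gatesOp op [] = 1 := rfl

lemma gatesOp_append (gs gs' : List G) :
    gatesOp op (gs ++ gs') = gatesOp op gs' * gatesOp op gs := by
  rw [gatesOp, List.foldl_append, foldl_mul_eq]
  rfl

lemma gatesOp_cons (γ : G) (gs : List G) : gatesOp op (γ :: gs) = gatesOp op gs * op γ := by
  rw [gatesOp, List.foldl_cons, foldl_mul_eq, mul_one]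

lemma gatesOp_append_mulVec (gs gs' : List G) (v : (Fin N → Bool) → ℂ) :
    gatesOp op (gs ++ gs') *ᵥ v = gatesOp op gs' *ᵥ (gatesOp op gs *ᵥ v) := by
  rw [gatesOp_append, Matrix.mulVec_mulVec]

lemma gatesOp_cons_mulVec (γ : G) (gs : List G) (v : (Fin N → Bool) → ℂ) :
    gatesOp op (γ :: gs) *ᵥ v = gatesOp op gs *ᵥ (op γ *ᵥ v) := by
  rw [gatesOp_cons, Matrix.mulVec_mulVec]

lemma gatesOp_nil_mulVec (v : (Fin N → Bool) → ℂ) : gatesOp op [] *ᵥ v = v := by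
  rw [gatesOp_nil, Matrix.one_mulVec]

lemma gatesOp_map {G' : Type} (φ : G' → G) (gs : List G') :
    gatesOp op (gs.map φ) = gatesOp (fun γ => op (φ γ)) gs := by
  rw [gatesOp, List.foldl_map]
  rfl

end gatesOp

/-! ### The action of single gates -/

variable {N : ℕ}

/-- The phase of the gate `T`. -/
def tPhase : ℂ := Complex.exp (Complex.I * (Real.pi / 4))

lemma tPhase_pow_four : tPhase ^ 4 = -1 := by
  rw [tPhase, ← Complex.exp_nat_mul, ← Complex.exp_pi_mul_I]
  congr 1
  push_cast
  ring

lemma tPhase_pow_eight : tPhase ^ 8 = 1 := by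
  rw [show (8 : ℕ) = 4 * 2 from rfl, pow_mul, tPhase_pow_four]
  norm_num

lemma T_op_mulVec_ket (i : Fin N) (z : Fin N → Bool) :
    (Gate.T i).op *ᵥ ket z = (tPhase ^ (z i).toNat) • ket z := by
  ext w
  rw [mulVec_ket, Pi.smul_apply, ket_apply, Gate.op, Matrix.diagonal_apply]
  by_cases h : w = z
  · subst h
    cases hi : w i <;> simp [tPhase]
  · simp [h]

lemma CNOT_op_mulVec_ket (c t : Fin N) (h : c ≠ t) (z : Fin N → Bool) :
    (Gate.CNOT c t h).op *ᵥ ket z = ket (Function.update z t (xor (z t) (z c))) := by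
  ext w
  rw [mulVec_ket, ket_apply]
  rfl

lemma H_op_mulVec_apply (i : Fin N) (v : (Fin N → Bool) → ℂ) (z : Fin N → Bool) :
    ((Gate.H i).op *ᵥ v) z = (Real.sqrt 2 : ℂ)⁻¹ * (v (Function.update z i false) +
      (if z i = true then -1 else 1) * v (Function.update z i true)) := by
  have key : ∀ w : Fin N → Bool, (∀ j, j ≠ i → z j = w j) ↔
      w = Function.update z i false ∨ w = Function.update z i true := by
    intro w
    constructor
    · intro h
      have : w = Function.update z i (w i) := by
        ext j
        by_cases hj : j = i
        · subst hj; simp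
        · simp [hj, h j hj]
      cases hw : w i
      · left; rw [this, hw]
      · right; rw [this, hw]
    · rintro (rfl | rfl) j hj <;> simp [hj]
  have hne : Function.update z i false ≠ Function.update z i true := fun h => by
    simpa using congrFun h i
  rw [Matrix.mulVec, dotProduct]
  have : ∀ w, (Gate.H i).op z w * v w =
      if w ∈ ({Function.update z i false, Function.update z i true} : Finset (Fin N → Bool)) then
        (Real.sqrt 2 : ℂ)⁻¹ * (if z i = true ∧ w i = true then -1 else 1) * v w else 0 := by
    intro w
    simp only [Gate.op, Matrix.of_apply, key w, Finset.mem_insert, Finset.mem_singleton]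
    split_ifs <;> simp
  simp only [this]
  rw [Finset.sum_ite_mem, Finset.univ_inter, Finset.sum_pair hne]
  simp only [Function.update_self, Bool.false_eq_true, and_false, and_true, if_false]
  ring

lemma H_op_mulVec_ket (i : Fin N) (z : Fin N → Bool) :
    (Gate.H i).op *ᵥ ket z = (Real.sqrt 2 : ℂ)⁻¹ • (ket (Function.update z i false) +
      (if z i = true then (-1 : ℂ) else 1) • ket (Function.update z i true)) := by
  ext w
  rw [H_op_mulVec_apply]
  simp only [ket_apply, Pi.smul_apply, Pi.add_apply, smul_eq_mul]
  congr 1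
  have h : ∀ b c : Bool, (Function.update w i b = z ∧ w i = c) ↔
      (w = Function.update z i c ∧ z i = b) := by
    intro b c
    constructor
    · rintro ⟨rfl, rfl⟩; simp
    · rintro ⟨rfl, rfl⟩; simp
  have hff := h false false
  have hft := h false true
  have htf := h true false
  have htt := h true true
  cases hz : z i <;> cases hw : w i <;> simp_all

lemma sqrt_two_inv_mul_self : (Real.sqrt 2 : ℂ)⁻¹ * (Real.sqrt 2 : ℂ)⁻¹ = 1 / 2 := by
  rw [← mul_inv, ← Complex.ofReal_mul, Real.mul_self_sqrt (by norm_num)]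
  norm_num

lemma H_op_mulVec_H_op_mulVec_ket (i : Fin N) (z : Fin N → Bool) :
    (Gate.H i).op *ᵥ ((Gate.H i).op *ᵥ ket z) = ket z := by
  rw [H_op_mulVec_ket, Matrix.mulVec_smul, Matrix.mulVec_add, Matrix.mulVec_smul,
    H_op_mulVec_ket, H_op_mulVec_ket]
  have hz : z = Function.update z i (z i) := by simp
  conv_rhs => rw [hz]
  simp only [Function.update_self, Function.update_idem, Bool.false_eq_true, if_false, if_true,
    one_smul]
  rw [smul_comm, ← smul_add, smul_smul, sqrt_two_inv_mul_self]
  cases z i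
  · ext w; simp; ring
  · ext w; simp; ring

/-! ### Derived gates -/

/-- The Pauli `Z` gate. -/
def zGates (i : Fin N) : List (Gate N) := List.replicate 4 (.T i)

lemma replicate_T_mulVec_ket (k : ℕ) (i : Fin N) (z : Fin N → Bool) :
    gatesOp Gate.op (List.replicate k (.T i)) *ᵥ ket z = (tPhase ^ (k * (z i).toNat)) • ket z := by
  induction k with
  | zero => simp
  | succ k ih =>
    rw [List.replicate_succ, gatesOp_cons_mulVec, T_op_mulVec_ket, Matrix.mulVec_smul, ih,
      smul_smul, ← pow_add]
    congr 2
    ring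

lemma zGates_mulVec_ket (i : Fin N) (z : Fin N → Bool) :
    gatesOp Gate.op (zGates i) *ᵥ ket z = (-1 : ℂ) ^ (z i).toNat • ket z := by
  rw [zGates, replicate_T_mulVec_ket, pow_mul, tPhase_pow_four]

/-- The Pauli `X` gate. -/
def xGates (i : Fin N) : List (Gate N) := [.H i] ++ zGates i ++ [.H i]

lemma xGates_mulVec_ket (i : Fin N) (z : Fin N → Bool) :
    gatesOp Gate.op (xGates i) *ᵥ ket z = ket (Function.update z i (!z i)) := by
  -- As the Hadamard gate is an involution, the target is rewritten as its image under two
  -- Hadamards, so that the outer one cancels on both sides.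
  rw [xGates, gatesOp_append_mulVec, gatesOp_append_mulVec, gatesOp_cons_mulVec,
    gatesOp_nil_mulVec, gatesOp_cons_mulVec, gatesOp_nil_mulVec,
    ← H_op_mulVec_H_op_mulVec_ket i (Function.update z i (!z i)), H_op_mulVec_ket i z,
    H_op_mulVec_ket i (Function.update z i (!z i))]
  congr 1
  rw [Matrix.mulVec_smul, Matrix.mulVec_add, Matrix.mulVec_smul, zGates_mulVec_ket,
    zGates_mulVec_ket]
  cases z i <;> simp

/-- The doubly controlled `Z` gate. -/
def cczGates (a b c : Fin N) (hab : a ≠ b) (hac : a ≠ c) (hbc : b ≠ c) : List (Gate N) :=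
  [.T a, .T b, .T c, .CNOT a b hab] ++ List.replicate 7 (.T b) ++
    [.CNOT b c hbc, .T c, .CNOT a b hab, .CNOT b c hbc] ++ List.replicate 7 (.T c) ++
    [.CNOT a c hac, .CNOT b c hbc] ++ List.replicate 7 (.T c) ++ [.CNOT b c hbc]

/-- Over the integers, `4abc = a + b + c - (a ⊕ b) - (a ⊕ c) - (b ⊕ c) + (a ⊕ b ⊕ c)`. The CNOTs
bring each parity onto a wire, where `T` or its inverse `T ^ 7` adds its phase, and `tPhase ^ 4 =
-1`. -/
lemma cczGates_mulVec_ket (a b c : Fin N) (hab : a ≠ b) (hac : a ≠ c) (hbc : b ≠ c)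
    (z : Fin N → Bool) : gatesOp Gate.op (cczGates a b c hab hac hbc) *ᵥ ket z =
      (-1 : ℂ) ^ (z a && z b && z c).toNat • ket z := by
  have e : ∀ w : Fin N → Bool, w a = z a → w b = z b → w c = z c →
      (∀ j, j ≠ a → j ≠ b → j ≠ c → w j = z j) → w = z := by
    intro w ha hb hc h
    ext j
    by_cases h1 : j = a
    · rw [h1, ha]
    by_cases h2 : j = b
    · rw [h2, hb]
    by_cases h3 : j = c
    · rw [h3, hc]
    rw [h j h1 h2 h3]
  simp only [cczGates, gatesOp_append_mulVec, gatesOp_cons_mulVec, gatesOp_nil_mulVec,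
    T_op_mulVec_ket, CNOT_op_mulVec_ket, replicate_T_mulVec_ket, Matrix.mulVec_smul, smul_smul,
    Function.update_self, Function.update_of_ne hab, Function.update_of_ne hac,
    Function.update_of_ne hbc, Function.update_of_ne hbc.symm]
  congr 1
  · rw [← tPhase_pow_four]
    have h16 : tPhase ^ 16 = 1 := by
      rw [show (16 : ℕ) = 8 * 2 from rfl, pow_mul, tPhase_pow_eight, one_pow]
    simp only [← pow_add, ← pow_mul]
    cases z a <;> cases z b <;> cases z c <;> simp [h16]
  · congr 1
    apply e
    · simp [hab, hac]
    · simp [hbc]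
    · cases z a <;> cases z b <;> cases z c <;> simp
    · intro j h1 h2 h3
      simp [h2, h3]

/-- The Toffoli gate. -/
def toffoliGates (a b t : Fin N) (hab : a ≠ b) (hat : a ≠ t) (hbt : b ≠ t) : List (Gate N) :=
  [.H t] ++ cczGates a b t hab hat hbt ++ [.H t]

lemma toffoliGates_mulVec_ket (a b t : Fin N) (hab : a ≠ b) (hat : a ≠ t) (hbt : b ≠ t)
    (z : Fin N → Bool) : gatesOp Gate.op (toffoliGates a b t hab hat hbt) *ᵥ ket z =
      ket (Function.update z t (xor (z t) (z a && z b))) := by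
  rw [toffoliGates, gatesOp_append_mulVec, gatesOp_append_mulVec, gatesOp_cons_mulVec,
    gatesOp_nil_mulVec, gatesOp_cons_mulVec, gatesOp_nil_mulVec,
    ← H_op_mulVec_H_op_mulVec_ket t (Function.update z t _), H_op_mulVec_ket t z,
    H_op_mulVec_ket t (Function.update z t _)]
  congr 1
  rw [Matrix.mulVec_smul, Matrix.mulVec_add, Matrix.mulVec_smul, cczGates_mulVec_ket,
    cczGates_mulVec_ket]
  simp only [Function.update_self, Function.update_idem, Function.update_of_ne hat,
    Function.update_of_ne hbt]
  cases z a <;> cases z b <;> cases z t <;> simp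

/-- The gate that adds the NAND of two wires to a third one. -/
def nandGates (a b t : Fin N) (hat : a ≠ t) (hbt : b ≠ t) : List (Gate N) :=
  (if hab : a = b then [.CNOT a t hat] else toffoliGates a b t hab hat hbt) ++ xGates t

lemma nandGates_mulVec_ket (a b t : Fin N) (hat : a ≠ t) (hbt : b ≠ t) (z : Fin N → Bool) :
    gatesOp Gate.op (nandGates a b t hat hbt) *ᵥ ket z =
      ket (Function.update z t (xor (z t) (!(z a && z b)))) := by
  rw [nandGates, gatesOp_append_mulVec]
  -- A NAND may read the same wire twice, as negation does; a Toffoli needs distinct controls, so a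
  -- CNOT replaces it.
  split_ifs with hab
  · subst hab
    rw [gatesOp_cons_mulVec, gatesOp_nil_mulVec, CNOT_op_mulVec_ket, xGates_mulVec_ket]
    simp
  · rw [toffoliGates_mulVec_ket, xGates_mulVec_ket]
    cases z a <;> cases z b <;> simp

/-- The count is `34` for the Toffoli gate, being `32 + 2`, and `6` for the `X` gate. -/
lemma length_nandGates_le (a b t : Fin N) (hat : a ≠ t) (hbt : b ≠ t) :
    (nandGates a b t hat hbt).length ≤ 40 := by
  rw [nandGates, List.length_append]
  split_ifs <;> simp [xGates, zGates, toffoliGates, cczGates]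

/-! ### Layers of Hadamard gates -/

/-- Hadamard gates on all wires in the range of `e`. -/
def hadamardLayer {ι : Type} [Fintype ι] (e : ι ↪ Fin N) : List (Gate N) :=
  (Finset.univ : Finset ι).toList.map fun i => .H (e i)

lemma length_hadamardLayer {ι : Type} [Fintype ι] (e : ι ↪ Fin N) :
    (hadamardLayer e).length = Fintype.card ι := by
  simp [hadamardLayer]

/-- Induction on the last gate: its wire still carries zero, so only the component with `false` at
`i` contributes. -/
lemma map_H_mulVec_ket (l : List (Fin N)) (hl : l.Nodup) (z : Fin N → Bool)
    (hz : ∀ i ∈ l, z i = false) (w : Fin N → Bool) :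
    (gatesOp Gate.op (l.map .H) *ᵥ ket z) w =
      if ∀ i, i ∉ l → w i = z i then ((Real.sqrt 2 : ℂ)⁻¹) ^ l.length else 0 := by
  induction l using List.reverseRecOn generalizing w with
  | nil =>
    simp only [List.map_nil, gatesOp_nil_mulVec, ket_apply, List.not_mem_nil, not_false_eq_true,
      forall_const, List.length_nil, pow_zero, funext_iff]
  | append_singleton l i ih =>
    rw [List.nodup_append] at hl
    have hi : i ∉ l := fun h => hl.2.2 i h i (by simp) rfl
    have ih' := ih hl.1 fun j hj => hz j (by simp [hj])
    rw [List.map_append, gatesOp_append_mulVec, List.map_cons, List.map_nil, gatesOp_cons_mulVec,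
      gatesOp_nil_mulVec, H_op_mulVec_apply, ih', ih']
    have h1 : ¬ ∀ j, j ∉ l → Function.update w i true j = z j := fun h => by
      have := h i hi
      rw [hz i (by simp)] at this
      simp at this
    have h2 : (∀ j, j ∉ l → Function.update w i false j = z j) ↔
        ∀ j, j ∉ l ++ [i] → w j = z j := by
      constructor
      · intro h j hj
        simp only [List.mem_append, List.mem_singleton, not_or] at hj
        rw [← h j hj.1, Function.update_of_ne hj.2]
      · intro h j hj
        by_cases hji : j = i
        · subst hji
          rw [Function.update_self, hz j (by simp)]
        · rw [Function.update_of_ne hji]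
          exact h j (by simp [hj, hji])
    rw [if_neg h1]
    simp only [h2, mul_zero, add_zero, mul_ite, List.length_append, List.length_singleton,
      pow_succ']

lemma extend_comp_self {ι : Type} (e : ι ↪ Fin N) (x : ι → Bool) (z : Fin N → Bool) :
    (fun i => Function.extend e x z (e i)) = x :=
  funext fun i => e.injective.extend_apply x z i

lemma eq_extend_iff {ι : Type} (e : ι ↪ Fin N) (x : ι → Bool) (z w : Fin N → Bool) :
    w = Function.extend e x z ↔
      (∀ i, w (e i) = x i) ∧ ∀ j, j ∉ Set.range e → w j = z j := by
  constructor
  · rintro rfl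
    exact ⟨fun i => e.injective.extend_apply x z i,
      fun j hj => Function.extend_apply' _ _ _ (by simpa using hj)⟩
  · rintro ⟨h1, h2⟩
    ext j
    by_cases hj : j ∈ Set.range e
    · obtain ⟨i, rfl⟩ := hj
      rw [e.injective.extend_apply, h1]
    · rw [Function.extend_apply' _ _ _ (by simpa using hj), h2 j hj]

lemma hadamardLayer_mulVec_ket {ι : Type} [Fintype ι] [DecidableEq ι] (e : ι ↪ Fin N)
    (z : Fin N → Bool) (hz : ∀ i, z (e i) = false) :
    gatesOp Gate.op (hadamardLayer e) *ᵥ ket z =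
      ∑ x : ι → Bool, ((Real.sqrt 2 : ℂ)⁻¹) ^ Fintype.card ι • ket (Function.extend e x z) := by
  ext w
  have hl : hadamardLayer e = ((Finset.univ : Finset ι).toList.map e).map .H := by
    simp [hadamardLayer, Function.comp_def]
  rw [hl, map_H_mulVec_ket]
  · simp only [List.mem_map, Finset.mem_toList, Finset.mem_univ, true_and, List.length_map,
      ← Set.mem_range,
      Finset.length_toList, Finset.card_univ, Finset.sum_apply, Pi.smul_apply, ket_apply,
      eq_extend_iff, smul_eq_mul, mul_ite, mul_one, mul_zero]
    by_cases h : ∀ j, j ∉ Set.range e → w j = z j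
    · rw [Finset.sum_eq_single (fun i => w (e i)), if_pos h, if_pos ⟨fun _ => rfl, h⟩]
      · intro x _ hx
        rw [if_neg]
        rintro ⟨h', -⟩
        exact hx (funext fun i => (h' i).symm)
      · simp
    · rw [if_neg h, Finset.sum_eq_zero fun x _ => if_neg fun h' => h h'.2]
  · exact (Finset.nodup_toList _).map e.injective
  · intro i hi
    obtain ⟨j, -, rfl⟩ := List.mem_map.1 hi
    exact hz j

end QCrypto

namespace QCrypto

/-! ### Reversible evaluation of NAND programs -/

/-- The register `z` carries the values at `x` of the wires `L`, and zeros elsewhere. -/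
def Loads {X : Type} {N : ℕ} (L : List (X → Bool)) (x : X) (z : Fin N → Bool) : Prop :=
  ∀ i : Fin N, z i = (L.reverse.map fun f => f x).getD i false

lemma NandExtends.length_le {X : Type} {L L' : List (X → Bool)} (h : NandExtends L L') :
    L.length ≤ L'.length := by
  induction h with
  | refl => exact le_rfl
  | step _ _ _ ih => exact ih.trans (by simp)

lemma exists_reverse_getElem {α : Type} {L : List α} {f : α} (h : f ∈ L) :
    ∃ i, ∃ hi : i < L.length, L.reverse[i]'(by simpa using hi) = f := by
  obtain ⟨i, hi, h⟩ := List.getElem_of_mem (List.mem_reverse.2 h)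
  exact ⟨i, by simpa using hi, h⟩

lemma Loads.apply {X : Type} {N : ℕ} {L : List (X → Bool)} {x : X} {z : Fin N → Bool}
    (h : Loads L x z) {i : ℕ} (hi : i < L.length) (hN : i < N) {f : X → Bool}
    (hf : L.reverse[i]'(by simpa using hi) = f) : z ⟨i, hN⟩ = f x := by
  rw [h, List.getD_eq_getElem _ _ (by simpa using hi), List.getElem_map, hf]

/-- A NAND program can be computed reversibly, and uncomputed. -/
lemma NandExtends.exists_gates {X : Type} {L L' : List (X → Bool)} (h : NandExtends L L')
    (N : ℕ) (hN : L'.length ≤ N) :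
    ∃ (gs gs' : List (Gate N)) (π : (Fin N → Bool) → Fin N → Bool),
      gs.length ≤ 40 * (L'.length - L.length) ∧ gs'.length ≤ 40 * (L'.length - L.length) ∧
      (∀ z, gatesOp Gate.op gs *ᵥ ket z = ket (π z)) ∧
      (∀ z, gatesOp Gate.op gs' *ᵥ ket (π z) = ket z) ∧
      ∀ x z, Loads L x z → Loads L' x (π z) := by
  induction h with
  | refl =>
    exact ⟨[], [], id, by simp, by simp, fun z => gatesOp_nil_mulVec _ _,
      fun z => gatesOp_nil_mulVec _ _, fun x z h => h⟩
  | @step L' f g hL hf hg ih =>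
    simp only [List.length_cons] at hN
    obtain ⟨gs, gs', π, h1, h2, h3, h4, h5⟩ := ih (by omega)
    obtain ⟨a, ha, hfa⟩ := exists_reverse_getElem hf
    obtain ⟨b, hb, hgb⟩ := exists_reverse_getElem hg
    set a' : Fin N := ⟨a, by omega⟩
    set b' : Fin N := ⟨b, by omega⟩
    -- New wires are consed, but `Loads` reads the list in reverse, so earlier wires keep their
    -- qubits and the new value goes to qubit `L'.length`, which is still zero.
    set t : Fin N := ⟨L'.length, by omega⟩ with ht
    have hat : a' ≠ t := fun h => by simp [a', t] at h; omega
    have hbt : b' ≠ t := fun h => by simp [b', t] at h; omega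
    have hlen := length_nandGates_le a' b' t hat hbt
    have hle := hL.length_le
    have hk := nandGates_mulVec_ket a' b' t hat hbt
    refine ⟨gs ++ nandGates a' b' t hat hbt, nandGates a' b' t hat hbt ++ gs',
      fun z => Function.update (π z) t (xor (π z t) (!(π z a' && π z b'))), ?_, ?_, ?_, ?_, ?_⟩
    · simp only [List.length_append, List.length_cons]
      omega
    · simp only [List.length_append, List.length_cons]
      omega
    · intro z
      rw [gatesOp_append_mulVec, h3, hk]
    · intro z
      -- Adding the NAND a second time cancels it, because the target differs from both controls.
      rw [gatesOp_append_mulVec, hk]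
      convert h4 z using 3
      simp [hat, hbt]
    · intro x z hz i
      have hz' := h5 x z hz
      have e1 : π z a' = f x := hz'.apply ha _ hfa
      have e2 : π z b' = g x := hz'.apply hb _ hgb
      have e3 : π z t = false := by
        rw [hz', List.getD_eq_default]
        simp [t]
      beta_reduce
      by_cases hi : i = t
      · subst hi
        rw [Function.update_self, e1, e2, e3, List.getD_eq_getElem _ _ (by simp [t])]
        simp [t]
      · rw [Function.update_of_ne hi, hz' i]
        have hi' : (i : ℕ) ≠ L'.length := fun h => hi (Fin.ext h)
        rw [List.reverse_cons, List.map_append]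
        rcases lt_or_gt_of_ne hi' with hlt | hgt
        · rw [List.getD_append _ _ _ _ (by simpa using hlt)]
        · rw [List.getD_eq_default _ _ (by simp; omega), List.getD_eq_default _ _ (by simp; omega)]

/-! ### Embedding of registers -/

/-- The isometry that adds qubits in state zero. -/
def embedMat {ι : Type} {N : ℕ} (e : ι ↪ Fin N) : Matrix (Fin N → Bool) (ι → Bool) ℂ :=
  Matrix.of fun z a => if z = Function.extend e a (fun _ => false) then 1 else 0

section embedMat

variable {ι κ : Type} [Fintype ι] [DecidableEq ι] {N N' : ℕ}

lemma embedMat_mulVec_ket (e : ι ↪ Fin N) (a : ι → Bool) :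
    embedMat e *ᵥ ket a = ket (Function.extend e a fun _ => false) := by
  ext z
  rw [mulVec_ket, ket_apply, embedMat, Matrix.of_apply]

omit [Fintype ι] [DecidableEq ι] in
lemma extend_injective (e : ι ↪ Fin N) (z : Fin N → Bool) :
    Function.Injective fun a : ι → Bool => Function.extend e a z := by
  intro a b h
  ext i
  have := congrFun h (e i)
  simpa [e.injective.extend_apply] using this

omit [DecidableEq ι] in
lemma conjTranspose_embedMat_mul_self (e : ι ↪ Fin N) : (embedMat e)ᴴ * embedMat e = 1 := by
  ext a b
  simp only [Matrix.mul_apply, Matrix.conjTranspose_apply, embedMat, Matrix.of_apply,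
    apply_ite star, star_one, star_zero, ite_mul, one_mul, zero_mul]
  rw [Finset.sum_ite_eq' Finset.univ, if_pos (Finset.mem_univ _), Matrix.one_apply]
  simp only [(extend_injective e fun _ => false).eq_iff]

lemma padZero_eq (e : ι ↪ Fin N) (ρ : Op ι) : padZero e ρ = embedMat e * ρ * (embedMat e)ᴴ := by
  have key : ∀ (z : Fin N → Bool) (a : ι → Bool),
      z = Function.extend e a (fun _ => false) ↔
        a = (fun i => z (e i)) ∧ ∀ j, j ∉ Set.range e → z j = false := by
    intro z a
    rw [eq_extend_iff]
    simp only [funext_iff, eq_comm]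
  ext z w
  simp only [Matrix.mul_apply, Matrix.conjTranspose_apply, embedMat, Matrix.of_apply,
    apply_ite star, star_one, star_zero, ite_mul, one_mul, zero_mul, mul_ite, mul_one, mul_zero,
    key, padZero]
  by_cases hw : ∀ j, j ∉ Set.range e → w j = false
  · by_cases hz : ∀ j, j ∉ Set.range e → z j = false
    · rw [if_pos fun j hj => ⟨hz j hj, hw j hj⟩]
      simp only [eq_true hw, eq_true hz, and_true, Finset.sum_ite_eq', Finset.mem_univ, if_true]
    · rw [if_neg fun h => hz fun j hj => (h j hj).1]
      simp only [eq_false hz, and_false, if_false, Finset.sum_const_zero, ite_self]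
  · rw [if_neg fun h => hw fun j hj => (h j hj).2]
    simp only [eq_false hw, and_false, if_false, Finset.sum_const_zero]

omit [Fintype ι] in
lemma extend_update (e : ι ↪ Fin N) (a : ι → Bool) (z : Fin N → Bool) (i : ι) (b : Bool) :
    Function.update (Function.extend e a z) (e i) b =
      Function.extend e (Function.update a i b) z := by
  rw [eq_extend_iff]
  constructor
  · intro j
    by_cases hj : j = i
    · subst hj; simp
    · rw [Function.update_of_ne (e.injective.ne hj), e.injective.extend_apply,
        Function.update_of_ne hj]
  · intro j hj
    rw [Function.update_of_ne fun h => hj ⟨i, h.symm⟩,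
      Function.extend_apply' _ _ _ (by simpa using hj)]

/-- A gate acting on a larger register. -/
def Gate.lift (e : Fin N ↪ Fin N') : Gate N → Gate N'
  | .H i => .H (e i)
  | .T i => .T (e i)
  | .CNOT c t h => .CNOT (e c) (e t) fun h' => h (e.injective h')

/-- Checked on basis vectors: a lifted gate never touches the added qubits, which stay zero. -/
lemma lift_op_mul_embedMat (e : Fin N ↪ Fin N') (γ : Gate N) :
    (γ.lift e).op * embedMat e = embedMat e * γ.op := by
  refine matrix_ext_ket fun z => ?_
  rw [← Matrix.mulVec_mulVec, ← Matrix.mulVec_mulVec, embedMat_mulVec_ket]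
  cases γ with
  | H i =>
    rw [Gate.lift, H_op_mulVec_ket, H_op_mulVec_ket, Matrix.mulVec_smul, Matrix.mulVec_add,
      Matrix.mulVec_smul, embedMat_mulVec_ket, embedMat_mulVec_ket, extend_update, extend_update,
      e.injective.extend_apply]
  | T i =>
    rw [Gate.lift, T_op_mulVec_ket, T_op_mulVec_ket, Matrix.mulVec_smul, embedMat_mulVec_ket,
      e.injective.extend_apply]
  | CNOT c t h =>
    rw [Gate.lift, CNOT_op_mulVec_ket, CNOT_op_mulVec_ket, embedMat_mulVec_ket, extend_update,
      e.injective.extend_apply, e.injective.extend_apply]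

lemma gatesOp_lift_mul_embedMat (e : Fin N ↪ Fin N') (gs : List (Gate N)) :
    gatesOp Gate.op (gs.map (Gate.lift e)) * embedMat e = embedMat e * gatesOp Gate.op gs := by
  induction gs with
  | nil => simp
  | cons γ gs ih =>
    rw [List.map_cons, gatesOp_cons, gatesOp_cons, Matrix.mul_assoc, lift_op_mul_embedMat,
      ← Matrix.mul_assoc, ih, Matrix.mul_assoc]

end embedMat

/-! ### Unitarity -/

lemma conjTranspose_gate_op_mul_self {N : ℕ} (γ : Gate N) : γ.opᴴ * γ.op = 1 := by
  cases γ with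
  | H i =>
    have hs : (Gate.H i : Gate N).opᴴ = (Gate.H i).op := by
      ext z w
      simp only [Matrix.conjTranspose_apply, Gate.op, Matrix.of_apply]
      have h1 : (∀ j, j ≠ i → w j = z j) ↔ ∀ j, j ≠ i → z j = w j := by
        simp only [eq_comm]
      have h2 : (w i = true ∧ z i = true) ↔ (z i = true ∧ w i = true) := and_comm
      simp only [h1, h2]
      split_ifs <;> simp
    rw [hs]
    refine matrix_ext_ket fun z => ?_
    rw [← Matrix.mulVec_mulVec, H_op_mulVec_H_op_mulVec_ket, Matrix.one_mulVec]
  | T i =>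
    rw [Gate.op, Matrix.diagonal_conjTranspose, Matrix.diagonal_mul_diagonal, ← Matrix.diagonal_one]
    congr 1
    ext z
    simp only [Pi.star_apply]
    split_ifs
    · have e : (starRingEnd ℂ) (Complex.I * (Real.pi / 4)) = -(Complex.I * (Real.pi / 4)) := by
        rw [map_mul, Complex.conj_I, map_div₀, Complex.conj_ofReal, map_ofNat]
        ring
      rw [Complex.star_def, ← Complex.exp_conj, e, ← Complex.exp_add, neg_add_cancel,
        Complex.exp_zero]
    · simp
  | CNOT c t h =>
    have hs : (Gate.CNOT c t h : Gate N).opᴴ = (Gate.CNOT c t h).op := by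
      ext z w
      simp only [Matrix.conjTranspose_apply, Gate.op, Matrix.of_apply, apply_ite star, star_one,
        star_zero]
      congr 1
      rw [eq_iff_iff]
      constructor <;> (rintro rfl; simp [h])
    rw [hs]
    refine matrix_ext_ket fun z => ?_
    rw [← Matrix.mulVec_mulVec, CNOT_op_mulVec_ket, CNOT_op_mulVec_ket, Matrix.one_mulVec]
    simp [h]

lemma conjTranspose_gatesOp_mul_self {N : ℕ} (gs : List (Gate N)) :
    (gatesOp Gate.op gs)ᴴ * gatesOp Gate.op gs = 1 := by
  induction gs with
  | nil => simp
  | cons γ gs ih =>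
    rw [gatesOp_cons, Matrix.conjTranspose_mul, Matrix.mul_assoc, ← Matrix.mul_assoc _ _ γ.op, ih,
      Matrix.one_mul, conjTranspose_gate_op_mul_self]

/-! ### Channels -/

/-- The discarded qubits are all in the basis state given by `z₀`, hence not entangled with the
output, and tracing them out leaves a pure state. -/
lemma traceOut_mul_apply_pure {N m : ℕ} (e : Fin m ↪ Fin N) (z₀ : Fin N → Bool)
    (ψ : (Fin m → Bool) → ℂ) (M : Op (Fin N))
    (hM : ∀ z w, M z w = (∑ x, ψ x • ket (Function.extend e x z₀)) z *
      star ((∑ x, ψ x • ket (Function.extend e x z₀)) w)) (u v : Fin m → Bool) :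
    traceOut e M u v = ψ u * star (ψ v) := by
  have hΨ : ∀ z, (∑ x, ψ x • ket (Function.extend e x z₀)) z =
      if ∀ j, j ∉ Set.range e → z j = z₀ j then ψ (fun i => z (e i)) else 0 := by
    intro z
    simp only [Finset.sum_apply, Pi.smul_apply, ket_apply, eq_extend_iff, smul_eq_mul, mul_ite,
      mul_one, mul_zero]
    split_ifs with h
    · rw [Finset.sum_eq_single fun i => z (e i), if_pos ⟨fun _ => rfl, h⟩]
      · intro x _ hx
        rw [if_neg]
        rintro ⟨h', -⟩
        exact hx (funext fun i => (h' i).symm)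
      · simp
    · exact Finset.sum_eq_zero fun x _ => if_neg fun h' => h h'.2
  have key : ∀ (x : Fin m → Bool) z, z = Function.extend e x z₀ →
      (∀ i, z (e i) = x i) ∧ ∀ j, j ∉ Set.range e → z j = z₀ j :=
    fun x z h => (eq_extend_iff e x z₀ z).1 h
  have ku := key u _ rfl
  have kv := key v _ rfl
  rw [traceOut, Matrix.of_apply, Finset.sum_eq_single (Function.extend e u z₀),
    Finset.sum_eq_single (Function.extend e v z₀)]
  · rw [if_pos ⟨ku.1, kv.1, fun j hj => (ku.2 j hj).trans (kv.2 j hj).symm⟩, hM, hΨ, hΨ,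
      if_pos ku.2, if_pos kv.2, extend_comp_self, extend_comp_self]
  · intro w _ hw
    split_ifs with h
    · rw [hM, hΨ w, if_neg, star_zero, mul_zero]
      intro h'
      exact hw ((eq_extend_iff e v z₀ w).2 ⟨h.2.1, h'⟩)
    · rfl
  · simp
  · intro z _ hz
    refine Finset.sum_eq_zero fun w _ => ?_
    split_ifs with h
    · rw [hM, hΨ z, if_neg, zero_mul]
      intro h'
      exact hz ((eq_extend_iff e u z₀ z).2 ⟨h.1, h'⟩)
    · rfl
  · simp

/-- Acceptance reads only the diagonal, so the partial trace reduces to the basis states whose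
output qubit is one. -/
lemma prOne_traceOut {N : ℕ} (e : Unit ↪ Fin N) (M : Op (Fin N)) :
    prOne (traceOut e M) = (∑ z, if z (e ()) = true then M z z else 0).re := by
  rw [prOne, traceOut, Matrix.of_apply]
  congr 1
  refine Finset.sum_congr rfl fun z _ => ?_
  have h : ∀ w : Fin N → Bool, ((∀ i : Unit, z (e i) = true) ∧ (∀ i : Unit, w (e i) = true) ∧
      ∀ j, j ∉ Set.range e → z j = w j) ↔ (w = z ∧ z (e ()) = true) := by
    intro w
    constructor
    · rintro ⟨h1, h2, h3⟩
      refine ⟨?_, h1 ()⟩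
      ext j
      by_cases hj : j ∈ Set.range e
      · obtain ⟨i, rfl⟩ := hj
        rw [h1, h2]
      · exact (h3 j hj).symm
    · rintro ⟨rfl, h⟩
      exact ⟨fun _ => h, fun _ => h, fun _ _ => rfl⟩
  simp only [h]
  rw [Finset.sum_eq_single z]
  · simp
  · intro w _ hw
    rw [if_neg fun h => hw h.1]
  · simp

lemma channel_eq {g : ℕ → Type} {ι κ : Type} [Fintype ι] [DecidableEq ι]
    (op : ∀ {N}, g N → Op (Fin N)) (C : Circuit g ι κ) (ρ : Op ι) :
    C.channel op ρ = traceOut C.out ((gatesOp op C.gates * embedMat C.inp) * ρ *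
      (gatesOp op C.gates * embedMat C.inp)ᴴ) := by
  rw [Circuit.channel, padZero_eq, Matrix.conjTranspose_mul]
  simp only [Matrix.mul_assoc]
  rfl

end QCrypto

namespace QCrypto

/-! ### The generator of binary phase states -/

lemma mul_basisState_mul_apply {n N : ℕ} (V : Matrix (Fin N → Bool) (Fin n → Bool) ℂ)
    (k : Fin n → Bool) (z w : Fin N → Bool) :
    (V * basisState k * Vᴴ) z w = (V *ᵥ ket k) z * star ((V *ᵥ ket k) w) := by
  rw [mulVec_ket, mulVec_ket, Matrix.mul_apply, Finset.sum_eq_single k]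
  · simp [basisState]
  · intro b _ hb
    rw [basisState, Matrix.mul_single_apply_of_ne _ _ _ _ _ hb, zero_mul]
  · simp

lemma sqrt_two_inv_pow (n : ℕ) :
    ((Real.sqrt 2 : ℂ)⁻¹) ^ n = ((Real.sqrt (2 ^ n) : ℝ) : ℂ)⁻¹ := by
  rw [inv_pow, ← Complex.ofReal_pow]
  congr 2
  rw [eq_comm, Real.sqrt_eq_iff_mul_self_eq (by positivity) (by positivity), ← mul_pow,
    Real.mul_self_sqrt (by norm_num)]

lemma binaryPhase_apply {n : ℕ} (f : (Fin n → Bool) → Bool) (x : Fin n → Bool) :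
    binaryPhase f x = ((Real.sqrt 2 : ℂ)⁻¹) ^ n * (-1) ^ (f x).toNat := by
  rw [sqrt_two_inv_pow]
  rfl

/-- The wires that carry a key, an input and a constant zero. -/
def inputList (l m : ℕ) : List ((Fin l → Bool) × (Fin m → Bool) → Bool) :=
  (List.ofFn (fun i (x : (Fin l → Bool) × (Fin m → Bool)) => x.1 i) ++
    (List.ofFn (fun i (x : (Fin l → Bool) × (Fin m → Bool)) => x.2 i) ++
      [fun _ => false])).reverse

lemma length_inputList (l m : ℕ) : (inputList l m).length = l + m + 1 := by
  simp [inputList]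
  omega

lemma mem_inputList {l m : ℕ} {f : (Fin l → Bool) × (Fin m → Bool) → Bool}
    (hf : f ∈ inputWires l m) : f ∈ inputList l m := by
  simp only [inputList, List.mem_reverse, List.mem_append, List.mem_ofFn]
  rcases hf with hf | hf | hf
  · exact Or.inr (Or.inr (by simpa using hf))
  · exact Or.inl hf
  · exact Or.inr (Or.inl hf)

lemma loads_inputList {l m N : ℕ} (inp : Fin l ↪ Fin N) (out : Fin m ↪ Fin N)
    (hinp : ∀ i, (inp i : ℕ) = i) (hout : ∀ j, (out j : ℕ) = l + j) (k : Fin l → Bool)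
    (x : Fin m → Bool) :
    Loads (inputList l m) (k, x) (Function.extend out x (Function.extend inp k fun _ => false)) := by
  intro i
  rw [inputList, List.reverse_reverse]
  simp only [List.map_append, List.map_ofFn, List.map_cons, List.map_nil, Function.comp_def]
  by_cases h1 : (i : ℕ) < l
  · obtain ⟨i', rfl⟩ : ∃ i', i = inp i' := ⟨⟨i, h1⟩, Fin.ext (by rw [hinp])⟩
    have : ¬ ∃ a, out a = inp i' := by
      rintro ⟨a, ha⟩
      have := congrArg Fin.val ha
      rw [hout, hinp] at this
      omega
    rw [Function.extend_apply' _ _ _ this, inp.injective.extend_apply,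
      List.getD_append _ _ _ _ (by simpa using h1), List.getD_eq_getElem _ _ (by simpa using h1)]
    simp [hinp]
  · by_cases h2 : (i : ℕ) - l < m
    · obtain ⟨j, rfl⟩ : ∃ j, i = out j := ⟨⟨i - l, h2⟩, Fin.ext (by rw [hout]; simp only; omega)⟩
      rw [out.injective.extend_apply, List.getD_append_right _ _ _ _ (by simpa using h1)]
      rw [List.getD_append _ _ _ _ (by simpa using h2),
        List.getD_eq_getElem _ _ (by simpa using h2)]
      simp [hout]
    · have e1 : ¬ ∃ a, out a = i := by
        rintro ⟨a, rfl⟩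
        rw [hout] at h2
        omega
      have e2 : ¬ ∃ a, inp a = i := by
        rintro ⟨a, rfl⟩
        rw [hinp] at h1
        omega
      rw [Function.extend_apply' _ _ _ e1, Function.extend_apply' _ _ _ e2,
        List.getD_append_right _ _ _ _ (by simp; omega),
        List.getD_append_right _ _ _ _ (by simp; omega)]
      rcases Nat.eq_zero_or_pos ((i : ℕ) - l - m) with h | h
      · simp [h]
      · rw [List.getD_eq_default]
        simp
        omega

/-- Binary phase states of a function with a short NAND program have a small generator. -/
theorem exists_circuit_binaryPhase {l m s : ℕ} {F : (Fin l → Bool) → (Fin m → Bool) → Bool}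
    (hF : Computes (inputWires l m) s {fun x => F x.1 x.2}) :
    ∃ C : Circuit Gate (Fin l) (Fin m), C.size ≤ 2 * l + 3 * m + 82 * s + 6 ∧
      ∀ k, C.run (basisState k) = pureState (binaryPhase (F k)) := by
  obtain ⟨L', hL, hlen, hmem⟩ := hF (inputList l m) fun f hf => mem_inputList hf
  have hle := hL.length_le
  rw [length_inputList] at hlen hle
  obtain ⟨gs, gs', π, h1, h2, h3, h4, h5⟩ := hL.exists_gates L'.length le_rfl
  rw [length_inputList] at h1 h2
  obtain ⟨o, ho, hFo⟩ := exists_reverse_getElem (hmem _ rfl)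
  set inp : Fin l ↪ Fin L'.length := ⟨fun i => ⟨i, by omega⟩, fun i j h => by
    simpa [Fin.ext_iff] using h⟩ with hinp
  set out : Fin m ↪ Fin L'.length := ⟨fun j => ⟨l + j, by omega⟩, fun i j h => by
    simpa [Fin.ext_iff] using h⟩ with hout
  set gates : List (Gate L'.length) := hadamardLayer out ++ (gs ++ (zGates ⟨o, ho⟩ ++ gs'))
    with hgates
  refine ⟨⟨L'.length, gates, inp, out⟩, ?_, fun k => ?_⟩
  -- One qubit per wire gives width at most `l + m + 1 + s`, counted twice. The gates are `m`
  -- Hadamards, `40 * s` each for computing and uncomputing, and `4` for the `Z`.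
  · simp only [Circuit.size, hgates, List.length_append, length_hadamardLayer, Fintype.card_fin,
      zGates, List.length_replicate]
    omega
  · set z₀ : Fin L'.length → Bool := Function.extend inp k fun _ => false with hz₀
    have hz₀out : ∀ j, z₀ (out j) = false := by
      intro j
      rw [hz₀, Function.extend_apply']
      rintro ⟨i, hi⟩
      have h : (i : ℕ) = l + j := congrArg Fin.val hi
      omega
    -- For each `x` the program writes `F k x` on wire `o`, the `Z` turns it into a sign, and
    -- uncomputation restores the basis state, so only the sign remains.
    have hU : gatesOp Gate.op gates *ᵥ ket z₀ =
        ∑ x, binaryPhase (F k) x • ket (Function.extend out x z₀) := by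
      rw [hgates, gatesOp_append_mulVec, hadamardLayer_mulVec_ket out z₀ hz₀out,
        Matrix.mulVec_sum]
      refine Finset.sum_congr rfl fun x _ => ?_
      have hload := h5 (k, x) _ (loads_inputList inp out (fun _ => rfl) (fun _ => rfl) k x)
      have hbit := hload.apply ho ho hFo
      rw [Matrix.mulVec_smul, gatesOp_append_mulVec, gatesOp_append_mulVec, h3, zGates_mulVec_ket,
        hbit, Matrix.mulVec_smul, h4, smul_smul, binaryPhase_apply, Fintype.card_fin]
    rw [Circuit.run, channel_eq]
    ext u v
    rw [traceOut_mul_apply_pure out z₀ (fun x => binaryPhase (F k) x)]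
    · rfl
    · intro z w
      rw [mul_basisState_mul_apply, ← Matrix.mulVec_mulVec, embedMat_mulVec_ket]
      simp only [← hz₀, hU]

/-! ### Acceptance probabilities as quadratic forms -/

/-- The isometry that adds a register in the state `x`. -/
def padMat {t n : ℕ} (a : ℕ) (x : Fin t → Fin n → Bool) :
    Matrix ((Fin t × Fin n) ⊕ Fin a → Bool) (Fin a → Bool) ℂ :=
  Matrix.of fun z b => if z = Sum.elim (fun p => x p.1 p.2) b then 1 else 0

/-- The operator that adds a register in the state `v`. -/
def copyMat {t n : ℕ} (a : ℕ) (v : (Fin t → Fin n → Bool) → ℂ) :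
    Matrix ((Fin t × Fin n) ⊕ Fin a → Bool) (Fin a → Bool) ℂ :=
  ∑ x, v x • padMat a x

section copies

variable {t n a : ℕ}

lemma copyMat_mulVec_ket (v : (Fin t → Fin n → Bool) → ℂ) (b : Fin a → Bool) :
    copyMat a v *ᵥ ket b = ∑ x, v x • ket (Sum.elim (fun p : Fin t × Fin n => x p.1 p.2) b) := by
  rw [copyMat, Matrix.sum_mulVec]
  refine Finset.sum_congr rfl fun x _ => ?_
  rw [Matrix.smul_mulVec]
  congr 1
  ext z
  rw [mulVec_ket, ket_apply, padMat, Matrix.of_apply]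

lemma eq_elim_iff (z : (Fin t × Fin n) ⊕ Fin a → Bool) (x : Fin t → Fin n → Bool)
    (b : Fin a → Bool) : z = Sum.elim (fun p => x p.1 p.2) b ↔
      x = (fun j i => z (Sum.inl (j, i))) ∧ b = fun i => z (Sum.inr i) := by
  constructor
  · rintro rfl
    simp
  · rintro ⟨rfl, rfl⟩
    ext (i | i) <;> rfl

lemma copyMat_apply (v : (Fin t → Fin n → Bool) → ℂ) (z : (Fin t × Fin n) ⊕ Fin a → Bool)
    (b : Fin a → Bool) :
    copyMat a v z b = if b = (fun i => z (Sum.inr i)) then v (fun j i => z (Sum.inl (j, i))) else 0 := by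
  rw [← mulVec_ket (copyMat a v), copyMat_mulVec_ket]
  simp only [Finset.sum_apply, Pi.smul_apply, ket_apply, eq_elim_iff, smul_eq_mul, mul_ite, mul_one,
    mul_zero]
  split_ifs with h
  · simp [h]
  · simp [h]

lemma copiesWithAdvice_pureState (θ : Ket n) (ρ : Op (Fin a)) :
    copiesWithAdvice t (pureState θ) ρ =
      copyMat a (tensorCoord (t := t) θ) * ρ * (copyMat a (tensorCoord (t := t) θ))ᴴ := by
  ext z w
  simp only [Matrix.mul_apply, Matrix.conjTranspose_apply, copyMat_apply, copiesWithAdvice,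
    Matrix.of_apply, pureState, apply_ite star, star_zero, ite_mul, zero_mul, mul_ite, mul_zero,
    Finset.sum_ite_eq', Finset.mem_univ, if_true, tensorCoord, Finset.prod_mul_distrib, star_prod]
  ring

lemma conjTranspose_padMat_mul (x y : Fin t → Fin n → Bool) :
    (padMat a x)ᴴ * padMat a y =
      if x = y then 1 else 0 := by
  ext b c
  simp only [Matrix.mul_apply, Matrix.conjTranspose_apply, padMat, Matrix.of_apply,
    apply_ite star, star_one, star_zero, ite_mul, one_mul, zero_mul]
  rw [Finset.sum_ite_eq' Finset.univ, if_pos (Finset.mem_univ _)]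
  simp only [eq_elim_iff, Sum.elim_inl, Sum.elim_inr]
  by_cases h : x = y
  · subst h
    simp [Matrix.one_apply, eq_comm]
  · have h' : ¬ y = x := fun h' => h h'.symm
    simp [h, h']

/-- The isometries `padMat a x` have mutually orthogonal ranges, so `copyMat a v` multiplies norms
by that of `v`. -/
lemma conjTranspose_copyMat_mul_self (v : (Fin t → Fin n → Bool) → ℂ) :
    (copyMat a v)ᴴ * copyMat a v =
      ((∑ x, ‖v x‖ ^ 2 : ℝ) : ℂ) • 1 := by
  simp only [copyMat, Matrix.conjTranspose_sum, Matrix.conjTranspose_smul, Matrix.sum_mul,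
    Matrix.mul_sum, Matrix.smul_mul, Matrix.mul_smul, conjTranspose_padMat_mul, smul_ite,
    smul_zero, Finset.sum_ite_eq', Finset.mem_univ, if_true]
  push_cast
  rw [Finset.sum_smul]
  refine Finset.sum_congr rfl fun x _ => ?_
  rw [smul_smul]
  congr 1
  rw [Complex.star_def, Complex.mul_conj']

lemma prOne_run_copies (A : Circuit Gate ((Fin t × Fin n) ⊕ Fin a) Unit) (θ : Ket n)
    (ρ : Op (Fin a)) :
    prOne (A.run (copiesWithAdvice t (pureState θ) ρ)) =
      (∑ z, if z (A.out ()) = true then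
        ((gatesOp Gate.op A.gates * embedMat A.inp * copyMat a (tensorCoord (t := t) θ)) * ρ *
          (gatesOp Gate.op A.gates * embedMat A.inp * copyMat a (tensorCoord (t := t) θ))ᴴ) z z else 0).re := by
  rw [Circuit.run, channel_eq, prOne_traceOut, copiesWithAdvice_pureState]
  simp only [Matrix.conjTranspose_mul, Matrix.mul_assoc]

/-- The acceptance probability on `t` copies of a pure state is given by an effect. -/
theorem exists_effect (A : Circuit Gate ((Fin t × Fin n) ⊕ Fin a) Unit) {ρ : Op (Fin a)}
    (hρ : IsDensity ρ) :
    ∃ M : (Fin t → Fin n → Bool) → (Fin t → Fin n → Bool) → ℂ, IsEffect M ∧ ∀ θ : Ket n,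
      prOne (A.run (copiesWithAdvice t (pureState θ) ρ)) = (sesqForm M (tensorCoord θ)).re := by
  set W := gatesOp Gate.op A.gates * embedMat A.inp with hW
  have hWW : Wᴴ * W = 1 := by
    rw [hW, Matrix.conjTranspose_mul, Matrix.mul_assoc, ← Matrix.mul_assoc _ (gatesOp _ _),
      conjTranspose_gatesOp_mul_self, Matrix.one_mul, conjTranspose_embedMat_mul_self]
  set M : (Fin t → Fin n → Bool) → (Fin t → Fin n → Bool) → ℂ := fun x y =>
    ∑ z, if z (A.out ()) = true then ((W * padMat a x) * ρ * (W * padMat a y)ᴴ) z z else 0 with hM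
  have key : ∀ v : (Fin t → Fin n → Bool) → ℂ, sesqForm M v =
      ∑ z, if z (A.out ()) = true then ((W * copyMat a v) * ρ * (W * copyMat a v)ᴴ) z z else 0 := by
    intro v
    have e : (W * copyMat a v) * ρ * (W * copyMat a v)ᴴ =
        ∑ x, ∑ y, (v x * star (v y)) • ((W * padMat a x) * ρ * (W * padMat a y)ᴴ) := by
      simp only [copyMat, Matrix.mul_sum, Matrix.sum_mul, Matrix.conjTranspose_sum,
        Matrix.mul_smul, Matrix.smul_mul, Matrix.conjTranspose_smul]
      simp only [Finset.smul_sum, smul_smul]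
      rw [Finset.sum_comm]
      exact Finset.sum_congr rfl fun x _ => Finset.sum_congr rfl fun y _ => by rw [mul_comm]
    simp only [e, sesqForm, hM, Finset.sum_mul]
    rw [Finset.sum_congr rfl fun x _ => Finset.sum_comm, Finset.sum_comm]
    refine Finset.sum_congr rfl fun z _ => ?_
    split_ifs with hz
    · simp only [Matrix.sum_apply, Matrix.smul_apply, smul_eq_mul, mul_comm]
    · simp
  refine ⟨M, fun v => ?_, fun θ => by rw [prOne_run_copies, key]⟩
  have hpsd : ((W * copyMat a v) * ρ * (W * copyMat a v)ᴴ).PosSemidef :=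
    hρ.1.mul_mul_conjTranspose_same _
  have hd : ∀ z, 0 ≤ (((W * copyMat a v) * ρ * (W * copyMat a v)ᴴ) z z).re := fun z =>
    (Complex.nonneg_iff.1 (hpsd.diag_nonneg (i := z))).1
  -- As `W` is an isometry and `ρ` has trace one, the total trace is the squared norm of `v`;
  -- acceptance is a part of this nonnegative diagonal sum.
  have htr : ((W * copyMat a v) * ρ * (W * copyMat a v)ᴴ).trace = ((∑ x, ‖v x‖ ^ 2 : ℝ) : ℂ) := by
    rw [Matrix.trace_mul_comm, ← Matrix.mul_assoc, Matrix.conjTranspose_mul, Matrix.mul_assoc _ Wᴴ,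
      ← Matrix.mul_assoc Wᴴ, hWW, Matrix.one_mul, conjTranspose_copyMat_mul_self, Matrix.smul_mul,
      Matrix.one_mul, Matrix.trace_smul, hρ.2, smul_eq_mul, mul_one]
  rw [key, Complex.re_sum]
  constructor
  · refine Finset.sum_nonneg fun z _ => ?_
    split_ifs
    · exact hd z
    · simp
  · have : (∑ x, ‖v x‖ ^ 2 : ℝ) = (((W * copyMat a v) * ρ * (W * copyMat a v)ᴴ).trace).re := by
      rw [htr, Complex.ofReal_re]
    rw [this, Matrix.trace, Complex.re_sum]
    refine Finset.sum_le_sum fun z _ => ?_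
    split_ifs
    · exact le_rfl
    · exact hd z

end copies

end QCrypto

namespace QCrypto

/-! ### Simulation of a distinguisher with oracle queries -/

section simulation

variable {n N : ℕ} (f : (Fin n → Bool) → Bool)

lemma query_op_mulVec_ket (x : Fin n ↪ Fin N) (y : Fin N) (h : ∀ i, x i ≠ y)
    (z : Fin N → Bool) : (OracleGate.query x y h).op f *ᵥ ket z =
      ket (Function.update z y (xor (z y) (f fun i => z (x i)))) := by
  ext w
  rw [mulVec_ket, ket_apply]
  rfl

lemma gatesOp_map_gate (gs : List (Gate N)) :
    gatesOp (OracleGate.op f) (gs.map .gate) = gatesOp Gate.op gs :=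
  gatesOp_map _ _ _

/-- The query of the oracle in the phase, with a scratch qubit `y`. -/
def phaseQuery (x : Fin n ↪ Fin N) (y : Fin N) (h : ∀ i, x i ≠ y) : List (OracleGate n N) :=
  [.query x y h] ++ ((zGates y).map .gate ++ [.query x y h])

/-- The value is written to the scratch qubit, converted into a sign, and erased by the second
query, so the scratch qubit can be reused. -/
lemma phaseQuery_mulVec_ket (x : Fin n ↪ Fin N) (y : Fin N) (h : ∀ i, x i ≠ y)
    {z : Fin N → Bool} (hz : z y = false) :
    gatesOp (OracleGate.op f) (phaseQuery x y h) *ᵥ ket z =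
      (-1 : ℂ) ^ (f fun i => z (x i)).toNat • ket z := by
  rw [phaseQuery, gatesOp_append_mulVec, gatesOp_append_mulVec, gatesOp_map_gate,
    gatesOp_cons_mulVec, gatesOp_nil_mulVec, gatesOp_cons_mulVec, gatesOp_nil_mulVec,
    query_op_mulVec_ket, zGates_mulVec_ket, Matrix.mulVec_smul, query_op_mulVec_ket]
  simp only [Function.update_self, Function.update_of_ne (h _), Function.update_idem, hz,
    Bool.false_xor, Bool.xor_self]
  congr 2
  rw [← hz, Function.update_eq_self]

lemma flatMap_phaseQuery_mulVec_ket {t : ℕ} (x : Fin t → (Fin n ↪ Fin N)) (y : Fin N)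
    (h : ∀ j i, x j i ≠ y) {z : Fin N → Bool} (hz : z y = false) (l : List (Fin t)) :
    gatesOp (OracleGate.op f) (l.flatMap fun j => phaseQuery (x j) y (h j)) *ᵥ ket z =
      (l.map fun j => (-1 : ℂ) ^ (f fun i => z (x j i)).toNat).prod • ket z := by
  induction l with
  | nil => simp
  | cons j l ih =>
    rw [List.flatMap_cons, gatesOp_append_mulVec, phaseQuery_mulVec_ket f _ _ _ hz,
      Matrix.mulVec_smul, ih, smul_smul, List.map_cons, List.prod_cons]

end simulation

lemma extend_extend_trans {ι : Type} {M N : ℕ} (e : Fin M ↪ Fin N) (i : ι ↪ Fin M)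
    (x : ι → Bool) : Function.extend e (Function.extend i x fun _ => false) (fun _ => false) =
      Function.extend (i.trans e) x fun _ => false := by
  symm
  rw [eq_extend_iff]
  constructor
  · intro j
    by_cases hj : j ∈ Set.range i
    · obtain ⟨k, rfl⟩ := hj
      rw [i.injective.extend_apply]
      exact (i.trans e).injective.extend_apply x _ k
    · rw [Function.extend_apply' _ _ _ (by simpa using hj), Function.extend_apply']
      rintro ⟨k, hk⟩
      exact hj ⟨k, hk⟩
  · intro j hj
    rw [Function.extend_apply']
    rintro ⟨k, rfl⟩
    exact hj ⟨i k, rfl⟩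

lemma extend_inl_extend_inr {ι κ : Type} {N : ℕ} (e : ι ⊕ κ ↪ Fin N) (x : ι → Bool)
    (b : κ → Bool) :
    Function.extend (Function.Embedding.inl.trans e) x
      (Function.extend (Function.Embedding.inr.trans e) b fun _ => false) =
      Function.extend e (Sum.elim x b) fun _ => false := by
  rw [eq_extend_iff]
  constructor
  · rintro (i | i)
    · exact (Function.Embedding.inl.trans e).injective.extend_apply x _ i
    · rw [Function.extend_apply']
      · exact (Function.Embedding.inr.trans e).injective.extend_apply b _ i
      · rintro ⟨k, hk⟩
        exact Sum.inl_ne_inr (e.injective hk)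
  · intro j hj
    rw [Function.extend_apply', Function.extend_apply']
    · rintro ⟨k, rfl⟩
      exact hj ⟨_, rfl⟩
    · rintro ⟨k, rfl⟩
      exact hj ⟨_, rfl⟩

/-- Added qubits that remain zero do not change the acceptance probability. -/
lemma sum_ite_embedMat_conj {M N : ℕ} (e : Fin M ↪ Fin N) (o : Fin M) (X : Op (Fin M)) :
    (∑ z, if z (e o) = true then (embedMat e * X * (embedMat e)ᴴ) z z else 0) =
      ∑ z, if z o = true then X z z else 0 := by
  have h1 : ∀ z, (embedMat e * X * (embedMat e)ᴴ) z z =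
      ∑ u, if z = Function.extend e u (fun _ => false) then X u u else 0 := by
    intro z
    simp only [Matrix.mul_apply, Matrix.conjTranspose_apply, embedMat, Matrix.of_apply,
      apply_ite star, star_one, star_zero, ite_mul, one_mul, zero_mul, mul_ite, mul_one, mul_zero]
    refine Finset.sum_congr rfl fun u _ => ?_
    split_ifs with hu
    · rw [Finset.sum_eq_single u, if_pos hu]
      · intro v _ hv
        rw [if_neg]
        intro hv'
        exact hv (extend_injective e _ (hv'.symm.trans hu))
      · simp
    · rfl
  have h2 : ∀ z, (if z (e o) = true then (embedMat e * X * (embedMat e)ᴴ) z z else 0) =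
      ∑ u, if z = Function.extend e u (fun _ => false) then (if u o = true then X u u else 0)
        else 0 := by
    intro z
    have h3 : ∀ u, z = Function.extend e u (fun _ => false) → u o = z (e o) := by
      rintro u rfl
      exact (e.injective.extend_apply u _ o).symm
    rw [h1]
    split_ifs with hz
    · refine Finset.sum_congr rfl fun u _ => ?_
      split_ifs with hu hu' <;> simp_all
    · refine (Finset.sum_eq_zero fun u _ => ?_).symm
      split_ifs with hu hu' <;> simp_all
  rw [Finset.sum_congr rfl fun z _ => h2 z, Finset.sum_comm]
  simp

/-- A distinguisher for binary phase states is simulated by an oracle distinguisher. -/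
theorem exists_oracle_circuit {t n a : ℕ} (A : Circuit Gate ((Fin t × Fin n) ⊕ Fin a) Unit) :
    ∃ B : Circuit (OracleGate n) (Fin a) Unit, B.size ≤ t * n + 6 * t + A.size + 2 ∧
      ∀ f ρ, prOne (B.runWith f ρ) =
        prOne (A.run (copiesWithAdvice t (pureState (binaryPhase f)) ρ)) := by
  -- The additional last qubit is the scratch qubit, shared by the phase queries for all `t` copies.
  set e : Fin A.width ↪ Fin (A.width + 1) := Fin.castSuccEmb with he
  set E := A.inp.trans e with hE
  set q : Fin t × Fin n ↪ Fin (A.width + 1) := Function.Embedding.inl.trans E with hq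
  set inp : Fin a ↪ Fin (A.width + 1) := Function.Embedding.inr.trans E with hinp
  set x : Fin t → (Fin n ↪ Fin (A.width + 1)) := fun j =>
    ⟨fun i => q (j, i), fun i i' h => by simpa using q.injective h⟩ with hx
  have hlast : ∀ i, e i ≠ Fin.last A.width := fun i => Fin.castSucc_ne_last i
  have hy : ∀ j i, x j i ≠ Fin.last A.width := fun j i => hlast _
  set prep : List (OracleGate n (A.width + 1)) := (hadamardLayer q).map .gate ++
    (List.finRange t).flatMap fun j => phaseQuery (x j) (Fin.last A.width) (hy j) with hprep
  refine ⟨⟨A.width + 1, prep ++ (A.gates.map (Gate.lift e)).map .gate, inp, A.out.trans e⟩,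
    ?_, fun f ρ => ?_⟩
  · have hlen : ∀ j, (phaseQuery (x j) (Fin.last A.width) (hy j)).length = 6 := fun j => by
      simp [phaseQuery, zGates]
    simp only [Circuit.size, hprep, List.length_append, List.length_map, length_hadamardLayer,
      List.length_flatMap, hlen]
    simp
    omega
  · have hstate : gatesOp (OracleGate.op f) prep * embedMat inp =
        embedMat E * copyMat a (tensorCoord (t := t) (binaryPhase f)) := by
      refine matrix_ext_ket fun b => ?_
      rw [← Matrix.mulVec_mulVec, ← Matrix.mulVec_mulVec, embedMat_mulVec_ket, copyMat_mulVec_ket,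
        Matrix.mulVec_sum, hprep, gatesOp_append_mulVec, gatesOp_map_gate,
        hadamardLayer_mulVec_ket, Matrix.mulVec_sum]
      · refine Fintype.sum_equiv (Equiv.curry (Fin t) (Fin n) Bool) _ _ fun u => ?_
        have hu : Function.extend q u (Function.extend inp b fun _ => false) =
            Function.extend E (Sum.elim u b) fun _ => false := extend_inl_extend_inr E u b
        rw [hu, Matrix.mulVec_smul, Matrix.mulVec_smul, embedMat_mulVec_ket,
          flatMap_phaseQuery_mulVec_ket, smul_smul]
        · congr 1
          · have hbits : ∀ j, (fun i => Function.extend E (Sum.elim u b) (fun _ => false)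
                (x j i)) = Equiv.curry (Fin t) (Fin n) Bool u j := fun j =>
              funext fun i => E.injective.extend_apply _ _ (Sum.inl (j, i))
            simp only [hbits, tensorCoord, binaryPhase_apply, Finset.prod_mul_distrib,
              Finset.prod_const, Finset.card_univ, Fintype.card_prod, Fintype.card_fin,
              Fin.prod_univ_def]
            rw [mul_comm t n, pow_mul]
        · rw [Function.extend_apply']
          rintro ⟨k, hk⟩
          exact hlast _ hk
      · intro i
        rw [Function.extend_apply']
        rintro ⟨k, hk⟩
        exact Sum.inr_ne_inl (E.injective hk)
    have hEe : embedMat E = embedMat e * embedMat A.inp := by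
      refine matrix_ext_ket fun b => ?_
      rw [← Matrix.mulVec_mulVec, embedMat_mulVec_ket, embedMat_mulVec_ket, embedMat_mulVec_ket,
        extend_extend_trans]
    -- After the preparation the scratch qubit is zero again, so the whole simulation is the
    -- original run followed by the embedding `e`.
    have hV : gatesOp (OracleGate.op f) (prep ++ (A.gates.map (Gate.lift e)).map .gate) *
        embedMat inp = embedMat e * (gatesOp Gate.op A.gates * embedMat A.inp *
          copyMat a (tensorCoord (t := t) (binaryPhase f))) := by
      rw [gatesOp_append, Matrix.mul_assoc, hstate, gatesOp_map_gate, hEe, Matrix.mul_assoc,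
        ← Matrix.mul_assoc, gatesOp_lift_mul_embedMat]
      simp only [Matrix.mul_assoc]
    rw [prOne_run_copies, Circuit.runWith, channel_eq, prOne_traceOut]
    simp only [hV]
    rw [← sum_ite_embedMat_conj e]
    congr 1
    refine Finset.sum_congr rfl fun z _ => ?_
    rw [Matrix.conjTranspose_mul (embedMat e)]
    simp only [Matrix.mul_assoc]
    rfl

/-! ### Polynomial bounds and negligible functions -/

lemma eval_nat_mono (p : Polynomial ℕ) {a b : ℕ} (h : a ≤ b) : p.eval a ≤ p.eval b := by
  rw [Polynomial.eval_eq_sum_range, Polynomial.eval_eq_sum_range]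
  gcongr

namespace PolyBounded

variable {s s' : ℕ → ℕ}

lemma mono (h : PolyBounded s) (hs : ∀ l, s' l ≤ s l) : PolyBounded s' := by
  obtain ⟨p, hp⟩ := h
  exact ⟨p, fun l => (hs l).trans (hp l)⟩

lemma const (c : ℕ) : PolyBounded fun _ => c := ⟨Polynomial.C c, fun l => by simp⟩

lemma id : PolyBounded fun l => l := ⟨Polynomial.X, fun l => by simp⟩

lemma add (h : PolyBounded s) (h' : PolyBounded s') : PolyBounded fun l => s l + s' l := by
  obtain ⟨p, hp⟩ := h
  obtain ⟨p', hp'⟩ := h'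
  exact ⟨p + p', fun l => by rw [Polynomial.eval_add]; exact add_le_add (hp l) (hp' l)⟩

lemma mul (h : PolyBounded s) (h' : PolyBounded s') : PolyBounded fun l => s l * s' l := by
  obtain ⟨p, hp⟩ := h
  obtain ⟨p', hp'⟩ := h'
  exact ⟨p * p', fun l => by rw [Polynomial.eval_mul]; exact Nat.mul_le_mul (hp l) (hp' l)⟩

lemma eval (h : PolyBounded s) (p : Polynomial ℕ) : PolyBounded fun l => p.eval (s l) := by
  obtain ⟨q, hq⟩ := h
  exact ⟨p.comp q, fun l => by rw [Polynomial.eval_comp]; exact eval_nat_mono p (hq l)⟩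

end PolyBounded

open Filter Asymptotics in
-- Taking `Real.log 2 / (c + 1)` as the little-o constant gives `l ^ (c + 1) ≤ 2 ^ n l` eventually;
-- the spare power of `l` yields a bound `1 / l`.
lemma negligible_inv_two_pow {n : ℕ → ℕ}
    (hn : (fun l : ℕ => Real.log (l : ℝ)) =o[atTop] (fun l : ℕ => (n l : ℝ))) :
    Negligible fun l => ((2 : ℝ) ^ n l)⁻¹ := by
  intro c
  have hε : 0 < Real.log 2 / (c + 1) := by positivity
  have hb := hn.bound hε
  refine squeeze_zero' (g := fun l : ℕ => ((l : ℝ))⁻¹) (Eventually.of_forall fun l => by positivity)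
    ?_ (tendsto_inv_atTop_zero.comp tendsto_natCast_atTop_atTop)
  filter_upwards [hb, eventually_ge_atTop 1] with l hl hl1
  have hl0 : (0 : ℝ) < l := by exact_mod_cast hl1
  have hlog : 0 ≤ Real.log l := Real.log_natCast_nonneg l
  rw [Real.norm_of_nonneg hlog, Real.norm_of_nonneg (Nat.cast_nonneg _)] at hl
  have h1 : (c + 1 : ℝ) * Real.log l ≤ n l * Real.log 2 := by
    have := mul_le_mul_of_nonneg_left hl (show (0 : ℝ) ≤ c + 1 by positivity)
    calc (c + 1 : ℝ) * Real.log l ≤ (c + 1) * (Real.log 2 / (c + 1) * n l) := this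
      _ = n l * Real.log 2 := by field_simp
  have h2 : (l : ℝ) ^ (c + 1) ≤ 2 ^ n l := by
    rw [← Real.log_le_log_iff (by positivity) (by positivity), Real.log_pow, Real.log_pow]
    exact_mod_cast h1
  rw [← div_eq_mul_inv, inv_eq_one_div, div_le_div_iff₀ (by positivity) hl0, one_mul,
    ← pow_succ]
  exact h2

lemma negligible_sq_div_two_pow {n t : ℕ → ℕ} (ht : PolyBounded t)
    (hn : (fun l : ℕ => Real.log (l : ℝ)) =o[Filter.atTop] (fun l : ℕ => (n l : ℝ))) :
    Negligible fun l => 6 * ((t l : ℝ) ^ 2 / 2 ^ n l) := by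
  obtain ⟨p, hp⟩ := ht
  set P : Polynomial ℝ := 6 * (p.map (Nat.castRingHom ℝ)) ^ 2 with hP
  have h := (negligible_inv_two_pow hn).polynomial_mul P
  refine h.trans_abs_le fun l => ?_
  have e : P.eval (l : ℝ) = 6 * ((p.eval l : ℕ) : ℝ) ^ 2 := by
    rw [hP, Polynomial.eval_mul, Polynomial.eval_pow, Polynomial.eval_ofNat,
      Polynomial.eval_natCast_map]
    rfl
  have hp' : (t l : ℝ) ≤ ((p.eval l : ℕ) : ℝ) := by exact_mod_cast hp l
  rw [e, abs_of_nonneg (by positivity), abs_of_nonneg (by positivity), ← mul_div_assoc,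
    div_eq_mul_inv]
  gcongr

lemma Negligible.add {ε ε' : ℕ → ℝ} (h : Negligible ε) (h' : Negligible ε') :
    Negligible fun l => ε l + ε' l := fun c => by
  simpa [mul_add] using (h c).add (h' c)

/-! ### The main theorem -/

/-- Binary phase states of a quantum-query secure PRF form a pseudorandom state generator. -/
theorem exists_isPRSGenerator_binaryPhase {n : ℕ → ℕ} (hn_poly : PolyBounded n)
    (hn_log : (fun l : ℕ => Real.log (l : ℝ)) =o[Filter.atTop] (fun l : ℕ => (n l : ℝ)))
    {F : ∀ l : ℕ, (Fin l → Bool) → (Fin (n l) → Bool) → Bool} (hF : IsQuantumQueryPRF n F) :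
    ∃ G : ∀ l : ℕ, Circuit Gate (Fin l) (Fin (n l)), IsPRSGenerator n G ∧
      ∀ (l : ℕ) (k : Fin l → Bool),
        (G l).run (basisState k) = pureState (binaryPhase (F l k)) := by
  obtain ⟨p, hp⟩ := hF.polyTime.computes
  choose G hsize hG using fun l => exists_circuit_binaryPhase (hp l)
  refine ⟨G, ⟨?_, fun l k => ⟨_, norm_binaryPhase _, hG l k⟩, ?_⟩, hG⟩
  · refine PolyBounded.mono ?_ hsize
    exact (((((PolyBounded.const 2).mul .id).add ((PolyBounded.const 3).mul hn_poly)).add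
      ((PolyBounded.const 82).mul ((PolyBounded.id.add hn_poly).eval p))).add (.const 6))
  · intro t a ρ A ht hρ hA
    choose B hBsize hB using fun l => exists_oracle_circuit (A l)
    have hBpoly : PolyBounded fun l => (B l).size :=
      PolyBounded.mono ((((ht.mul hn_poly).add ((PolyBounded.const 6).mul ht)).add hA).add
        (.const 2)) hBsize
    obtain ⟨ε, hε, hsec⟩ := hF.secure a ρ B hρ hBpoly
    -- The PRF advantage of the simulating distinguisher plus the statistical distance between
    -- random phase states and Haar states.
    refine ⟨fun l => ε l + 6 * ((t l : ℝ) ^ 2 / 2 ^ n l),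
      hε.add (negligible_sq_div_two_pow ht hn_log), fun l => ?_⟩
    obtain ⟨M, hM, hMθ⟩ := exists_effect (A l) (hρ l)
    have h1 := hsec l
    have h2 := abs_avg_binaryPhase_sub_integral_haarState_le (n l) (t l) hM
    simp only [hB, hMθ] at h1
    simp only [hG, hMθ]
    exact (abs_sub_le _ _ _).trans (add_le_add h1 h2)

end QCrypto

end

theorem mainTheorem2 (n : ℕ → ℕ) (hn_poly : QCrypto.PolyBounded n)
    (hn_log : (fun l : ℕ => Real.log (l : ℝ)) =o[Filter.atTop] (fun l : ℕ => (n l : ℝ)))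
    (F : ∀ l : ℕ, (Fin l → Bool) → (Fin (n l) → Bool) → Bool)
    (hF : QCrypto.IsQuantumQueryPRF n F) :
    ∃ G : ∀ l : ℕ, QCrypto.Circuit QCrypto.Gate (Fin l) (Fin (n l)),
      QCrypto.IsPRSGenerator n G ∧
      ∀ (l : ℕ) (k : Fin l → Bool),
        (G l).run (QCrypto.basisState k) =
          QCrypto.pureState (QCrypto.binaryPhase (F l k)) :=
  QCrypto.exists_isPRSGenerator_binaryPhase hn_poly hn_log hF
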